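/- **Theorem (hardness of PCP-Vectors).** *Model and problems.* Algorithms are deterministic programs on a random access machine with logarithmic cost (up to polylogarithmic factors this is the usual word RAM with $O(\log N)$-bit words). SETH is the hypothesis that for every $\varepsilon>0$ there is $k\ge 3$ such that no algorithm decides satisfiability of $k$-CNF formulas (sets of clauses with $k$ literals each) on $n$ variables in time $O(2^{(1-\varepsilon)n})$. An instance of PCP-Vectors consists of finite index sets $L\neq\emptyset$, $K$, a finite alphabet $\Sigma$, and nonempty sets of vectors $A\subseteq\Sigma^{L\times K}$ and $B\subseteq\Sigma^{L}$, all given explicitly; $N=|A|+|B|$ is its number of vectors, and for $a\in A$, $b\in B$ the score is $$s(a,b)=\Pr_{\ell\in L}\Big[\bigvee_{k\in K}\,(a_{\ell,k}=b_\ell)\Big],\qquad \ell\text{ uniform in }L.$$ *Statement.* Assume SETH. There are functions $\eta,\delta:\mathbb N\to\mathbb R$ with $\eta(N)\to0$ and $\delta(N)\to0$ as $N\to\infty$ such that for every $\varepsilon>0$ no algorithm with running time $O(N^{2-\varepsilon})$, given an instance of PCP-Vectors with $N$ vectors and $|L|,|K|,|\Sigma|\le N^{\eta(N)}$, distinguishes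 between the two cases * (Completeness) there exist $a^*\in A$, $b^*\in B$ with $s(a^*,b^*)=1$; * (Soundness) $s(a,b)\le 1/2^{(\log_2 N)^{1-\delta(N)}}$ for all $a\in A$, $b\in B$. (The algorithm is only required to be correct, and to obey the time bound, on instances in one of the two cases.) -/

import Mathlib

open Filter Topology

namespace RAM

/-- Binary arithmetic operations of the machine, on natural numbers. -/
inductive Op
  | add | sub | mul | div | mod

/-- Subtraction is truncated at zero. -/
def Op.eval : Op → ℕ → ℕ → ℕ
  | .add, x, y => x + y
  | .sub, x, y => x - y
  | .mul, x, y => x * y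
  | .div, x, y => x / y
  | .mod, x, y => x % y

/-- The memory of a random access machine: registers, and arrays that can be addressed indirectly.
A program mentions only finitely many registers and arrays. -/
structure State where
  reg : ℕ → ℕ
  arr : ℕ → ℕ → ℕ

/-- Expressions: constants, registers, cells of arrays (`get a e` is the cell of array `a` whose
address is the value of `e`), and arithmetic. -/
inductive Expr
  | lit (c : ℕ)
  | reg (x : ℕ)
  | get (a : ℕ) (e : Expr)
  | op (o : Op) (e f : Expr)

def Expr.eval (s : State) : Expr → ℕ
  | .lit c => c
  | .reg x => s.reg x
  | .get a e => s.arr a (e.eval s)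
  | .op o e f => o.eval (e.eval s) (f.eval s)

/-- Logarithmic cost of evaluating an expression: every value that is read or computed on the way,
addresses included, is charged one plus its bit length. -/
def Expr.cost (s : State) : Expr → ℕ
  | .lit c => 1 + c.size
  | .reg x => 1 + (s.reg x).size
  | .get a e => e.cost s + (1 + (s.arr a (e.eval s)).size)
  | .op o e f => e.cost s + f.cost s + (1 + (o.eval (e.eval s) (f.eval s)).size)

/-- Programs of the machine. `assign x e` writes the value of `e` to register `x`; `store a i e`
writes the value of `e` to the cell of array `a` whose address is the value of `i`; `cond e p q`
runs `p` if the value of `e` is nonzero and `q` otherwise; `loop e p` repeats `p` as long as the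
value of `e` is nonzero. -/
inductive Prog
  | skip
  | assign (x : ℕ) (e : Expr)
  | store (a : ℕ) (i e : Expr)
  | seq (p q : Prog)
  | cond (e : Expr) (p q : Prog)
  | loop (e : Expr) (p : Prog)

/-- `Exec p s t s'`: started in state `s`, the program `p` halts in state `s'` after time `t`
(logarithmic cost). -/
inductive Exec : Prog → State → ℕ → State → Prop
  | skip (s : State) : Exec .skip s 1 s
  | assign (s : State) (x : ℕ) (e : Expr) :
      Exec (.assign x e) s (1 + e.cost s) { s with reg := Function.update s.reg x (e.eval s) }
  | store (s : State) (a : ℕ) (i e : Expr) :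
      Exec (.store a i e) s (1 + i.cost s + e.cost s)
        { s with arr :=
          Function.update s.arr a (Function.update (s.arr a) (i.eval s) (e.eval s)) }
  | seq {p q : Prog} {s s₁ s₂ : State} {t₁ t₂ : ℕ} :
      Exec p s t₁ s₁ → Exec q s₁ t₂ s₂ → Exec (.seq p q) s (t₁ + t₂) s₂
  | cond_true {e : Expr} {p q : Prog} {s s₁ : State} {t : ℕ} :
      e.eval s ≠ 0 → Exec p s t s₁ → Exec (.cond e p q) s (1 + e.cost s + t) s₁
  | cond_false {e : Expr} {p q : Prog} {s s₁ : State} {t : ℕ} :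
      e.eval s = 0 → Exec q s t s₁ → Exec (.cond e p q) s (1 + e.cost s + t) s₁
  | loop_stop {e : Expr} {p : Prog} {s : State} :
      e.eval s = 0 → Exec (.loop e p) s (1 + e.cost s) s
  | loop_step {e : Expr} {p : Prog} {s s₁ s₂ : State} {t₁ t₂ : ℕ} :
      e.eval s ≠ 0 → Exec p s t₁ s₁ → Exec (.loop e p) s₁ t₂ s₂ →
      Exec (.loop e p) s (1 + e.cost s + t₁ + t₂) s₂

/-- Initially the input occupies the first cells of array `0`, and everything else is zero. -/
def init (l : List ℕ) : State where
  reg := fun _ => 0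
  arr := fun a i => if a = 0 then l.getD i 0 else 0

/-- On input `l`, program `p` halts within time `T` with answer yes (register `0` holds `1`). -/
def AcceptsWithin (p : Prog) (l : List ℕ) (T : ℝ) : Prop :=
  ∃ t s, Exec p (init l) t s ∧ (t : ℝ) ≤ T ∧ s.reg 0 = 1

/-- On input `l`, program `p` halts within time `T` with answer no (register `0` holds `0`). -/
def RejectsWithin (p : Prog) (l : List ℕ) (T : ℝ) : Prop :=
  ∃ t s, Exec p (init l) t s ∧ (t : ℝ) ≤ T ∧ s.reg 0 = 0

end RAM

/-- A `k`-CNF formula on `n` variables: a set of clauses (listed without repetition), each of which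
is a disjunction of `k` literals. The literal `(v, b)` is true iff the variable `v` has value `b`. -/
structure KCNF (k n : ℕ) where
  clauses : List (Fin k → Fin n × Bool)
  nodup : clauses.Nodup

def KCNF.Satisfiable {k n : ℕ} (φ : KCNF k n) : Prop :=
  ∃ x : Fin n → Bool, ∀ c ∈ φ.clauses, ∃ i, x (c i).1 = (c i).2

/-- The input of a `k`-SAT algorithm: the number of variables, the number of clauses, and then the
literals of the clauses, one number for each. -/
def KCNF.encode {k n : ℕ} (φ : KCNF k n) : List ℕ :=
  n :: φ.clauses.length ::
    φ.clauses.flatMap fun c => List.ofFn fun i => 2 * ((c i).1 : ℕ) + (c i).2.toNat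

/-- The algorithm `p` solves `k`-SAT on `n` variables in time `O(2 ^ ((1 - ε) n))`. -/
def SolvesKSAT (k : ℕ) (ε : ℝ) (p : RAM.Prog) : Prop :=
  ∃ C : ℝ, ∀ (n : ℕ) (φ : KCNF k n),
    (φ.Satisfiable → RAM.AcceptsWithin p φ.encode (C * (2 : ℝ) ^ ((1 - ε) * (n : ℝ)))) ∧
    (¬ φ.Satisfiable → RAM.RejectsWithin p φ.encode (C * (2 : ℝ) ^ ((1 - ε) * (n : ℝ))))

/-- The Strong Exponential Time Hypothesis. -/
def SETH : Prop :=
  ∀ ε : ℝ, 0 < ε → ∃ k : ℕ, 3 ≤ k ∧ ¬ ∃ p : RAM.Prog, SolvesKSAT k ε p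

/-- An instance of PCP-Vectors: nonempty sets `A ⊆ Σ^(L × K)` and `B ⊆ Σ^L` (listed without
repetition), where the three finite sets are `Fin L`, `Fin K` and `Fin S`. -/
structure PCPVectors where
  L : ℕ
  K : ℕ
  S : ℕ
  A : List (Fin L → Fin K → Fin S)
  B : List (Fin L → Fin S)
  L_pos : 0 < L
  A_nodup : A.Nodup
  B_nodup : B.Nodup
  A_ne_nil : A ≠ []
  B_ne_nil : B ≠ []

namespace PCPVectors

/-- The number of vectors of the instance. -/
def N (I : PCPVectors) : ℕ := I.A.length + I.B.length

/-- The probability over a uniform `l` that `a l k = b l` for some `k`. -/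
noncomputable def score {L K S : ℕ} (a : Fin L → Fin K → Fin S) (b : Fin L → Fin S) : ℝ :=
  ((Finset.univ.filter fun l : Fin L => ∃ k : Fin K, a l k = b l).card : ℝ) / (L : ℝ)

/-- The input of an algorithm: the five sizes, and then the entries of all vectors. -/
def encode (I : PCPVectors) : List ℕ :=
  I.L :: I.K :: I.S :: I.A.length :: I.B.length ::
    ((I.A.flatMap fun a => (List.ofFn fun l => List.ofFn fun k => (a l k : ℕ)).flatten) ++
      I.B.flatMap fun b => List.ofFn fun l => (b l : ℕ))

/-- Some pair of vectors has score `1`. -/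
def Complete (I : PCPVectors) : Prop :=
  ∃ a ∈ I.A, ∃ b ∈ I.B, score a b = 1

/-- Every pair of vectors has score at most `τ`. -/
def Sound (I : PCPVectors) (τ : ℝ) : Prop :=
  ∀ a ∈ I.A, ∀ b ∈ I.B, score a b ≤ τ

/-- The algorithm `p` distinguishes, in time `O(N ^ r)`, instances with a pair of score `1` from
instances all of whose pairs have score at most `1 / 2 ^ ((log N) ^ (1 - δ N))`, as long as
`|L|, |K|, |Σ| ≤ N ^ (η N)`. Nothing is required of `p` on any other input. -/
def Distinguishes (p : RAM.Prog) (η δ : ℕ → ℝ) (r : ℝ) : Prop :=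
  ∃ C : ℝ, ∀ I : PCPVectors,
    (I.L : ℝ) ≤ (I.N : ℝ) ^ η I.N → (I.K : ℝ) ≤ (I.N : ℝ) ^ η I.N →
    (I.S : ℝ) ≤ (I.N : ℝ) ^ η I.N →
    (I.Complete → RAM.AcceptsWithin p I.encode (C * (I.N : ℝ) ^ r)) ∧
    (I.Sound (1 / (2 : ℝ) ^ (Real.logb 2 (I.N : ℝ) ^ (1 - δ I.N))) →
      RAM.RejectsWithin p I.encode (C * (I.N : ℝ) ^ r))

end PCPVectors

/-! Suppose that a program distinguishes the two cases in time `O(N ^ (2 - ε))`. A `k`-CNF on `n`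
variables is decided by splitting the variables into two blocks of size about `h = n / 2` and giving
every partial assignment of either block a 0/1 vector with one coordinate per clause, namely "no
literal of this clause is made true here". A satisfying assignment is then an orthogonal pair. A
communication protocol turns orthogonality into score `1` and everything else into tiny score.

Sparsification. The original clauses are too many to serve as coordinates. As long as many clauses
of one size share a common part (a flower with a heart), the formula branches: either the heart or
all petals are added as new clauses, and supersets are dropped. A potential function shows that at
most `O(n / D)` steps add petals (`Inv.add`, `steps_le`). For polylogarithmic `D` the choice of
these steps costs a factor `2 ^ o(n)`, and at most `n` times polylog clauses remain when no flower
is left (`Good.card_le`). Every branch implies the formula (`sat_of_sat_runc`), and every satisfying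
assignment survives in some branch (`exists_petal_steps`).

Protocol. The coordinates form a `g × T` grid with `g` slightly sublinear in `h` and `T`
polylogarithmic. For each `w < T` the two vectors yield polynomials `A_w` and `B_w` over a prime
field, with the exponents of `B_w` reversed, so that the inner product is the coefficient of degree
`g - 1` of `∑ A_w B_w`. A prover announces this polynomial with that coefficient set to zero; there
are only `2 ^ o(h)` announcements, and all of them are tried. The second player sends the values
`B_w(t)` at `R` random points `t`, and the first player compares with the announcement. A false
announcement passes with probability at most `(2 g / q) ^ R ≤ 2 ^ (-R)` (`card_accept_le`,
`score_le`). In the instance, `ℓ` is the random string, `b_ℓ` is the message, and the entries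
`a_{ℓ,k}` list the accepted messages, so the score is the acceptance probability (`score_eq`).

For every piece of advice (branch and announcement) the instance lies in one of the two cases, and
it is complete only if the formula is satisfiable; hence the distinguisher never meets an instance
outside the promise. Running it on all `2 ^ o(h)` instances takes time `2 ^ ((2 - ε / 2) h)` for
large `h`, against SETH. The functions `eta` and `delta` do not depend on `k`, as they must not,
because SETH provides `k` only after `ε`.

On the machine, `Feas` describes functions computable in polynomial time, closed under arithmetic
and bounded recursion. Single entries of the instances are feasible in terms of `h`, and
`exists_search` runs the given program on all instances in disjoint parts of the memory. -/

namespace RAM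

/-! ### Polynomially bounded functions -/

/-- `g` is bounded by a polynomial in the size measure `sz`. -/
def PolyBd {α : Type} (sz g : α → ℕ) : Prop := ∃ c, ∀ a, g a ≤ (sz a + 2) ^ c

namespace PolyBd
variable {α β : Type} {sz f g : α → ℕ}

theorem mono (hg : PolyBd sz g) (h : ∀ a, f a ≤ g a) : PolyBd sz f :=
  hg.imp fun _ hc a => (h a).trans (hc a)

theorem const (sz : α → ℕ) (n : ℕ) : PolyBd sz fun _ => n :=
  ⟨n, fun a => (Nat.lt_two_pow_self (n := n)).le.trans (Nat.pow_le_pow_left (by omega) _)⟩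

theorem size (sz : α → ℕ) : PolyBd sz sz := ⟨1, fun a => by simp⟩

theorem mul (hf : PolyBd sz f) (hg : PolyBd sz g) : PolyBd sz fun a => f a * g a := by
  obtain ⟨c, hc⟩ := hf
  obtain ⟨d, hd⟩ := hg
  exact ⟨c + d, fun a => (Nat.mul_le_mul (hc a) (hd a)).trans (pow_add _ _ _).ge⟩

theorem add (hf : PolyBd sz f) (hg : PolyBd sz g) : PolyBd sz fun a => f a + g a := by
  obtain ⟨c, hc⟩ := hf
  obtain ⟨d, hd⟩ := hg
  refine ⟨c + d + 1, fun a => ?_⟩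
  have h1 : (sz a + 2) ^ c ≤ (sz a + 2) ^ (c + d) := Nat.pow_le_pow_right (by omega) (by omega)
  have h2 : (sz a + 2) ^ d ≤ (sz a + 2) ^ (c + d) := Nat.pow_le_pow_right (by omega) (by omega)
  -- The base is at least two, so one more power pays for the sum of two bounds.
  have h3 : (sz a + 2) ^ (c + d) * 2 ≤ (sz a + 2) ^ (c + d) * (sz a + 2) :=
    Nat.mul_le_mul_left _ (by omega)
  rw [pow_succ]
  have := hc a
  have := hd a
  dsimp only
  omega

theorem pow (hf : PolyBd sz f) (n : ℕ) : PolyBd sz fun a => f a ^ n := by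
  obtain ⟨c, hc⟩ := hf
  exact ⟨c * n, fun a => (Nat.pow_le_pow_left (hc a) n).trans (pow_mul _ _ _).ge⟩

theorem comp (hf : PolyBd sz f) (π : β → α) : PolyBd (fun b => sz (π b)) fun b => f (π b) :=
  hf.imp fun _ hc b => hc (π b)

end PolyBd

theorem size_add_le (x y : ℕ) : (x + y).size ≤ x.size + y.size + 1 := by
  rw [Nat.size_le]
  have hx := Nat.lt_size_self x
  have hy := Nat.lt_size_self y
  have h1 : 2 ^ x.size ≤ 2 ^ (x.size + y.size) := Nat.pow_le_pow_right (by omega) (by omega)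
  have h2 : 2 ^ y.size ≤ 2 ^ (x.size + y.size) := Nat.pow_le_pow_right (by omega) (by omega)
  rw [pow_succ]
  omega

theorem size_mul_le (x y : ℕ) : (x * y).size ≤ x.size + y.size := by
  rw [Nat.size_le, pow_add]
  exact Nat.mul_lt_mul'' (Nat.lt_size_self x) (Nat.lt_size_self y)

theorem size_le_self (x : ℕ) : x.size ≤ x := Nat.size_le.2 Nat.lt_two_pow_self

theorem size_pow_le (x n : ℕ) : (x ^ n).size ≤ x.size * n + 1 := by
  rw [Nat.size_le]
  calc x ^ n ≤ (2 ^ x.size) ^ n := Nat.pow_le_pow_left (Nat.lt_size_self x).le n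
    _ = 2 ^ (x.size * n) := (pow_mul _ _ _).symm
    _ < _ := Nat.pow_lt_pow_right (by omega) (by omega)

theorem Op.size_eval_le (o : Op) (x y : ℕ) : (o.eval x y).size ≤ x.size + y.size + 1 := by
  cases o <;> simp only [Op.eval]
  · exact size_add_le x y
  · exact (Nat.size_le_size (Nat.sub_le x y)).trans (by omega)
  · exact (size_mul_le x y).trans (by omega)
  · exact (Nat.size_le_size (Nat.div_le_self x y)).trans (by omega)
  · exact (Nat.size_le_size (Nat.mod_le x y)).trans (by omega)

/-! ### Feasible functions -/

/-- The context of a computation on instances from `α`: the size of an instance, the input array,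
and the functions whose values are available in registers. -/
structure Ctx (α : Type) where
  size : α → ℕ
  inp : α → ℕ → ℕ
  vars : Set (α → ℕ)
  vars_bd : ∀ v ∈ vars, PolyBd size fun a => (v a).size

/-- With the variables of the context in the registers `ρ v`, the program `p` writes `f` to
register `b` in time `T`, and changes neither lower registers nor arrays. -/
def Computes {α : Type} (Γ : Ctx α) (b : ℕ) (ρ : (α → ℕ) → ℕ) (p : Prog) (f T : α → ℕ) : Prop :=
  ∀ a s, (∀ v ∈ Γ.vars, s.reg (ρ v) = v a) → s.arr 0 = Γ.inp a →
    ∃ t s', Exec p s t s' ∧ t ≤ T a ∧ s'.reg b = f a ∧ (∀ r < b, s'.reg r = s.reg r) ∧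
      s'.arr = s.arr

/-- `f` can be computed in polynomial time from the variables and the input array. -/
def Feas {α : Type} (Γ : Ctx α) (f : α → ℕ) : Prop :=
  ∃ T : α → ℕ, PolyBd Γ.size T ∧ (∀ a, (f a).size ≤ T a) ∧
    ∀ b ρ, (∀ v ∈ Γ.vars, ρ v < b) → ∃ p, Computes Γ b ρ p f T

theorem Exec.cast {p : Prog} {s s' : State} {t t' : ℕ} (h : Exec p s t s') (e : t = t') :
    Exec p s t' s' := e ▸ h

/-- A loop that is repeated `n` times. -/
theorem Exec.loop_of_invariant {e : Expr} {p : Prog} {c τ : ℕ} (n : ℕ) (Inv : ℕ → State → Prop)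
    (hstep : ∀ i s, i < n → Inv i s → e.eval s ≠ 0 ∧ e.cost s ≤ c ∧
      ∃ t s', Exec p s t s' ∧ t ≤ τ ∧ Inv (i + 1) s')
    (hend : ∀ s, Inv n s → e.eval s = 0 ∧ e.cost s ≤ c) (s : State) (h0 : Inv 0 s) :
    ∃ t s', Exec (.loop e p) s t s' ∧ t ≤ (n + 1) * (1 + c + τ) ∧ Inv n s' := by
  suffices H : ∀ m i s, i + m = n → Inv i s →
      ∃ t s', Exec (.loop e p) s t s' ∧ t ≤ (m + 1) * (1 + c + τ) ∧ Inv n s' by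
    simpa using H n 0 s (by simp) h0
  intro m
  induction m with
  | zero =>
    intro i s hi h
    obtain rfl : i = n := by simpa using hi
    obtain ⟨h1, h2⟩ := hend s h
    exact ⟨_, s, Exec.loop_stop h1, by omega, h⟩
  | succ m ih =>
    intro i s hi h
    obtain ⟨h1, h2, t, s₁, h3, h4, h5⟩ := hstep i s (by omega) h
    obtain ⟨t', s', h6, h7, h8⟩ := ih (i + 1) s₁ (by omega) h5
    refine ⟨_, s', .loop_step h1 h3 h6, ?_, h8⟩
    rw [add_mul (m + 1) 1]
    omega

namespace Ctx
variable {α : Type}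

/-- Instances together with an index below `n`. -/
abbrev Ix (n : α → ℕ) : Type := Σ a : α, Fin (n a)

/-- The context of a loop body: the index and the functions `w` are additional variables. -/
def ext (Γ : Ctx α) (n : α → ℕ) (w : Set (Ix n → ℕ))
    (hw : ∀ v ∈ w, PolyBd (fun x : Ix n => Γ.size x.1) fun x => (v x).size) : Ctx (Ix n) where
  size x := Γ.size x.1
  inp x := Γ.inp x.1
  vars := w ∪ (fun v x => v x.1) '' Γ.vars
  vars_bd := by
    rintro v (hv | ⟨v, hv, rfl⟩)
    · exact hw v hv
    · exact (Γ.vars_bd v hv).comp _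

end Ctx

namespace Feas
variable {α : Type} {Γ : Ctx α} {f g : α → ℕ}

theorem size_bd (hf : Feas Γ f) : PolyBd Γ.size fun a => (f a).size := by
  obtain ⟨T, hT, h, -⟩ := hf
  exact hT.mono h

theorem congr (hf : Feas Γ f) (h : ∀ a, f a = g a) : Feas Γ g := (funext h : f = g) ▸ hf

theorem const (n : ℕ) : Feas Γ fun _ => n := by
  refine ⟨fun _ => 2 + n.size, .const _ _, fun _ => by dsimp only; omega, fun b ρ _ => ?_⟩
  refine ⟨.assign b (.lit n), fun a s _ _ => ⟨_, _, .assign s b _, ?_, ?_, ?_, rfl⟩⟩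
  · simp only [Expr.cost]; omega
  · simp [Expr.eval]
  · intro r hr
    simp [Function.update_of_ne hr.ne]

theorem var {v : α → ℕ} (hv : v ∈ Γ.vars) : Feas Γ v := by
  refine ⟨fun a => 2 + (v a).size, (PolyBd.const _ 2).add (Γ.vars_bd v hv), fun _ => by dsimp only; omega,
    fun b ρ _ => ?_⟩
  refine ⟨.assign b (.reg (ρ v)), fun a s h _ => ⟨_, _, .assign s b _, ?_, ?_, ?_, rfl⟩⟩
  · simp only [Expr.cost, h v hv]; omega
  · simp [Expr.eval, h v hv]
  · intro r hr
    simp [Function.update_of_ne hr.ne]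

/-- Reading a cell is charged the bit length of its content, which the feasibility of the address
does not control; hence the hypothesis `hb`. -/
theorem input (hf : Feas Γ f) (hb : PolyBd Γ.size fun a => (Γ.inp a (f a)).size) :
    Feas Γ fun a => Γ.inp a (f a) := by
  obtain ⟨T, hT, hs, h⟩ := hf
  refine ⟨fun a => T a + (3 + T a + (Γ.inp a (f a)).size),
    hT.add (((PolyBd.const _ 3).add hT).add hb), fun _ => by dsimp only; omega, fun b ρ hρ => ?_⟩
  obtain ⟨p, hp⟩ := h b ρ hρ
  refine ⟨.seq p (.assign b (.get 0 (.reg b))), fun a s hv hi => ?_⟩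
  obtain ⟨t, s₁, h1, h2, h3, h4, h5⟩ := hp a s hv hi
  refine ⟨_, _, .seq h1 (.assign s₁ b _), ?_, ?_, ?_, h5⟩
  · have := hs a
    simp only [Expr.cost, Expr.eval, h3, h5, hi]
    omega
  · simp [Expr.eval, h3, h5, hi]
  · intro r hr
    simp [Function.update_of_ne hr.ne, h4 r hr]

theorem op (o : Op) (hf : Feas Γ f) (hg : Feas Γ g) : Feas Γ fun a => o.eval (f a) (g a) := by
  obtain ⟨T, hT, hs, h⟩ := hf
  obtain ⟨T', hT', hs', h'⟩ := hg
  refine ⟨fun a => 3 * T a + 3 * T' a + 5, (((PolyBd.const _ 3).mul hT).add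
    ((PolyBd.const _ 3).mul hT')).add (PolyBd.const _ 5), fun a => ?_, fun b ρ hρ => ?_⟩
  · have := o.size_eval_le (f a) (g a)
    have := hs a
    have := hs' a
    dsimp only
    omega
  obtain ⟨p, hp⟩ := h b ρ hρ
  -- The second operand works from register `b + 1` on, so the first result in `b` survives. For
  -- this reason `Feas` allows every `b`, with a time bound independent of it.
  obtain ⟨p', hp'⟩ := h' (b + 1) ρ fun v hv => (hρ v hv).trans (Nat.lt_succ_self b)
  refine ⟨.seq (.seq p p') (.assign b (.op o (.reg b) (.reg (b + 1)))), fun a s hv hi => ?_⟩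
  obtain ⟨t, s₁, h1, h2, h3, h4, h5⟩ := hp a s hv hi
  obtain ⟨t', s₂, h1', h2', h3', h4', h5'⟩ := hp' a s₁
    (fun v hv' => by rw [h4 _ (hρ v hv'), hv v hv']) (by rw [h5, hi])
  have hb : s₂.reg b = f a := by rw [h4' b (Nat.lt_succ_self b), h3]
  refine ⟨_, _, .seq (.seq h1 h1') (.assign s₂ b _), ?_, ?_, ?_, by simp [h5', h5]⟩
  · have := o.size_eval_le (f a) (g a)
    have := hs a
    have := hs' a
    simp only [Expr.cost, Expr.eval, hb, h3']
    omega
  · simp [Expr.eval, hb, h3']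
  · intro r hr
    simp [Function.update_of_ne hr.ne, h4 r hr, h4' r (hr.trans (Nat.lt_succ_self b))]

theorem mono {Γ' : Ctx α} (hf : Feas Γ f) (hs : Γ'.size = Γ.size) (hi : Γ'.inp = Γ.inp)
    (hv : Γ.vars ⊆ Γ'.vars) : Feas Γ' f := by
  obtain ⟨T, hT, hs', h⟩ := hf
  refine ⟨T, hs ▸ hT, hs', fun b ρ hρ => ?_⟩
  obtain ⟨p, hp⟩ := h b ρ fun v h => hρ v (hv h)
  exact ⟨p, fun a s h1 h2 => hp a s (fun v h => h1 v (hv h)) (hi ▸ h2)⟩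

/-- Feasible functions stay feasible when instances carry additional data. -/
theorem pull {β : Type} {Γ' : Ctx β} (hf : Feas Γ f) (π : β → α)
    (hs : ∀ x, Γ'.size x = Γ.size (π x)) (hi : ∀ x, Γ'.inp x = Γ.inp (π x))
    (hv : ∀ v ∈ Γ.vars, (fun x => v (π x)) ∈ Γ'.vars) : Feas Γ' fun x => f (π x) := by
  obtain ⟨T, hT, hs', h⟩ := hf
  refine ⟨fun x => T (π x), ?_, fun x => hs' _, fun b ρ hρ => ?_⟩
  · rw [show Γ'.size = fun x => Γ.size (π x) from funext hs]
    exact hT.comp π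
  obtain ⟨p, hp⟩ := h b (fun v => ρ fun x => v (π x)) fun v h => hρ _ (hv v h)
  exact ⟨p, fun x s h1 h2 => hp (π x) s (fun v h => h1 _ (hv v h)) (h2.trans (hi x))⟩

theorem ext {n : α → ℕ} {w : Set (Ctx.Ix n → ℕ)}
    {hw : ∀ v ∈ w, PolyBd (fun x : Ctx.Ix n => Γ.size x.1) fun x => (v x).size}
    (hf : Feas Γ f) : Feas (Γ.ext n w hw) fun x => f x.1 :=
  hf.pull (Γ' := Γ.ext n w hw) (fun x => x.1) (fun _ => rfl) (fun _ => rfl) fun v hv =>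
    Or.inr ⟨v, hv, rfl⟩

theorem _root_.RAM.PolyBd.fin {sz n : α → ℕ} (hn : PolyBd sz n) :
    PolyBd (fun x : Ctx.Ix n => sz x.1) fun x => ((x.2 : ℕ)).size :=
  (hn.comp fun x : Ctx.Ix n => x.1).mono fun x => (size_le_self _).trans x.2.2.le

/-- Primitive recursion with polynomially many steps, all of whose values are short. -/
theorem fold {n : α → ℕ} (hn : Feas Γ n) (hnb : PolyBd Γ.size n) (acc : α → ℕ → ℕ)
    {S : α → ℕ} (hS : PolyBd Γ.size S) (hacc : ∀ a i, i ≤ n a → (acc a i).size ≤ S a)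
    (h0 : Feas Γ fun a => acc a 0)
    (w : Set (Ctx.Ix n → ℕ))
    (hw : ∀ v ∈ w, PolyBd (fun x : Ctx.Ix n => Γ.size x.1) fun x => (v x).size)
    (hw' : w ⊆ {fun x => acc x.1 x.2, fun x => x.2})
    (hstep : Feas (Γ.ext n w hw) fun x => acc x.1 (x.2 + 1)) :
    Feas Γ fun a => acc a (n a) := by
  classical
  obtain ⟨T₁, hT₁, hs₁, H₁⟩ := hn
  obtain ⟨T₂, hT₂, hs₂, H₂⟩ := h0
  -- The polynomial bound for `T₃` is unpacked because it depends on the instance only through its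
  -- size, and hence is uniform in the loop index.
  obtain ⟨T₃, ⟨c₃, hT₃⟩, hs₃, H₃⟩ := hstep
  let τ : α → ℕ := fun a => 2 + S a + 5 + 4 * n a + (Γ.size a + 2) ^ c₃
  have hτ : PolyBd Γ.size τ :=
    ((((PolyBd.const _ 2).add hS).add (.const _ 5)).add ((PolyBd.const _ 4).mul hnb)).add
      ⟨c₃, fun a => le_rfl⟩
  let C : α → ℕ := fun a => 3 + 3 * n a
  have hC : PolyBd Γ.size C := (PolyBd.const _ 3).add ((PolyBd.const _ 3).mul hnb)
  refine ⟨fun a => (T₁ a + T₂ a + 3) + (n a + 1) * (1 + C a + τ a) + (2 + S a), ?_, ?_, ?_⟩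
  · exact (((hT₁.add hT₂).add (.const _ 3)).add ((hnb.add (.const _ 1)).mul
      (((PolyBd.const _ 1).add hC).add hτ))).add ((PolyBd.const _ 2).add hS)
  · intro a
    have := hacc a (n a) le_rfl
    dsimp only
    omega
  intro b ρ hρ
  obtain ⟨p₁, hp₁⟩ := H₁ b ρ hρ
  obtain ⟨p₂, hp₂⟩ := H₂ (b + 1) ρ fun v hv => (hρ v hv).trans (by omega)
  let A : Ctx.Ix n → ℕ := fun x => acc x.1 x.2
  let I : Ctx.Ix n → ℕ := fun x => x.2
  -- Register `b` holds the number of rounds, `b + 1` the accumulator, `b + 2` the index, and outer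
  -- variables stay where they were. Variables are functions, so several of them may coincide; any
  -- matching register then holds the right value.
  let ρ' : (Ctx.Ix n → ℕ) → ℕ := fun v =>
    if v = A then b + 1 else if v = I then b + 2 else
      if h : ∃ u ∈ Γ.vars, (fun x : Ctx.Ix n => u x.1) = v then ρ h.choose else 0
  have hρ' : ∀ v ∈ (Γ.ext n w hw).vars, v = A ∧ ρ' v = b + 1 ∨ v = I ∧ ρ' v = b + 2 ∨
      ∃ u ∈ Γ.vars, (fun x : Ctx.Ix n => u x.1) = v ∧ ρ' v = ρ u := by
    intro v hv
    by_cases h1 : v = A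
    · exact .inl ⟨h1, if_pos h1⟩
    by_cases h2 : v = I
    · exact .inr (.inl ⟨h2, by simp only [ρ', if_neg h1, if_pos h2]⟩)
    rcases hv with hv | ⟨u, hu, huv⟩
    · rcases hw' hv with hv | hv
      · exact absurd hv h1
      · exact absurd hv h2
    · have h : ∃ u ∈ Γ.vars, (fun x : Ctx.Ix n => u x.1) = v := ⟨u, hu, huv⟩
      exact .inr (.inr ⟨h.choose, h.choose_spec.1, h.choose_spec.2, by
        simp only [ρ', if_neg h1, if_neg h2, dif_pos h]⟩)
  obtain ⟨p₃, hp₃⟩ := H₃ (b + 3) ρ' fun v hv => by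
    rcases hρ' v hv with ⟨-, h⟩ | ⟨-, h⟩ | ⟨u, hu, -, h⟩
    · omega
    · omega
    · have := hρ u hu
      omega
  let body : Prog := .seq (.seq p₃ (.assign (b + 1) (.reg (b + 3))))
    (.assign (b + 2) (.op .add (.reg (b + 2)) (.lit 1)))
  -- The loop test is a truncated subtraction: it is nonzero exactly while the index is below the
  -- number of rounds.
  refine ⟨.seq (.seq (.seq (.seq p₁ p₂) (.assign (b + 2) (.lit 0)))
    (.loop (.op .sub (.reg b) (.reg (b + 2))) body)) (.assign b (.reg (b + 1))), ?_⟩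
  intro a s hv hi
  obtain ⟨t₁, s₁, e₁, le₁, r₁, l₁, a₁⟩ := hp₁ a s hv hi
  obtain ⟨t₂, s₂, e₂, le₂, r₂, l₂, a₂⟩ := hp₂ a s₁
    (fun v hv' => by rw [l₁ _ (hρ v hv'), hv v hv']) (by rw [a₁, hi])
  let Inv : ℕ → State → Prop := fun i s' => s'.reg b = n a ∧ s'.reg (b + 1) = acc a i ∧
    s'.reg (b + 2) = i ∧ (∀ r < b, s'.reg r = s.reg r) ∧ s'.arr = s.arr
  have hcost : ∀ i s', i ≤ n a → Inv i s' →
      Expr.cost s' (.op .sub (.reg b) (.reg (b + 2))) ≤ C a := by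
    rintro i s' hin ⟨h1, h2, h3, -⟩
    have h4 := size_le_self (n a)
    have h5 := size_le_self i
    have h6 := size_le_self (n a - i)
    simp only [Expr.cost, Expr.eval, h1, h3, Op.eval, C]
    omega
  obtain ⟨t₃, s₃, e₃, le₃, ⟨h1, h2, h3, h4, h5⟩⟩ := Exec.loop_of_invariant
    (e := .op .sub (.reg b) (.reg (b + 2))) (p := body) (c := C a) (τ := τ a) (n a) Inv
    (by
      rintro i s' hin hInv
      refine ⟨?_, hcost i s' hin.le hInv, ?_⟩
      · obtain ⟨h1, h2, h3, -⟩ := hInv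
        simp only [Expr.eval, Op.eval, h1, h3]
        omega
      obtain ⟨h1, h2, h3, h4, h5⟩ := hInv
      obtain ⟨t, s₄, e₄, le₄, r₄, l₄, a₄⟩ := hp₃ ⟨a, i, hin⟩ s' (by
        intro v hv'
        rcases hρ' v hv' with ⟨rfl, h⟩ | ⟨rfl, h⟩ | ⟨u, hu, rfl, h⟩
        · rw [h, h2]
        · rw [h, h3]
        · rw [h, h4 _ (hρ u hu), hv u hu]) (by rw [h5, hi]; rfl)
      have hi2 : s₄.reg (b + 2) = i := by rw [l₄ _ (by omega), h3]
      refine ⟨_, _, .seq (.seq e₄ (.assign s₄ _ _)) (.assign _ _ _), ?_, ?_⟩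
      · have h6 := hT₃ ⟨a, i, hin⟩
        have h7 := hacc a (i + 1) hin
        have h8 := size_le_self i
        have h9 := size_le_self (i + 1)
        have h10 : Nat.size 1 = 1 := Nat.size_one
        change T₃ ⟨a, i, hin⟩ ≤ (Γ.size a + 2) ^ c₃ at h6
        change s₄.reg (b + 3) = acc a (i + 1) at r₄
        simp only [Expr.cost, Expr.eval, Op.eval, r₄, τ,
          Function.update_of_ne (show b + 2 ≠ b + 1 by omega), hi2]
        omega
      · refine ⟨?_, ?_, ?_, ?_, ?_⟩
        · simp [Function.update_of_ne, l₄, h1]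
        · simpa [Expr.eval, Function.update_of_ne] using r₄
        · simp [Expr.eval, Op.eval, hi2]
        · intro r hr
          rw [← h4 r hr, ← l₄ r (by omega)]
          simp [Function.update_of_ne (show r ≠ b + 1 by omega),
            Function.update_of_ne (show r ≠ b + 2 by omega)]
        · simpa [a₄] using h5)
    (by
      intro s' hInv
      refine ⟨?_, hcost _ s' le_rfl hInv⟩
      obtain ⟨h1, h2, h3, -⟩ := hInv
      simp [Expr.eval, Op.eval, h1, h3])
    { s₂ with reg := Function.update s₂.reg (b + 2) ((Expr.lit 0).eval s₂) }
    (by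
      refine ⟨?_, ?_, ?_, ?_, ?_⟩
      · simp [Function.update_of_ne, l₂, r₁]
      · simp [Function.update_of_ne, r₂]
      · simp [Expr.eval]
      · intro r hr
        simp [Function.update_of_ne (show r ≠ b + 2 by omega), l₂ r (by omega), l₁ r hr]
      · simp [a₂, a₁])
  refine ⟨_, _, .seq (.seq (.seq (.seq e₁ e₂) (.assign s₂ _ _)) e₃) (.assign s₃ _ _), ?_, ?_, ?_,
    h5⟩
  · have := hacc a (n a) le_rfl
    have h6 : Nat.size 0 = 0 := Nat.size_zero
    simp only [Expr.cost, h2, h6]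
    omega
  · simp [Expr.eval, h2]
  · intro r hr
    simp [Function.update_of_ne hr.ne, h4 r hr]

end Feas
end RAM

/-! ### Feasible predicates, bounded sums and searches, digits and bit masks -/

namespace RAM

/-- The truth value of a proposition. -/
noncomputable def ind (P : Prop) : ℕ := open Classical in if P then 1 else 0

theorem ind_true {P : Prop} (h : P) : ind P = 1 := if_pos h
theorem ind_le_one (P : Prop) : ind P ≤ 1 := by by_cases h : P <;> simp [ind, h]
theorem ind_eq_one {P : Prop} : ind P = 1 ↔ P := by by_cases h : P <;> simp [ind, h]
theorem ind_eq_zero {P : Prop} : ind P = 0 ↔ ¬P := by by_cases h : P <;> simp [ind, h]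
theorem ind_congr {P Q : Prop} (h : P ↔ Q) : ind P = ind Q := by rw [propext h]

/-- Feasible functions with polynomially bounded values. -/
def FeasU {α : Type} (Γ : Ctx α) (f : α → ℕ) : Prop := Feas Γ f ∧ PolyBd Γ.size f

/-- Feasible predicates. -/
def FeasP {α : Type} (Γ : Ctx α) (P : α → Prop) : Prop := Feas Γ fun a => ind (P a)

/-- The context of a loop body with the index as additional variable. -/
def Ctx.idx {α : Type} (Γ : Ctx α) (n : α → ℕ) (hn : PolyBd Γ.size n) : Ctx (Ctx.Ix n) :=
  Γ.ext n {fun x => x.2} fun _ hv => hv ▸ hn.fin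

section
variable {α : Type} {Γ : Ctx α} {f g n : α → ℕ} {P Q : α → Prop}

theorem Feas.add (hf : Feas Γ f) (hg : Feas Γ g) : Feas Γ fun a => f a + g a := hf.op .add hg
theorem Feas.sub (hf : Feas Γ f) (hg : Feas Γ g) : Feas Γ fun a => f a - g a := hf.op .sub hg
theorem Feas.mul (hf : Feas Γ f) (hg : Feas Γ g) : Feas Γ fun a => f a * g a := hf.op .mul hg
theorem Feas.div (hf : Feas Γ f) (hg : Feas Γ g) : Feas Γ fun a => f a / g a := hf.op .div hg
theorem Feas.mod (hf : Feas Γ f) (hg : Feas Γ g) : Feas Γ fun a => f a % g a := hf.op .mod hg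

theorem Feas.idx {hn : PolyBd Γ.size n} (hf : Feas Γ f) : Feas (Γ.idx n hn) fun x => f x.1 :=
  hf.ext

namespace FeasU
theorem const (n : ℕ) : FeasU Γ fun _ => n := ⟨.const n, .const _ n⟩
theorem add (hf : FeasU Γ f) (hg : FeasU Γ g) : FeasU Γ fun a => f a + g a :=
  ⟨hf.1.add hg.1, hf.2.add hg.2⟩
theorem mul (hf : FeasU Γ f) (hg : FeasU Γ g) : FeasU Γ fun a => f a * g a :=
  ⟨hf.1.mul hg.1, hf.2.mul hg.2⟩
theorem sub (hf : FeasU Γ f) (hg : Feas Γ g) : FeasU Γ fun a => f a - g a :=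
  ⟨hf.1.sub hg, hf.2.mono fun _ => Nat.sub_le _ _⟩
theorem div (hf : FeasU Γ f) (hg : Feas Γ g) : FeasU Γ fun a => f a / g a :=
  ⟨hf.1.div hg, hf.2.mono fun _ => Nat.div_le_self _ _⟩
theorem mod (hf : FeasU Γ f) (hg : Feas Γ g) : FeasU Γ fun a => f a % g a :=
  ⟨hf.1.mod hg, hf.2.mono fun _ => Nat.mod_le _ _⟩
theorem pow (hf : FeasU Γ f) : ∀ k : ℕ, FeasU Γ fun a => f a ^ k
  | 0 => const 1
  | k + 1 => (pow hf k).mul hf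
theorem idx {hn : PolyBd Γ.size n} (hf : FeasU Γ f) : FeasU (Γ.idx n hn) fun x => f x.1 :=
  ⟨hf.1.idx, hf.2.comp _⟩
theorem var {hn : PolyBd Γ.size n} : FeasU (Γ.idx n hn) fun x => (x.2 : ℕ) :=
  ⟨.var (Or.inl rfl), (hn.comp fun x : Ctx.Ix n => x.1).mono fun x => x.2.2.le⟩
end FeasU

theorem size_sum_le {n S : ℕ} {f : ℕ → ℕ} (h : ∀ i < n, (f i).size ≤ S) :
    (∑ i ∈ Finset.range n, f i).size ≤ n + S := by
  rw [Nat.size_le]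
  have h1 : ∑ i ∈ Finset.range n, f i ≤ n * 2 ^ S := by
    refine (Finset.sum_le_card_nsmul _ _ (2 ^ S) fun i hi => ?_).trans (by simp)
    exact (Nat.size_le.1 (h i (Finset.mem_range.1 hi))).le
  calc _ ≤ n * 2 ^ S := h1
    _ < 2 ^ n * 2 ^ S := Nat.mul_lt_mul_of_pos_right Nat.lt_two_pow_self (by positivity)
    _ = _ := (pow_add _ _ _).symm

theorem Feas.sum (hn : FeasU Γ n) {f : α → ℕ → ℕ}
    (hf : Feas (Γ.idx n hn.2) fun x => f x.1 x.2) :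
    Feas Γ fun a => ∑ i ∈ Finset.range (n a), f a i := by
  obtain ⟨c, hc⟩ := hf.size_bd
  have hS : PolyBd Γ.size fun a => n a + (Γ.size a + 2) ^ c := hn.2.add ⟨c, fun a => le_rfl⟩
  have hsz : ∀ a i, i ≤ n a → (∑ j ∈ Finset.range i, f a j).size ≤ n a + (Γ.size a + 2) ^ c :=
    fun a i hi => (size_sum_le (S := (Γ.size a + 2) ^ c) fun j hj =>
      hc ⟨a, j, hj.trans_le hi⟩).trans (by omega)
  have hw : ∀ v ∈ ({fun x => ∑ i ∈ Finset.range (x.2 : ℕ), f x.1 i, fun x => (x.2 : ℕ)} :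
      Set (Ctx.Ix n → ℕ)), PolyBd (fun x : Ctx.Ix n => Γ.size x.1) fun x => (v x).size := by
    rintro v (rfl | rfl)
    · exact (hS.comp fun x : Ctx.Ix n => x.1).mono fun x => hsz _ _ x.2.2.le
    · exact hn.2.fin
  refine Feas.fold hn.1 hn.2 (fun a i => ∑ j ∈ Finset.range i, f a j) hS hsz
    (by simpa using Feas.const 0) _ hw (fun _ h => h) ?_
  have h1 : Feas (Γ.ext n _ hw) fun x => ∑ i ∈ Finset.range (x.2 : ℕ), f x.1 i :=
    .var (Or.inl (Or.inl rfl))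
  have h2 : Feas (Γ.ext n _ hw) fun x => f x.1 x.2 := hf.mono rfl rfl (by
    rintro v (rfl | hv)
    · exact Or.inl (Or.inr rfl)
    · exact Or.inr hv)
  exact (h1.add h2).congr fun x => (Finset.sum_range_succ _ _).symm

theorem FeasU.sum (hn : FeasU Γ n) {f : α → ℕ → ℕ}
    (hf : FeasU (Γ.idx n hn.2) fun x => f x.1 x.2) :
    FeasU Γ fun a => ∑ i ∈ Finset.range (n a), f a i := by
  refine ⟨.sum hn hf.1, ?_⟩
  obtain ⟨c, hc⟩ := hf.2
  refine (hn.2.mul ⟨c, fun a => le_rfl⟩).mono fun a => ?_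
  exact (Finset.sum_le_card_nsmul _ _ ((Γ.size a + 2) ^ c) fun i hi =>
    hc ⟨a, i, Finset.mem_range.1 hi⟩).trans (by simp)

theorem Feas.pow (hf : Feas Γ f) (hn : FeasU Γ n) : Feas Γ fun a => f a ^ n a := by
  have hS : PolyBd Γ.size fun a => (f a).size * n a + 1 := (hf.size_bd.mul hn.2).add (.const _ 1)
  have hsz : ∀ a i, i ≤ n a → (f a ^ i).size ≤ (f a).size * n a + 1 := fun a i hi =>
    (size_pow_le _ _).trans (by have := Nat.mul_le_mul_left (f a).size hi; omega)
  have hw : ∀ v ∈ ({fun x => f x.1 ^ (x.2 : ℕ)} :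
      Set (Ctx.Ix n → ℕ)), PolyBd (fun x : Ctx.Ix n => Γ.size x.1) fun x => (v x).size := by
    rintro v rfl
    exact (hS.comp fun x : Ctx.Ix n => x.1).mono fun x => hsz _ _ x.2.2.le
  refine Feas.fold hn.1 hn.2 (fun a i => f a ^ i) hS hsz
    (by simpa using Feas.const 1) _ hw (fun _ h => Or.inl h) ?_
  have hv : Feas (Γ.ext n _ hw) fun x => f x.1 ^ (x.2 : ℕ) := .var (Or.inl rfl)
  exact Feas.congr (hv.mul hf.ext) fun x => (pow_succ _ _).symm

namespace FeasP

theorem feasU (hP : FeasP Γ P) : FeasU Γ fun a => ind (P a) :=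
  ⟨hP, (PolyBd.const _ 1).mono fun _ => ind_le_one _⟩

theorem congr (hP : FeasP Γ P) (h : ∀ a, P a ↔ Q a) : FeasP Γ Q :=
  Feas.congr hP fun a => ind_congr (h a)

theorem idx {hn : PolyBd Γ.size n} (hP : FeasP Γ P) : FeasP (Γ.idx n hn) fun x => P x.1 :=
  Feas.idx hP

/-- With truncated subtraction, `1 - (1 - x)` is the indicator of `0 < x`. All comparisons, and
bounded quantifiers through sums, reduce to this test. -/
theorem pos (hf : Feas Γ f) : FeasP Γ fun a => 0 < f a :=
  Feas.congr ((Feas.const 1).sub ((Feas.const 1).sub hf)) fun a => by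
    by_cases h : 0 < f a <;> simp only [ind, h, if_true, if_false] <;> omega

theorem not (hP : FeasP Γ P) : FeasP Γ fun a => ¬P a :=
  Feas.congr ((Feas.const 1).sub hP) fun a => by by_cases h : P a <;> simp [ind, h]

theorem and (hP : FeasP Γ P) (hQ : FeasP Γ Q) : FeasP Γ fun a => P a ∧ Q a :=
  Feas.congr (Feas.mul hP hQ) fun a => by by_cases h : P a <;> by_cases h' : Q a <;> simp [ind, h, h']

theorem or (hP : FeasP Γ P) (hQ : FeasP Γ Q) : FeasP Γ fun a => P a ∨ Q a :=
  (hP.not.and hQ.not).not.congr fun a => by tauto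

theorem imp (hP : FeasP Γ P) (hQ : FeasP Γ Q) : FeasP Γ fun a => P a → Q a :=
  (hP.not.or hQ).congr fun a => by tauto

theorem lt (hf : Feas Γ f) (hg : Feas Γ g) : FeasP Γ fun a => f a < g a :=
  (pos (hg.sub hf)).congr fun a => by omega

theorem le (hf : Feas Γ f) (hg : Feas Γ g) : FeasP Γ fun a => f a ≤ g a :=
  (lt hg hf).not.congr fun a => by omega

theorem eq (hf : Feas Γ f) (hg : Feas Γ g) : FeasP Γ fun a => f a = g a :=
  ((le hf hg).and (le hg hf)).congr fun a => by omega

theorem _root_.RAM.Feas.ite [∀ a, Decidable (P a)] (hP : FeasP Γ P) (hf : Feas Γ f) (hg : Feas Γ g) :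
    Feas Γ fun a => if P a then f a else g a :=
  Feas.congr (Feas.add (Feas.mul hP hf) (Feas.mul hP.not hg)) fun a => by
    by_cases h : P a <;> simp [ind, h]

theorem ex (hn : FeasU Γ n) {P : α → ℕ → Prop}
    (hP : FeasP (Γ.idx n hn.2) fun x => P x.1 x.2) : FeasP Γ fun a => ∃ i < n a, P a i :=
  (pos (Feas.sum hn (f := fun a i => ind (P a i)) hP)).congr fun a => by
    rw [Finset.sum_pos_iff]
    simp only [Finset.mem_range, Nat.pos_iff_ne_zero, ne_eq, ind_eq_zero, not_not]

theorem all (hn : FeasU Γ n) {P : α → ℕ → Prop}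
    (hP : FeasP (Γ.idx n hn.2) fun x => P x.1 x.2) : FeasP Γ fun a => ∀ i < n a, P a i :=
  (ex hn (P := fun a i => ¬P a i) hP.not).not.congr fun a => by push Not; rfl

end FeasP

/-- The number of indices below `n` with the property `P`. -/
noncomputable def countP (n : ℕ) (P : ℕ → Prop) : ℕ := ∑ i ∈ Finset.range n, ind (P i)

theorem countP_eq (n : ℕ) (P : ℕ → Prop) [DecidablePred P] :
    countP n P = ((Finset.range n).filter P).card := by
  rw [Finset.card_filter]
  exact Finset.sum_congr rfl fun i _ => by by_cases h : P i <;> simp [ind, h]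

theorem FeasU.countP (hn : FeasU Γ n) {P : α → ℕ → Prop}
    (hP : FeasP (Γ.idx n hn.2) fun x => P x.1 x.2) : FeasU Γ fun a => RAM.countP (n a) (P a) :=
  .sum hn hP.feasU

/-- The least index below `n` with the property `P`, or `n` if there is none. -/
noncomputable def least (n : ℕ) (P : ℕ → Prop) : ℕ := countP n fun i => ∀ j < i + 1, ¬P j

/-- The indices counted by `least` are those with no solution at or below them. They form an initial
segment that ends right before the first solution. -/
theorem least_spec {n : ℕ} {P : ℕ → Prop} (h : ∃ i < n, P i) :
    least n P < n ∧ P (least n P) ∧ ∀ i < least n P, ¬P i := by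
  classical
  have h' : ∃ i, P i := h.imp fun _ h => h.2
  have : least n P = Nat.find h' := by
    rw [least, countP_eq]
    obtain ⟨i, hi, hP⟩ := h
    have hlt : Nat.find h' < n := (Nat.find_le hP).trans_lt hi
    rw [← Finset.card_range (Nat.find h')]
    congr 1
    ext j
    simp only [Finset.mem_filter, Finset.mem_range, Nat.lt_find_iff]
    constructor
    · rintro ⟨-, hj⟩ m hm
      exact hj m (by omega)
    · intro hj
      have : j < Nat.find h' := (Nat.lt_find_iff h' j).2 hj
      exact ⟨this.trans hlt, fun m hm => hj m (by omega)⟩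
  rw [this]
  obtain ⟨i, hi, hP⟩ := h
  exact ⟨(Nat.find_le hP).trans_lt hi, Nat.find_spec h', fun _ => Nat.find_min h'⟩

theorem FeasU.least (hn : FeasU Γ n) {P : α → ℕ → Prop}
    (hP : FeasP (Γ.idx n hn.2) fun x => P x.1 x.2) : FeasU Γ fun a => RAM.least (n a) (P a) := by
  refine .countP hn (P := fun a i => ∀ j < i + 1, ¬P a j) ?_
  refine FeasP.all (Γ := Γ.idx n hn.2) (n := fun x => (x.2 : ℕ) + 1) (P := fun x j => ¬P x.1 j)
    (FeasU.var.add (.const 1)) (FeasP.not ?_)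
  -- The inner index `j ≤ i < n` is itself an admissible index for the original predicate, so the
  -- outer index can be forgotten.
  refine Feas.pull hP (β := Ctx.Ix fun x : Ctx.Ix n => (x.2 : ℕ) + 1)
    (fun x => ⟨x.1.1, x.2, by have := x.1.2.2; have : (x.2 : ℕ) < x.1.2 + 1 := x.2.2; omega⟩) (fun _ => rfl) (fun _ => rfl) ?_
  rintro v (rfl | ⟨u, hu, rfl⟩)
  · exact Or.inl rfl
  · exact Or.inr ⟨_, Or.inr ⟨u, hu, rfl⟩, rfl⟩

/-- The digit number `i` of `x` in base `B`. -/
def dg (B x i : ℕ) : ℕ := x / B ^ i % B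

theorem Feas.dg {B x i : α → ℕ} (hB : Feas Γ B) (hx : Feas Γ x) (hi : FeasU Γ i) :
    Feas Γ fun a => RAM.dg (B a) (x a) (i a) := (hx.div (hB.pow hi)).mod hB

theorem FeasU.dg {B x i : α → ℕ} (hB : FeasU Γ B) (hx : Feas Γ x) (hi : FeasU Γ i)
    (hpos : ∀ a, 0 < B a) : FeasU Γ fun a => RAM.dg (B a) (x a) (i a) :=
  ⟨.dg hB.1 hx hi, hB.2.mono fun a => (Nat.mod_lt _ (hpos a)).le⟩

/-- The number with bits `P i` for `i < n`. -/
noncomputable def mask (n : ℕ) (P : ℕ → Prop) : ℕ := ∑ i ∈ Finset.range n, ind (P i) * 2 ^ i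

theorem mask_lt (n : ℕ) (P : ℕ → Prop) : mask n P < 2 ^ n := by
  induction n with
  | zero => simp [mask]
  | succ n ih =>
    have := Nat.mul_le_mul_right (2 ^ n) (ind_le_one (P n))
    rw [mask, Finset.sum_range_succ, ← mask, pow_succ]
    omega

theorem dg_mask {n i : ℕ} {P : ℕ → Prop} : dg 2 (mask n P) i = 1 ↔ i < n ∧ P i := by
  induction n with
  | zero => simp [mask, dg]
  | succ n ih =>
    have h1 := mask_lt n P
    rw [mask, Finset.sum_range_succ, ← mask]
    rcases lt_trichotomy i n with h | rfl | h
    · have : dg 2 (mask n P + ind (P n) * 2 ^ n) i = dg 2 (mask n P) i := by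
        obtain ⟨m, rfl⟩ := Nat.exists_eq_add_of_lt h
        rw [dg, show ind (P (i + m + 1)) * 2 ^ (i + m + 1) =
          (2 * (ind (P (i + m + 1)) * 2 ^ m)) * 2 ^ i by ring,
          Nat.add_mul_div_right _ _ (by positivity), Nat.add_mul_mod_self_left, dg]
      rw [this, ih]
      simp [h, h.trans (Nat.lt_succ_self n)]
    · rw [dg, Nat.add_mul_div_right _ _ (by positivity), Nat.div_eq_of_lt h1, zero_add,
        Nat.mod_eq_of_lt (by have := ind_le_one (P i); omega), ind_eq_one]
      simp
    · have h2 : mask n P + ind (P n) * 2 ^ n < 2 ^ i := by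
        have h3 := Nat.mul_le_mul_right (2 ^ n) (ind_le_one (P n))
        have h4 : 2 ^ (n + 1) ≤ 2 ^ i := Nat.pow_le_pow_right (by omega) h
        rw [pow_succ] at h4
        omega
      rw [dg, Nat.div_eq_of_lt h2]
      simp
      omega

theorem Feas.mask (hn : FeasU Γ n) {P : α → ℕ → Prop}
    (hP : FeasP (Γ.idx n hn.2) fun x => P x.1 x.2) : Feas Γ fun a => RAM.mask (n a) (P a) :=
  .sum hn (f := fun a i => ind (P a i) * 2 ^ i) (Feas.mul hP ((Feas.const 2).pow .var))

theorem FeasU.size (hf : FeasU Γ f) : FeasU Γ fun a => (f a).size := by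
  refine ⟨Feas.congr (FeasU.countP hf (P := fun a i => 2 ^ i ≤ f a)
    (.le ((Feas.const 2).pow .var) hf.1.idx)).1 fun a => ?_, hf.2.mono fun _ => size_le_self _⟩
  rw [countP_eq, ← Finset.card_range (f a).size]
  congr 1
  ext i
  simp only [Finset.mem_filter, Finset.mem_range, Nat.lt_size]
  exact ⟨fun h => h.2, fun h => ⟨Nat.lt_two_pow_self.trans_le h, h⟩⟩

end
end RAM

namespace RAM

/-! ### Running a program in fresh memory -/

/-- Registers are shifted by `B`, arrays by one, and the address `i` becomes `i * J + j`, where the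
numbers `J` and `j` are held by the registers `rJ` and `rj`. -/
def Expr.reloc (B rJ rj : ℕ) : Expr → Expr
  | .lit c => .lit c
  | .reg x => .reg (x + B)
  | .get a e => .get (a + 1) (.op .add (.op .mul (e.reloc B rJ rj) (.reg rJ)) (.reg rj))
  | .op o e f => .op o (e.reloc B rJ rj) (f.reloc B rJ rj)

def Prog.reloc (B rJ rj : ℕ) : Prog → Prog
  | .skip => .skip
  | .assign x e => .assign (x + B) (e.reloc B rJ rj)
  | .store a i e => .store (a + 1)
      (.op .add (.op .mul (i.reloc B rJ rj) (.reg rJ)) (.reg rj)) (e.reloc B rJ rj)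
  | .seq p q => .seq (p.reloc B rJ rj) (q.reloc B rJ rj)
  | .cond e p q => .cond (e.reloc B rJ rj) (p.reloc B rJ rj) (q.reloc B rJ rj)
  | .loop e p => .loop (e.reloc B rJ rj) (p.reloc B rJ rj)

/-- A bound for the registers in an expression. -/
def Expr.regs : Expr → ℕ
  | .lit _ => 0
  | .reg x => x + 1
  | .get _ e => e.regs
  | .op _ e f => max e.regs f.regs

/-- A bound for the registers in a program. -/
def Prog.regs : Prog → ℕ
  | .skip => 0
  | .assign x e => max (x + 1) e.regs
  | .store _ i e => max i.regs e.regs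
  | .seq p q => max p.regs q.regs
  | .cond e p q => max e.regs (max p.regs q.regs)
  | .loop e p => max e.regs p.regs

/-- The state `s'` simulates `s` in the memory with number `j`. -/
structure Sim (X B rJ rj J j : ℕ) (s s' : State) : Prop where
  reg : ∀ x < X, s'.reg (x + B) = s.reg x
  arr : ∀ a i, s'.arr (a + 1) (i * J + j) = s.arr a i
  hJ : s'.reg rJ = J
  hj : s'.reg rj = j

/-- Only registers from `B` on and array cells of the memory with number `j` have changed. -/
structure Frame (B J j : ℕ) (s s' : State) : Prop where
  reg : ∀ r < B, s'.reg r = s.reg r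
  inp : s'.arr 0 = s.arr 0
  arr : ∀ a m, m % J ≠ j → s'.arr a m = s.arr a m

theorem Frame.refl (B J j : ℕ) (s : State) : Frame B J j s s :=
  ⟨fun _ _ => rfl, rfl, fun _ _ _ => rfl⟩

theorem Frame.trans {B J j : ℕ} {s s₁ s₂ : State} (h : Frame B J j s s₁) (h' : Frame B J j s₁ s₂) :
    Frame B J j s s₂ :=
  ⟨fun r hr => (h'.reg r hr).trans (h.reg r hr), h'.inp.trans h.inp,
    fun a m hm => (h'.arr a m hm).trans (h.arr a m hm)⟩

variable {X B rJ rj J j : ℕ}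

theorem Sim.eval {s s' : State} (h : Sim X B rJ rj J j s s') :
    ∀ e : Expr, e.regs ≤ X → (e.reloc B rJ rj).eval s' = e.eval s
  | .lit c, _ => rfl
  | .reg x, hx => h.reg x hx
  | .get a e, he => by
    simp only [Expr.reloc, Expr.eval, Op.eval, h.eval e he, h.hJ, h.hj, h.arr]
  | .op o e f, he => by
    simp only [Expr.reloc, Expr.eval, h.eval e ((le_max_left _ _).trans he),
      h.eval f ((le_max_right _ _).trans he)]

theorem size_mul_add_le (hj : j < J) (x : ℕ) : (x * J + j).size ≤ x.size + J.size := by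
  rw [Nat.size_le, pow_add]
  calc x * J + j < (x + 1) * J := by rw [add_mul, one_mul]; omega
    _ ≤ 2 ^ x.size * 2 ^ J.size := Nat.mul_le_mul (Nat.lt_size_self x) (Nat.lt_size_self J).le

/-- The term `2 * (e.eval s).size` is slack for the induction: an array access at address `x` now
also computes `x * J` and `x * J + j`, and the bit length of `x` enters twice. The remaining extra
cost per access is at most a constant plus four times the bit length of `J`. -/
theorem Sim.cost {s s' : State} (h : Sim X B rJ rj J j s s') (hj : j < J) :
    ∀ e : Expr, e.regs ≤ X →
      (e.reloc B rJ rj).cost s' + 2 * (e.eval s).size ≤ (5 + 4 * J.size) * e.cost s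
  | .lit c, _ => by
    simp only [Expr.reloc, Expr.eval, Expr.cost]
    nlinarith [Nat.zero_le (J.size * c.size), Nat.zero_le J.size]
  | .reg x, hx => by
    simp only [Expr.reloc, Expr.eval, Expr.cost, h.reg x hx]
    nlinarith [Nat.zero_le (J.size * (s.reg x).size), Nat.zero_le J.size]
  | .get a e, he => by
    have h1 := h.cost hj e he
    have h2 := size_mul_add_le hj (e.eval s)
    have h3 := size_mul_le (e.eval s) J
    have h4 := Nat.size_le_size hj.le
    simp only [Expr.reloc, Expr.eval, Expr.cost, Op.eval, h.eval e he, h.hJ, h.hj, h.arr]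
    nlinarith [Nat.zero_le (J.size * (s.arr a (e.eval s)).size), Nat.zero_le J.size]
  | .op o e f, he => by
    have h1 := h.cost hj e ((le_max_left _ _).trans he)
    have h2 := h.cost hj f ((le_max_right _ _).trans he)
    simp only [Expr.reloc, Expr.eval, Expr.cost, h.eval e ((le_max_left _ _).trans he),
      h.eval f ((le_max_right _ _).trans he)]
    nlinarith [Nat.zero_le (J.size * (o.eval (e.eval s) (f.eval s)).size), Nat.zero_le J.size]

/-- Memory number `j` is the residue class of `j` modulo `J` in each array. Different runs thus
never touch the same cells, and no array has to be cleared between them; the price is only a factor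
logarithmic in `J`. -/
theorem Exec.reloc {p : Prog} {s s₁ : State} {t : ℕ} (h : Exec p s t s₁) (hJ : rJ < B)
    (hjB : rj < B) (hj : j < J) : p.regs ≤ X → ∀ s', Sim X B rJ rj J j s s' →
    ∃ t' s₁', Exec (p.reloc B rJ rj) s' t' s₁' ∧ t' ≤ (5 + 4 * J.size) * t ∧
      Sim X B rJ rj J j s₁ s₁' ∧ Frame B J j s' s₁' := by
  induction h with
  | skip s => exact fun _ s' hs => ⟨_, s', .skip s', by omega, hs, .refl ..⟩
  | assign s x e =>
    intro hX s' hs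
    have hx : x < X := (le_max_left _ _).trans hX
    have he : e.regs ≤ X := (le_max_right _ _).trans hX
    refine ⟨_, _, .assign s' _ _, ?_, ⟨?_, hs.arr, ?_, ?_⟩, ?_, rfl, fun _ _ _ => rfl⟩
    · have := hs.cost hj e he
      nlinarith
    · intro y hy
      simp only [hs.eval e he]
      by_cases hxy : y = x
      · simp [hxy]
      · rw [Function.update_of_ne (by omega), Function.update_of_ne hxy, hs.reg y hy]
    · simp only
      rw [Function.update_of_ne (by omega), hs.hJ]
    · simp only
      rw [Function.update_of_ne (by omega), hs.hj]
    · intro r hr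
      simp only
      rw [Function.update_of_ne (by omega)]
  | store s a i e =>
    intro hX s' hs
    have hi : i.regs ≤ X := (le_max_left _ _).trans hX
    have he : e.regs ≤ X := (le_max_right _ _).trans hX
    refine ⟨_, _, .store s' _ _ _, ?_, ⟨hs.reg, ?_, hs.hJ, hs.hj⟩, fun _ _ => rfl, ?_, ?_⟩
    · have h1 := hs.cost hj e he
      have h1' := hs.cost hj i hi
      have h2 := size_mul_add_le hj (i.eval s)
      have h3 := size_mul_le (i.eval s) J
      have h4 := Nat.size_le_size hj.le
      simp only [Expr.cost, Expr.eval, Op.eval, hs.eval i hi, hs.hJ, hs.hj]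
      nlinarith
    · intro a' i'
      simp only [Expr.eval, Op.eval, hs.eval i hi, hs.eval e he, hs.hJ, hs.hj]
      by_cases ha : a' = a
      · subst ha
        simp only [Function.update_self]
        by_cases hi' : i' = i.eval s
        · simp [hi']
        · rw [Function.update_of_ne, Function.update_of_ne hi', hs.arr]
          intro h
          exact hi' (Nat.eq_of_mul_eq_mul_right (by omega) (by omega : i' * J = i.eval s * J))
      · rw [Function.update_of_ne (by omega), Function.update_of_ne ha, hs.arr]
    · simp
    · intro a' m hm
      simp only [Expr.eval, Op.eval, hs.eval i hi, hs.hJ, hs.hj]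
      by_cases ha : a' = a + 1
      · subst ha
        rw [Function.update_self, Function.update_of_ne]
        rintro rfl
        rw [Nat.mul_add_mod_self_right, Nat.mod_eq_of_lt hj] at hm
        exact hm rfl
      · rw [Function.update_of_ne ha]
  | seq _ _ ih₁ ih₂ =>
    intro hX s' hs
    obtain ⟨t₁, s₁, e₁, h₁, hs₁, f₁⟩ := ih₁ ((le_max_left _ _).trans hX) s' hs
    obtain ⟨t₂, s₂, e₂, h₂, hs₂, f₂⟩ := ih₂ ((le_max_right _ _).trans hX) s₁ hs₁
    exact ⟨_, _, .seq e₁ e₂, by rw [mul_add]; omega, hs₂, f₁.trans f₂⟩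
  | @cond_true e p q s s₁ t he _ ih =>
    intro hX s' hs
    simp only [Prog.regs, max_le_iff] at hX
    obtain ⟨t₁, s₁, e₁, h₁, hs₁, f₁⟩ := ih hX.2.1 s' hs
    refine ⟨_, _, .cond_true (by rwa [hs.eval e hX.1]) e₁, ?_, hs₁, f₁⟩
    have := hs.cost hj e hX.1
    nlinarith
  | @cond_false e p q s s₁ t he _ ih =>
    intro hX s' hs
    simp only [Prog.regs, max_le_iff] at hX
    obtain ⟨t₁, s₁, e₁, h₁, hs₁, f₁⟩ := ih hX.2.2 s' hs
    refine ⟨_, _, .cond_false (by rwa [hs.eval e hX.1]) e₁, ?_, hs₁, f₁⟩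
    have := hs.cost hj e hX.1
    nlinarith
  | loop_stop he =>
    rename_i e p s
    intro hX s' hs
    simp only [Prog.regs, max_le_iff] at hX
    refine ⟨_, _, Exec.loop_stop (by rwa [hs.eval e hX.1]), ?_, hs, .refl ..⟩
    have := hs.cost hj e hX.1
    nlinarith
  | @loop_step e p s s₁ s₂ t₁ t₂ he _ _ ih₁ ih₂ =>
    intro hX s' hs
    have hX' := hX
    simp only [Prog.regs, max_le_iff] at hX'
    obtain ⟨t₁, s₁, e₁, h₁, hs₁, f₁⟩ := ih₁ hX'.2 s' hs
    obtain ⟨t₂, s₂, e₂, h₂, hs₂, f₂⟩ := ih₂ hX s₁ hs₁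
    refine ⟨_, _, .loop_step (by rwa [hs.eval e hX'.1]) e₁ e₂, ?_, hs₂, f₁.trans f₂⟩
    have := hs.cost hj e hX'.1
    nlinarith

end RAM

/-! ### Sparsification of set families -/

namespace Sparsify
open Finset

variable {U : Type} [DecidableEq U]

/-- The number of members of size `c` that contain `H`. -/
def deg (F : Finset (Finset U)) (c : ℕ) (H : Finset U) : ℕ :=
  #{C ∈ F | C.card = c ∧ H ⊆ C}

/-- `H` is the heart of a large flower of sets of size `c`. -/
def Heavy (D : ℕ) (F : Finset (Finset U)) (c : ℕ) (H : Finset U) : Prop :=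
  1 ≤ H.card ∧ H.card < c ∧ D ^ (c - H.card) ≤ deg F c H

/-- The minimal members of a family. -/
def reduce (F : Finset (Finset U)) : Finset (Finset U) :=
  {C ∈ F | ∀ C' ∈ F, C' ⊆ C → C' = C}

def petals (F : Finset (Finset U)) (c : ℕ) (H : Finset U) : Finset (Finset U) :=
  ({C ∈ F | C.card = c ∧ H ⊆ C} : Finset (Finset U)).image (· \ H)

/-- A flower with sets of the least possible size and, among those, with the largest heart. -/
structure Extremal (D : ℕ) (F : Finset (Finset U)) (c : ℕ) (H : Finset U) : Prop where
  heavy : Heavy D F c H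
  min : ∀ c' H', c' < c → ¬Heavy D F c' H'
  max : ∀ H', H.card < H'.card → ¬Heavy D F c H'

/-- An antichain of nonempty sets of size at most `k` over the ground set `V`. -/
structure Good (k : ℕ) (V : Finset U) (F : Finset (Finset U)) : Prop where
  anti : ∀ C ∈ F, ∀ C' ∈ F, C' ⊆ C → C' = C
  pos : ∀ C ∈ F, 1 ≤ C.card
  le : ∀ C ∈ F, C.card ≤ k
  sub : ∀ C ∈ F, C ⊆ V

/-- The members that were added so far form a light family. -/
structure Inv (k D : ℕ) (V : Finset U) (F A : Finset (Finset U)) : Prop where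
  good : Good k V F
  sub : A ⊆ F
  light : ∀ c H, 1 ≤ H.card → H.card ≤ c → deg A c H ≤ 2 * D ^ (c - H.card)

/-- Smaller sets weigh more. The base `5 * D` is large enough that a new set outweighs twice
everything in a light family that it can displace. -/
def pot (k D : ℕ) (A : Finset (Finset U)) : ℕ := ∑ C ∈ A, (5 * D) ^ (k - C.card)

theorem deg_mono {F G : Finset (Finset U)} (h : F ⊆ G) (c : ℕ) (H : Finset U) :
    deg F c H ≤ deg G c H := card_le_card (filter_subset_filter _ h)

theorem deg_self_le (F : Finset (Finset U)) (H : Finset U) : deg F H.card H ≤ 1 := by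
  rw [deg, card_le_one]
  simp only [mem_filter]
  rintro C ⟨-, h1, h2⟩ C' ⟨-, h1', h2'⟩
  rw [← eq_of_subset_of_card_le h2 h1.le, ← eq_of_subset_of_card_le h2' h1'.le]

theorem exists_reduce_subset {F : Finset (Finset U)} {C : Finset U} (hC : C ∈ F) :
    ∃ C' ∈ reduce F, C' ⊆ C := by
  obtain ⟨C', h1, h2⟩ := exists_min_image {C' ∈ F | C' ⊆ C} card ⟨C, by simp [hC]⟩
  simp only [mem_filter] at h1 h2
  refine ⟨C', ?_, h1.2⟩
  simp only [reduce, mem_filter]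
  exact ⟨h1.1, fun C'' h3 h4 => eq_of_subset_of_card_le h4 (h2 C'' ⟨h3, h4.trans h1.2⟩)⟩

theorem Good.reduce {k : ℕ} {V : Finset U} {F : Finset (Finset U)} (h1 : ∀ C ∈ F, 1 ≤ C.card)
    (h2 : ∀ C ∈ F, C.card ≤ k) (h3 : ∀ C ∈ F, C ⊆ V) : Good k V (reduce F) := by
  refine ⟨?_, ?_, ?_, ?_⟩ <;> simp only [Sparsify.reduce, mem_filter]
  · exact fun C hC C' hC' h => hC.2 C' hC'.1 h
  · exact fun C hC => h1 C hC.1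
  · exact fun C hC => h2 C hC.1
  · exact fun C hC => h3 C hC.1

/-- The sum is thus at most a quarter of `(5 * D) ^ d`. The factor two in the definition of a light
family makes this one half, and so a new set loses at most half of its weight again. -/
theorem weights (D y d : ℕ) :
    4 * ∑ i ∈ Ioc y (y + d), D ^ (i - y) * (5 * D) ^ (y + d - i) + D ^ d = (5 * D) ^ d := by
  induction d with
  | zero => simp
  | succ d ih =>
    rw [← add_assoc, Finset.sum_Ioc_succ_top (by omega)]
    have : ∑ i ∈ Ioc y (y + d), D ^ (i - y) * (5 * D) ^ (y + d + 1 - i) =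
        5 * D * ∑ i ∈ Ioc y (y + d), D ^ (i - y) * (5 * D) ^ (y + d - i) := by
      rw [mul_sum]
      refine sum_congr rfl fun i hi => ?_
      rw [mem_Ioc] at hi
      rw [show y + d + 1 - i = y + d - i + 1 by omega]
      ring
    rw [this, pow_succ (5 * D), ← ih, show y + d + 1 - y = d + 1 by omega, Nat.sub_self]
    ring

theorem pot_filter_le {k D y : ℕ} {A : Finset (Finset U)} {M : Finset U} {m : ℕ → ℕ}
    (hA : ∀ C ∈ A, M ⊆ C → y < C.card ∧ C.card ≤ k) (hm : ∀ i, y < i → deg A i M ≤ m i) :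
    pot k D {C ∈ A | M ⊆ C} ≤ ∑ i ∈ Ioc y k, m i * (5 * D) ^ (k - i) := by
  rw [pot, ← sum_fiberwise_of_maps_to (s := {C ∈ A | M ⊆ C}) (t := Ioc y k) (g := card)
    (by simpa using hA)]
  refine sum_le_sum fun i hi => ?_
  rw [mem_Ioc] at hi
  rw [sum_congr rfl (g := fun _ => (5 * D) ^ (k - i)) (by simp +contextual), sum_const,
    smul_eq_mul]
  refine Nat.mul_le_mul_right _ (le_trans (card_le_card ?_) (hm i hi.1))
  intro C hC
  simp only [mem_filter] at hC ⊢
  exact ⟨hC.1.1, hC.2, hC.1.2⟩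

theorem pot_biUnion_le {ι : Type} (k D : ℕ) (s : Finset ι) (f : ι → Finset (Finset U))
    {A : Finset (Finset U)} (h : ∀ C ∈ A, ∃ i ∈ s, C ∈ f i) :
    pot k D A ≤ ∑ i ∈ s, pot k D (f i) := by
  classical
  calc pot k D A ≤ pot k D (s.biUnion f) :=
        sum_le_sum_of_subset fun C hC => mem_biUnion.2 (h C hC)
    _ ≤ _ := by
      unfold pot
      induction s using Finset.induction_on generalizing A with
      | empty => simp
      | insert a s ha ih =>
        rw [biUnion_insert, sum_insert ha]
        refine le_trans ?_ (Nat.add_le_add_left (ih (A := s.biUnion f) (by simp)) _)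
        rw [← sum_union_inter]
        exact Nat.le_add_right _ _

/-- Adding sets of size `y` to the family increases the potential. -/
theorem Inv.add {k D y : ℕ} {V : Finset U} {F A N : Finset (Finset U)}
    (hI : Inv k D V F A) (hy : 1 ≤ y) (hyk : y ≤ k) (hN : ∀ C ∈ N, C.card = y) (hNV : ∀ C ∈ N, C ⊆ V)
    (hNF : ∀ C ∈ N, ∀ C' ∈ F, ¬C' ⊆ C)
    (hlight : ∀ H : Finset U, 1 ≤ H.card → H.card < y →
      deg F y H + deg N y H ≤ 2 * D ^ (y - H.card)) :
    ∃ A', Inv k D V (reduce (F ∪ N)) A' ∧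
      2 * pot k D A + N.card * (5 * D) ^ (k - y) ≤ 2 * pot k D A' := by
  classical
  have hgood : Good k V (reduce (F ∪ N)) := by
    refine .reduce ?_ ?_ ?_ <;> intro C hC <;> rcases mem_union.1 hC with h | h
    · exact hI.good.pos C h
    · exact (hN C h).symm ▸ hy
    · exact hI.good.le C h
    · exact (hN C h).symm ▸ hyk
    · exact hI.good.sub C h
    · exact hNV C h
  have hNsub : N ⊆ reduce (F ∪ N) := by
    intro C hC
    simp only [reduce, mem_filter, mem_union]
    refine ⟨.inr hC, ?_⟩
    rintro C' (h | h) hsub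
    · exact absurd hsub (hNF C hC C' h)
    · exact eq_of_subset_of_card_le hsub (by rw [hN C hC, hN C' h])
  have hdisj : Disjoint N A := by
    rw [Finset.disjoint_left]
    exact fun C h h' => hNF C h C (hI.sub h') Subset.rfl
  -- The record of added sets gains `N` and loses exactly those members that the reduction deletes,
  -- namely the ones above a member of `N`.
  refine ⟨N ∪ {C ∈ A | ∀ M ∈ N, ¬M ⊆ C}, ⟨hgood, ?_, ?_⟩, ?_⟩
  · refine union_subset hNsub fun C hC => ?_
    simp only [mem_filter] at hC
    simp only [reduce, mem_filter, mem_union]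
    refine ⟨.inl (hI.sub hC.1), ?_⟩
    rintro C' (h | h) hsub
    · exact hI.good.anti C (hI.sub hC.1) C' h hsub
    · exact absurd hsub (hC.2 C' h)
  · intro c H h1 h2
    have hle : deg (N ∪ {C ∈ A | ∀ M ∈ N, ¬M ⊆ C}) c H ≤ deg N c H + deg A c H := by
      rw [deg, filter_union]
      exact (card_union_le _ _).trans
        (Nat.add_le_add_left (deg_mono (filter_subset _ _) c H) _)
    by_cases hc : c = y
    · subst hc
      rcases h2.lt_or_eq with h3 | rfl
      · have := hlight H h1 h3
        have := deg_mono hI.sub c H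
        omega
      · exact (deg_self_le _ _).trans (by simp)
    · have : deg N c H = 0 := by
        rw [deg, card_eq_zero, filter_eq_empty_iff]
        rintro C hC ⟨h, -⟩
        exact hc (by rw [← h, hN C hC])
      have := hI.light c H h1 h2
      omega
  · have hbad : 2 * pot k D {C ∈ A | ¬∀ M ∈ N, ¬M ⊆ C} ≤ N.card * (5 * D) ^ (k - y) := by
      have h1 : pot k D {C ∈ A | ¬∀ M ∈ N, ¬M ⊆ C} ≤ ∑ M ∈ N, pot k D {C ∈ A | M ⊆ C} := by
        refine pot_biUnion_le _ _ _ _ fun C hC => ?_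
        simp only [mem_filter] at hC
        push Not at hC
        obtain ⟨hC, M, hM, h⟩ := hC
        exact ⟨M, hM, mem_filter.2 ⟨hC, h⟩⟩
      have h2 : ∀ M ∈ N, 2 * pot k D {C ∈ A | M ⊆ C} ≤ (5 * D) ^ (k - y) := by
        intro M hM
        have h3 := pot_filter_le (k := k) (D := D) (y := y) (A := A) (M := M)
          (m := fun i => 2 * D ^ (i - y)) (fun C hC hMC => ⟨?_, hI.good.le C (hI.sub hC)⟩)
          (fun i hi => ?_)
        · obtain ⟨d, rfl⟩ := Nat.exists_eq_add_of_le hyk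
          have h4 := weights D y d
          simp only [mul_assoc 2, ← mul_sum] at h3
          rw [show y + d - y = d by omega]
          omega
        · rw [← hN M hM]
          refine card_lt_card (hMC.ssubset_of_ne ?_)
          rintro rfl
          exact hNF M hM M (hI.sub hC) Subset.rfl
        · have := hI.light i M (by rw [hN M hM]; exact hy) (by rw [hN M hM]; exact hi.le)
          rwa [hN M hM] at this
      calc _ ≤ ∑ M ∈ N, 2 * pot k D {C ∈ A | M ⊆ C} := by rw [← mul_sum]; omega
        _ ≤ _ := sum_le_card_nsmul _ _ _ h2
    have hsplit : pot k D A = pot k D {C ∈ A | ∀ M ∈ N, ¬M ⊆ C} +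
        pot k D {C ∈ A | ¬∀ M ∈ N, ¬M ⊆ C} := (sum_filter_add_sum_filter_not _ _ _).symm
    have hnew : pot k D (N ∪ {C ∈ A | ∀ M ∈ N, ¬M ⊆ C}) =
        N.card * (5 * D) ^ (k - y) + pot k D {C ∈ A | ∀ M ∈ N, ¬M ⊆ C} := by
      rw [pot, sum_union (hdisj.mono_right (filter_subset _ _)), ← pot]
      congr 1
      rw [pot, sum_congr rfl (g := fun _ => (5 * D) ^ (k - y)) (fun C hC => by rw [hN C hC]), sum_const,
        smul_eq_mul]
    omega

section
variable {k D c : ℕ} {V H : Finset U} {F A : Finset (Finset U)}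

theorem deg_lt_of_not_heavy (h1 : 1 ≤ H.card) (h2 : H.card < c) (h : ¬Heavy D F c H) :
    deg F c H < D ^ (c - H.card) := by
  by_contra! h3
  exact h ⟨h1, h2, h3⟩

theorem Heavy.exists_mem (hD : 1 ≤ D) (h : Heavy D F c H) : ∃ C ∈ F, C.card = c ∧ H ⊆ C := by
  have : 0 < deg F c H := (Nat.pow_pos hD).trans_le h.2.2
  obtain ⟨C, hC⟩ := card_pos.1 this
  exact ⟨C, by simpa using hC⟩

/-- The heart is smaller than `c`, and by minimality of `c` there are no flowers of sets of that
size, so one more set keeps the family light. No member lies below the heart, since it would lie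
properly below a member above the heart. -/
theorem Inv.heart (hD : 1 ≤ D) (hI : Inv k D V F A) (hE : Extremal D F c H) :
    ∃ A', Inv k D V (reduce (F ∪ {H})) A' ∧ 2 * pot k D A + 1 ≤ 2 * pot k D A' := by
  obtain ⟨C, hC, rfl, hHC⟩ := hE.heavy.exists_mem hD
  have hlt := hE.heavy.2.1
  obtain ⟨A', h1, h2⟩ := hI.add (N := {H}) hE.heavy.1 (hlt.le.trans (hI.good.le C hC))
    (by simp) (by simpa using hHC.trans (hI.good.sub C hC)) (by
      simp only [mem_singleton, forall_eq]
      intro C' hC' h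
      have := hI.good.anti C hC C' hC' (h.trans hHC)
      subst this
      exact absurd (card_le_card h) (by omega)) (by
      intro H' h1 h2
      have h3 := deg_lt_of_not_heavy h1 h2 (hE.min _ _ hlt)
      have h4 : deg {H} H.card H' ≤ 1 := (card_filter_le _ _).trans (by simp)
      omega)
  refine ⟨A', h1, le_trans ?_ h2⟩
  have : 0 < (5 * D) ^ (k - H.card) := by positivity
  simp
  omega

theorem petals_injOn : Set.InjOn (· \ H) {C : Finset U | H ⊆ C} := by
  intro C hC C' hC' h
  rw [← sdiff_union_of_subset hC, ← sdiff_union_of_subset hC']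
  exact congrArg (· ∪ H) h

theorem card_petals : (petals F c H).card = deg F c H :=
  card_image_of_injOn fun C hC C' hC' h =>
    petals_injOn (by simp at hC; exact hC.2.2) (by simp at hC'; exact hC'.2.2) h

/-- Adding `H` back to a petal that contains `H'` gives a member that contains `H ∪ H'`, and this
map is injective. -/
theorem deg_petals_le (H' : Finset U) : deg (petals F c H) (c - H.card) H' ≤ deg F c (H ∪ H') := by
  refine card_le_card_of_injOn (· ∪ H) ?_ ?_
  · intro P hP
    simp only [petals, coe_filter, mem_image, mem_filter, Set.mem_ofPred_eq] at hP
    obtain ⟨⟨C, ⟨h1, h2, h3⟩, rfl⟩, h4, h5⟩ := hP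
    simp only [coe_filter, Set.mem_ofPred_eq, sdiff_union_of_subset h3]
    exact ⟨h1, h2, union_subset h3 (h5.trans sdiff_subset)⟩
  · intro P hP P' hP' h
    simp only [petals, coe_filter, mem_image, mem_filter, Set.mem_ofPred_eq] at hP hP'
    obtain ⟨⟨C, ⟨h1, h2, h3⟩, rfl⟩, h4, h5⟩ := hP
    obtain ⟨⟨C', ⟨h1', h2', h3'⟩, rfl⟩, h4', h5'⟩ := hP'
    simp only [sdiff_union_of_subset h3, sdiff_union_of_subset h3'] at h
    rw [h]

/-- Petals are smaller than `c`, so the old family has no flowers of their size. A large flower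
among the petals themselves would give, by `deg_petals_le`, a flower of size `c` with a larger
heart, against maximality. The gain is large because there are at least `D ^ (c - H.card)` petals,
each of weight `(5 * D) ^ (k - (c - H.card))`. -/
theorem Inv.petals (hD : 1 ≤ D) (hI : Inv k D V F A) (hE : Extremal D F c H) :
    ∃ A', Inv k D V (reduce (F ∪ petals F c H)) A' ∧ 2 * pot k D A + 1 ≤ 2 * pot k D A' ∧
      2 * pot k D A + D ^ k ≤ 2 * pot k D A' := by
  obtain ⟨C₀, hC₀, rfl, hHC₀⟩ := hE.heavy.exists_mem hD
  have hlt := hE.heavy.2.1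
  have hle := hI.good.le C₀ hC₀
  have hpos := hE.heavy.1
  generalize hc : C₀.card = c at *
  have hmem : ∀ P ∈ Sparsify.petals F c H, ∃ C ∈ F, C.card = c ∧ H ⊆ C ∧ P = C \ H := by
    intro P hP
    simp only [Sparsify.petals, mem_image, mem_filter] at hP
    obtain ⟨C, ⟨h1, h2, h3⟩, rfl⟩ := hP
    exact ⟨C, h1, h2, h3, rfl⟩
  obtain ⟨A', h1, h2⟩ := hI.add (N := Sparsify.petals F c H) (y := c - H.card) (by omega)
    (by omega) (by
      intro P hP
      obtain ⟨C, h1, h2, h3, rfl⟩ := hmem P hP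
      rw [card_sdiff_of_subset h3, h2]) (by
      intro P hP
      obtain ⟨C, h1, h2, h3, rfl⟩ := hmem P hP
      exact sdiff_subset.trans (hI.good.sub C h1)) (by
      intro P hP C' hC' h
      obtain ⟨C, h1, h2, h3, rfl⟩ := hmem P hP
      obtain rfl := hI.good.anti C h1 C' hC' (h.trans sdiff_subset)
      have := card_le_card h
      rw [card_sdiff_of_subset h3] at this
      omega) (by
      intro H' h1 h2
      have h3 := deg_lt_of_not_heavy h1 h2 (hE.min _ _ (by omega))
      rcases Nat.eq_zero_or_pos (deg (Sparsify.petals F c H) (c - H.card) H') with h0 | h0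
      · omega
      obtain ⟨P, hP⟩ := card_pos.1 h0
      obtain ⟨hP, -, hP'⟩ := mem_filter.1 hP
      obtain ⟨C, h5, h6, h7, rfl⟩ := hmem P hP
      have hdis : Disjoint H H' := disjoint_sdiff.mono_right hP'
      have hcard : (H ∪ H').card = H.card + H'.card := card_union_of_disjoint hdis
      have h8 := deg_petals_le (F := F) (c := c) (H := H) H'
      have h9 := deg_lt_of_not_heavy (by omega) (by omega)
        (hE.max (H ∪ H') (by omega))
      rw [hcard, ← Nat.sub_sub] at h9
      omega)
  have h3 : D ^ k ≤ (Sparsify.petals F c H).card * (5 * D) ^ (k - (c - H.card)) := by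
    rw [card_petals]
    refine le_trans ?_ (Nat.mul_le_mul hE.heavy.2.2
      (Nat.pow_le_pow_left (show D ≤ 5 * D by omega) _))
    rw [← pow_add]
    exact Nat.pow_le_pow_right hD (by omega)
  have : 0 < D ^ k := Nat.pow_pos hD
  exact ⟨A', h1, by omega, by omega⟩

/-- Every member contains a point of `V`, and lightness at the singletons bounds the weight through
each point. The exponent `c - 1` there is the source of the saving by the factor `D`, and hence of
the small number of petal steps. -/
theorem Inv.two_mul_pot_le (hI : Inv k D V F A) : D * (2 * pot k D A) ≤ V.card * (5 * D) ^ k := by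
  have h1 : pot k D A ≤ ∑ u ∈ V, pot k D {C ∈ A | {u} ⊆ C} := by
    refine pot_biUnion_le _ _ _ _ fun C hC => ?_
    obtain ⟨u, hu⟩ := card_pos.1 (hI.good.pos C (hI.sub hC))
    exact ⟨u, hI.good.sub C (hI.sub hC) hu, by simp [hC, hu]⟩
  have h2 : ∀ u ∈ V, D * (2 * pot k D {C ∈ A | {u} ⊆ C}) ≤ (5 * D) ^ k := by
    intro u _
    have h3 := pot_filter_le (k := k) (D := D) (y := 0) (A := A) (M := {u})
      (m := fun i => 2 * D ^ (i - 1))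
      (fun C hC _ => ⟨hI.good.pos C (hI.sub hC), hI.good.le C (hI.sub hC)⟩)
      (fun i hi => by simpa using hI.light i {u} (by simp) (by simpa using Nat.succ_le_of_lt hi))
    have h4 := weights D 0 k
    have h5 : D * ∑ i ∈ Ioc 0 k, 2 * D ^ (i - 1) * (5 * D) ^ (k - i) =
        2 * ∑ i ∈ Ioc 0 (0 + k), D ^ (i - 0) * (5 * D) ^ (0 + k - i) := by
      rw [mul_sum, mul_sum, zero_add]
      refine sum_congr rfl fun i hi => ?_
      obtain ⟨i, rfl⟩ := Nat.exists_eq_add_of_le' (mem_Ioc.1 hi).1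
      simp only [Nat.succ_sub_one, Nat.sub_zero]
      ring
    have h6 := Nat.mul_le_mul_left D h3
    calc D * (2 * pot k D {C ∈ A | {u} ⊆ C}) = 2 * (D * pot k D {C ∈ A | {u} ⊆ C}) := by ring
      _ ≤ _ := by omega
  calc D * (2 * pot k D A) ≤ ∑ u ∈ V, D * (2 * pot k D {C ∈ A | {u} ⊆ C}) := by
        rw [← mul_sum, ← mul_sum]
        gcongr
    _ ≤ _ := sum_le_card_nsmul _ _ _ h2

/-- A family without large flowers is small. -/
theorem Good.card_le (hD : 1 ≤ D) (hF : Good k V F) (h : ∀ c H, ¬Heavy D F c H) :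
    F.card ≤ V.card * (k * D ^ (k - 1)) := by
  have h1 : F ⊆ V.biUnion fun u => (Ioc 0 k).biUnion fun i =>
      {C ∈ F | C.card = i ∧ {u} ⊆ C} := by
    intro C hC
    obtain ⟨u, hu⟩ := card_pos.1 (hF.pos C hC)
    simp only [mem_biUnion, mem_filter, mem_Ioc]
    exact ⟨u, hF.sub C hC hu, C.card, ⟨hF.pos C hC, hF.le C hC⟩, hC, rfl, by simpa using hu⟩
  refine (card_le_card h1).trans (card_biUnion_le_card_mul _ _ _ fun u _ => ?_)
  refine (card_biUnion_le_card_mul _ _ (D ^ (k - 1)) fun i hi => ?_).trans (by simp)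
  rw [mem_Ioc] at hi
  change deg F i {u} ≤ _
  rcases (show 1 ≤ i from hi.1).eq_or_lt with rfl | h2
  · exact (deg_self_le F {u}).trans (Nat.one_le_pow _ _ hD)
  · have := deg_lt_of_not_heavy (by simp) (by simpa using h2) (h i {u})
    exact this.le.trans (Nat.pow_le_pow_right hD (by simp; omega))

end

/-- One step of sparsification: for a largest flower, either its heart or its petals are added. -/
def Step (D : ℕ) (P : Prop) (F F' : Finset (Finset U)) : Prop :=
  ∃ c H, Extremal D F c H ∧ (P → F' = reduce (F ∪ petals F c H)) ∧ (¬P → F' = reduce (F ∪ {H}))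

/-- Whatever is added, reduction only replaces a member by one of its subsets, so a set of points
that meets all new members meets all old ones. This holds for either choice in the step. -/
theorem Step.sat {D : ℕ} {P : Prop} {F F' : Finset (Finset U)} (h : Step D P F F') {τ : U → Prop}
    (hτ : ∀ C ∈ F', ∃ u ∈ C, τ u) : ∀ C ∈ F, ∃ u ∈ C, τ u := by
  obtain ⟨c, H, -, h1, h2⟩ := h
  intro C hC
  have : ∃ C' ∈ F', C' ⊆ C := by
    by_cases hP : P
    · rw [h1 hP]
      exact exists_reduce_subset (mem_union_left _ hC)
    · rw [h2 hP]
      exact exists_reduce_subset (mem_union_left _ hC)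
  obtain ⟨C', hC', hsub⟩ := this
  obtain ⟨u, hu, h⟩ := hτ C' hC'
  exact ⟨u, hsub hu, h⟩

theorem sat_reduce_union {F N : Finset (Finset U)} {τ : U → Prop} (hF : ∀ C ∈ F, ∃ u ∈ C, τ u)
    (hN : ∀ C ∈ N, ∃ u ∈ C, τ u) : ∀ C ∈ reduce (F ∪ N), ∃ u ∈ C, τ u := by
  intro C hC
  rcases mem_union.1 (mem_of_mem_filter C hC) with h | h
  · exact hF C h
  · exact hN C h

/-- If the heart is missed, then each set of the flower is met outside the heart. -/
theorem sat_petals {F : Finset (Finset U)} {c : ℕ} {H : Finset U} {τ : U → Prop}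
    (hF : ∀ C ∈ F, ∃ u ∈ C, τ u) (hH : ¬∃ u ∈ H, τ u) : ∀ C ∈ petals F c H, ∃ u ∈ C, τ u := by
  intro P hP
  simp only [petals, mem_image, mem_filter] at hP
  obtain ⟨C, ⟨h1, -, -⟩, rfl⟩ := hP
  obtain ⟨u, hu, h⟩ := hF C h1
  exact ⟨u, mem_sdiff.2 ⟨hu, fun h' => hH ⟨u, h', h⟩⟩, h⟩

theorem exists_inv {k D : ℕ} {V : Finset U} (hD : 1 ≤ D) (F : ℕ → Finset (Finset U))
    (P : ℕ → Prop) [DecidablePred P] (h0 : Good k V (F 0)) (n : ℕ)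
    (hstep : ∀ i < n, Step D (P i) (F i) (F (i + 1))) :
    ∃ A, Inv k D V (F n) A ∧ n ≤ 2 * pot k D A ∧ #{i ∈ range n | P i} * D ^ k ≤ 2 * pot k D A := by
  induction n with
  | zero => exact ⟨∅, ⟨h0, empty_subset _, by simp [deg]⟩, by simp, by simp⟩
  | succ n ih =>
    obtain ⟨A, h1, h2, h3⟩ := ih fun i hi => hstep i (by omega)
    obtain ⟨c, H, hE, h4, h5⟩ := hstep n (by omega)
    rw [range_add_one, filter_insert]
    by_cases hP : P n
    · obtain ⟨A', h6, h7, h8⟩ := h1.petals hD hE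
      rw [if_pos hP, card_insert_of_notMem (by simp), add_mul, h4 hP]
      exact ⟨A', h6, by omega, by omega⟩
    · obtain ⟨A', h6, h7⟩ := h1.heart hD hE
      rw [if_neg hP, h5 hP]
      exact ⟨A', h6, by omega, by omega⟩

/-- Sparsification takes few steps, and very few of them add petals. -/
theorem steps_le {k D : ℕ} {V : Finset U} (hD : 1 ≤ D) (F : ℕ → Finset (Finset U))
    (P : ℕ → Prop) [DecidablePred P] (h0 : Good k V (F 0)) (n : ℕ)
    (hstep : ∀ i < n, Step D (P i) (F i) (F (i + 1))) :
    n ≤ V.card * (5 * D) ^ k ∧ #{i ∈ range n | P i} * D ≤ V.card * 5 ^ k ∧ Good k V (F n) := by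
  obtain ⟨A, h1, h2, h3⟩ := exists_inv hD F P h0 n hstep
  have h4 := h1.two_mul_pot_le
  refine ⟨?_, ?_, h1.good⟩
  · refine le_trans ?_ h4
    nlinarith
  · have h5 : (#{i ∈ range n | P i} * D) * D ^ k ≤ (V.card * 5 ^ k) * D ^ k := by
      calc _ = D * (#{i ∈ range n | P i} * D ^ k) := by ring
        _ ≤ D * (2 * pot k D A) := Nat.mul_le_mul_left D h3
        _ ≤ _ := h4
        _ = _ := by rw [mul_pow]; ring
    exact Nat.le_of_mul_le_mul_right h5 (Nat.pow_pos hD)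

end Sparsify

namespace RAM

/-! ### Digits -/

theorem sum_dg (B x k : ℕ) : ∑ i ∈ Finset.range k, dg B x i * B ^ i = x % B ^ k := by
  induction k with
  | zero => simp [Nat.mod_one]
  | succ k ih => rw [Finset.sum_range_succ, ih, Nat.mod_pow_succ, dg, mul_comm (B ^ k)]

theorem dg_ext {B k x y : ℕ} (hx : x < B ^ k) (hy : y < B ^ k)
    (h : ∀ i < k, dg B x i = dg B y i) : x = y := by
  rw [← Nat.mod_eq_of_lt hx, ← Nat.mod_eq_of_lt hy, ← sum_dg, ← sum_dg]
  exact Finset.sum_congr rfl fun i hi => by rw [h i (Finset.mem_range.1 hi)]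

theorem sum_digits_lt {B : ℕ} (k : ℕ) {f : ℕ → ℕ} (hf : ∀ i < k, f i < B) :
    ∑ i ∈ Finset.range k, f i * B ^ i < B ^ k := by
  induction k with
  | zero => simp
  | succ k ih =>
    rw [Finset.sum_range_succ, pow_succ]
    have h1 := ih fun i hi => hf i (by omega)
    have h2 : (f k + 1) * B ^ k ≤ B * B ^ k := Nat.mul_le_mul_right _ (hf k (by omega))
    rw [mul_comm (B ^ k)]
    linarith

theorem dg_sum_digits {B k : ℕ} {f : ℕ → ℕ} (hf : ∀ i < k, f i < B) {i : ℕ} (hi : i < k) :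
    dg B (∑ i ∈ Finset.range k, f i * B ^ i) i = f i := by
  have hB : 0 < B := (Nat.zero_le _).trans_lt (hf i hi)
  have h1 := sum_digits_lt i (B := B) (f := f) fun j hj => hf j (hj.trans hi)
  have h2 : ∑ j ∈ Finset.range k, f j * B ^ j =
      ∑ j ∈ Finset.range i, f j * B ^ j +
        (f i + B * ∑ j ∈ Finset.range (k - i - 1), f (i + 1 + j) * B ^ j) * B ^ i := by
    obtain ⟨m, rfl⟩ := Nat.exists_eq_add_of_lt hi
    have h3 : ∀ j, f (i + (j + 1)) * B ^ (i + (j + 1)) =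
        B ^ (i + 1) * (f (i + 1 + j) * B ^ j) := fun j => by
      rw [show i + 1 + j = i + (j + 1) by omega]
      ring
    rw [add_assoc i m 1, Finset.sum_range_add, show i + (m + 1) - i - 1 = m by omega,
      Finset.sum_range_succ', Finset.sum_congr rfl fun j _ => h3 j, ← Finset.mul_sum]
    rw [show f (i + 0) * B ^ (i + 0) = f i * B ^ i from rfl]
    generalize ∑ j ∈ Finset.range i, f j * B ^ j = a
    generalize ∑ j ∈ Finset.range m, f (i + 1 + j) * B ^ j = b
    ring
  rw [dg, h2, Nat.add_mul_div_right _ _ (by positivity), Nat.div_eq_of_lt h1, zero_add,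
    Nat.add_mul_mod_self_left, Nat.mod_eq_of_lt (hf i hi)]

theorem dg_lt {B : ℕ} (hB : 0 < B) (x i : ℕ) : dg B x i < B := Nat.mod_lt _ hB

/-! ### Clauses as numbers

A clause is a number with `k` digits in base `B`; the digit `0` is a blank, and every other digit is
a literal. -/

section Codes
open Finset

/-- The set of pairs of a position and a literal of a clause. -/
def cl (B k c : ℕ) : Finset (ℕ × ℕ) := {i ∈ range k | dg B c i ≠ 0}.image fun i => (i, dg B c i)

def subc (B k c' c : ℕ) : Prop := ∀ i < k, dg B c' i = 0 ∨ dg B c' i = dg B c i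

/-- The number of literals of a clause. -/
noncomputable def csz (B k c : ℕ) : ℕ := countP k fun i => dg B c i ≠ 0

/-- Membership in a set of numbers that is represented by its bit mask. -/
def bt (m c : ℕ) : Prop := dg 2 m c = 1

open Classical in
/-- The family of clauses with the given bit mask. -/
noncomputable def fam (B k m : ℕ) : Finset (Finset (ℕ × ℕ)) :=
  {c ∈ range (B ^ k) | bt m c}.image (cl B k)

variable {B k : ℕ}

theorem mem_cl {c : ℕ} {u : ℕ × ℕ} : u ∈ cl B k c ↔ u.1 < k ∧ u.2 ≠ 0 ∧ dg B c u.1 = u.2 := by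
  obtain ⟨i, d⟩ := u
  simp only [cl, mem_image, mem_filter, mem_range, Prod.mk.injEq]
  constructor
  · rintro ⟨i, ⟨h1, h2⟩, rfl, rfl⟩
    exact ⟨h1, h2, rfl⟩
  · rintro ⟨h1, h2, rfl⟩
    exact ⟨i, ⟨h1, h2⟩, rfl, rfl⟩

theorem cl_subset_cl {c' c : ℕ} : cl B k c' ⊆ cl B k c ↔ subc B k c' c := by
  constructor
  · intro h i hi
    by_cases h0 : dg B c' i = 0
    · exact .inl h0
    · exact .inr (mem_cl.1 (h (mem_cl.2 ⟨hi, h0, rfl⟩ : (i, dg B c' i) ∈ cl B k c'))).2.2.symm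
  · intro h u hu
    rw [mem_cl] at hu ⊢
    rcases h u.1 hu.1 with h0 | h0
    · exact absurd (hu.2.2.symm.trans h0) hu.2.1
    · exact ⟨hu.1, hu.2.1, by rw [← h0, hu.2.2]⟩

theorem cl_injOn : Set.InjOn (cl B k) (range (B ^ k) : Finset ℕ) := by
  intro c hc c' hc' h
  simp only [coe_range, Set.mem_Iio] at hc hc'
  refine dg_ext hc hc' fun i hi => ?_
  have h1 := cl_subset_cl.1 h.subset i hi
  have h2 := cl_subset_cl.1 h.superset i hi
  omega

theorem cl_inj {c c' : ℕ} (hc : c < B ^ k) (hc' : c' < B ^ k) : cl B k c = cl B k c' ↔ c = c' :=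
  ⟨fun h => cl_injOn (by simpa using hc) (by simpa using hc') h, fun h => h ▸ rfl⟩

theorem card_cl (c : ℕ) : (cl B k c).card = csz B k c := by
  rw [cl, card_image_of_injective _ fun i j h => (Prod.mk.injEq _ _ _ _ ▸ h).1, csz, countP_eq]

/-- Blanking the positions of `c` that are not in `H` gives the code. -/
theorem exists_cl_eq {c : ℕ} {H : Finset (ℕ × ℕ)} (hB : 0 < B) (hH : H ⊆ cl B k c) :
    ∃ c' < B ^ k, cl B k c' = H := by
  classical
  have hf : ∀ i < k, (if (i, dg B c i) ∈ H then dg B c i else 0) < B := fun i _ => by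
    split_ifs
    · exact dg_lt hB c i
    · exact hB
  refine ⟨_, sum_digits_lt k hf, ?_⟩
  ext ⟨i, d⟩
  rw [mem_cl]
  constructor
  · rintro ⟨hi, h0, h⟩
    rw [dg_sum_digits hf hi] at h
    split_ifs at h with hm
    · dsimp only at h
      rwa [h] at hm
    · exact absurd h.symm h0
  · intro h
    obtain ⟨h1, h2, h3⟩ := mem_cl.1 (hH h)
    dsimp only at h1 h2 h3
    subst h3
    exact ⟨h1, h2, by rw [dg_sum_digits hf h1, if_pos h]⟩

theorem mem_fam {m : ℕ} {C : Finset (ℕ × ℕ)} :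
    C ∈ fam B k m ↔ ∃ c < B ^ k, bt m c ∧ cl B k c = C := by
  simp [fam, and_assoc]

theorem cl_mem_fam {m c : ℕ} (hc : c < B ^ k) : cl B k c ∈ fam B k m ↔ bt m c := by
  rw [mem_fam]
  constructor
  · rintro ⟨c', hc', h, he⟩
    rwa [← (cl_inj hc' hc).1 he]
  · exact fun h => ⟨c, hc, h, rfl⟩

theorem bt_mask {n i : ℕ} {P : ℕ → Prop} : bt (mask n P) i ↔ i < n ∧ P i := dg_mask

theorem mem_fam_mask {P : ℕ → Prop} {C : Finset (ℕ × ℕ)} :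
    C ∈ fam B k (mask (B ^ k) P) ↔ ∃ c < B ^ k, P c ∧ cl B k c = C := by
  simp only [mem_fam, bt_mask]
  exact exists_congr fun c => by tauto

noncomputable def cdeg (B k m c H : ℕ) : ℕ :=
  countP (B ^ k) fun C => bt m C ∧ csz B k C = c ∧ subc B k H C

theorem cdeg_eq (m c H : ℕ) : cdeg B k m c H = Sparsify.deg (fam B k m) c (cl B k H) := by
  classical
  rw [cdeg, countP_eq, Sparsify.deg, fam, filter_image, card_image_of_injOn, filter_filter]
  · simp only [card_cl, cl_subset_cl]
  · exact cl_injOn.mono fun c hc => by simp at hc ⊢; exact hc.1.1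

/-- The number `t` describes a flower: its digits are the size of the sets, the number of literals
that the heart misses, and the heart. -/
def Flower (B k D m t : ℕ) : Prop :=
  let H := t % B ^ k
  let s := t / B ^ k % (k + 1)
  let c := t / B ^ k / (k + 1)
  csz B k H + s = k ∧ 1 ≤ csz B k H ∧ csz B k H < c ∧
    D ^ (c - csz B k H) ≤ cdeg B k m c H

/-- The members of the family that is reduced in a step. -/
def Cand (B k m t : ℕ) (P : Prop) (C : ℕ) : Prop :=
  let H := t % B ^ k
  let c := t / B ^ k / (k + 1)
  bt m C ∨ (¬P ∧ C = H) ∨ (P ∧ ∃ C₀ < B ^ k, bt m C₀ ∧ csz B k C₀ = c ∧ subc B k H C₀ ∧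
    ∀ i < k, (dg B H i = 0 ∧ dg B C i = dg B C₀ i) ∨ (dg B H i ≠ 0 ∧ dg B C i = 0))

noncomputable def flowers (B k : ℕ) : ℕ := (k + 1) * (k + 1) * B ^ k

noncomputable def firstFlower (B k D m : ℕ) : ℕ := least (flowers B k) (Flower B k D m)

/-- One step of sparsification. -/
noncomputable def stepc (B k D m : ℕ) (P : Prop) : ℕ :=
  open Classical in
  if firstFlower B k D m < flowers B k then
    mask (B ^ k) fun C => Cand B k m (firstFlower B k D m) P C ∧
      ∀ C' < B ^ k, Cand B k m (firstFlower B k D m) P C' → subc B k C' C → C' = C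
  else m

/-- A heavy `H` lies in some member and therefore has a code. The middle digit stores `k - H.card`
rather than `H.card`, so that numerically smaller codes mean larger hearts. -/
theorem exists_flower {D m c : ℕ} {H : Finset (ℕ × ℕ)} (hB : 0 < B) (hD : 1 ≤ D)
    (h : Sparsify.Heavy D (fam B k m) c H) :
    ∃ H' < B ^ k, cl B k H' = H ∧ c ≤ k ∧ (c * (k + 1) + (k - H.card)) * B ^ k + H' < flowers B k ∧
      Flower B k D m ((c * (k + 1) + (k - H.card)) * B ^ k + H') := by
  obtain ⟨C, hC, hcard, hsub⟩ := h.exists_mem hD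
  obtain ⟨C, -, -, rfl⟩ := mem_fam.1 hC
  obtain ⟨H', hH', rfl⟩ := exists_cl_eq hB hsub
  have hck : c ≤ k := by
    rw [← hcard, card_cl, csz, countP_eq]
    exact (card_filter_le _ _).trans (by simp)
  refine ⟨H', hH', rfl, hck, ?_, ?_⟩
  · have h1 : c * (k + 1) + (k - (cl B k H').card) + 1 ≤ (k + 1) * (k + 1) := by
      have := Nat.mul_le_mul_right (k + 1) hck
      rw [add_mul k 1]
      omega
    have h2 := Nat.mul_le_mul_right (B ^ k) h1
    rw [add_mul _ 1, one_mul] at h2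
    rw [flowers]
    omega
  · have hZ : 0 < B ^ k := Nat.pow_pos hB
    have h1 : ((c * (k + 1) + (k - (cl B k H').card)) * B ^ k + H') % B ^ k = H' := by
      rw [Nat.mul_add_mod_self_right, Nat.mod_eq_of_lt hH']
    have h2 : ((c * (k + 1) + (k - (cl B k H').card)) * B ^ k + H') / B ^ k =
        c * (k + 1) + (k - (cl B k H').card) := by
      rw [add_comm, Nat.add_mul_div_right _ _ hZ, Nat.div_eq_of_lt hH', zero_add]
    have h3 : (c * (k + 1) + (k - (cl B k H').card)) % (k + 1) = k - (cl B k H').card := by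
      rw [Nat.mul_add_mod_self_right, Nat.mod_eq_of_lt (by omega)]
    have h4 : (c * (k + 1) + (k - (cl B k H').card)) / (k + 1) = c := by
      rw [add_comm, Nat.add_mul_div_right _ _ (by omega), Nat.div_eq_of_lt (by omega), zero_add]
    have h5 := h.2.1
    simp only [Flower, h1, h2, h3, h4, cdeg_eq, ← card_cl]
    exact ⟨by omega, h.1, h.2.1, h.2.2⟩

theorem Flower.heavy {D m t : ℕ} (h : Flower B k D m t) :
    Sparsify.Heavy D (fam B k m) (t / B ^ k / (k + 1)) (cl B k (t % B ^ k)) := by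
  obtain ⟨h1, h2, h3, h4⟩ := h
  rw [cdeg_eq] at h4
  simp only [← card_cl] at h2 h3 h4
  exact ⟨h2, h3, h4⟩

theorem not_heavy_of_flowers_le {D m : ℕ} (hB : 0 < B) (hD : 1 ≤ D)
    (h : ¬firstFlower B k D m < flowers B k) (c : ℕ) (H : Finset (ℕ × ℕ)) :
    ¬Sparsify.Heavy D (fam B k m) c H := by
  intro hH
  obtain ⟨H', -, -, -, h1, h2⟩ := exists_flower hB hD hH
  exact h (least_spec ⟨_, h1, h2⟩).1

/-- The leading digit of the number of a flower is the size of its sets, followed by the deficiency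
of the heart. The least number thus minimizes the size first and then maximizes the heart, which is
the order that `Extremal` asks for. -/
theorem firstFlower_spec {D m : ℕ} (hB : 0 < B) (hD : 1 ≤ D)
    (h : firstFlower B k D m < flowers B k) :
    Sparsify.Extremal D (fam B k m) (firstFlower B k D m / B ^ k / (k + 1))
      (cl B k (firstFlower B k D m % B ^ k)) := by
  classical
  have hex : ∃ t < flowers B k, Flower B k D m t := by
    by_contra! hno
    refine absurd h (not_lt.2 ?_)
    rw [firstFlower, least, countP_eq, filter_true_of_mem]
    · simp
    · intro i hi j hj
      rw [mem_range] at hi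
      exact hno j (by omega)
  obtain ⟨-, hF, hmin⟩ := least_spec hex
  rw [← firstFlower] at hF hmin
  generalize firstFlower B k D m = t at *
  have hZ : 0 < B ^ k := Nat.pow_pos hB
  have hlt : ∀ c H', H' < B ^ k → c * (k + 1) + (k - (cl B k H').card) < t / B ^ k →
      ¬Sparsify.Heavy D (fam B k m) c (cl B k H') := by
    intro c H' hH' hlt hH
    obtain ⟨H'', h1, h2, h3, h4, h5⟩ := exists_flower hB hD hH
    rw [cl_inj h1 hH'] at h2
    subst h2
    refine hmin _ ?_ h5
    have h6 := Nat.mul_le_mul_right (B ^ k) (Nat.succ_le_of_lt hlt)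
    have h7 := Nat.div_mul_le_self t (B ^ k)
    rw [Nat.succ_mul] at h6
    omega
  have hs := hF.1
  rw [← card_cl] at hs
  have hdm := Nat.div_add_mod' (t / B ^ k) (k + 1)
  refine ⟨hF.heavy, ?_, ?_⟩
  · intro c' H' hc' hH
    obtain ⟨H'', h1, rfl, -⟩ := exists_flower hB hD hH
    refine hlt c' H'' h1 ?_ hH
    have := Nat.mul_le_mul_right (k + 1) (Nat.succ_le_of_lt hc')
    rw [Nat.succ_mul] at this
    omega
  · intro H' hH' hH
    obtain ⟨H'', h1, rfl, -⟩ := exists_flower hB hD hH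
    refine hlt _ H'' h1 ?_ hH
    have := hH.2.1
    obtain ⟨_, _, _, hck, -⟩ := exists_flower hB hD hH
    omega

/-- Candidates are exactly the codes of members of the enlarged family, and `subc` is inclusion of
the coded sets; so the arithmetic step is the set-theoretic one. -/
theorem fam_stepc_eq {D m : ℕ} {P : Prop} (hB : 0 < B) (h : firstFlower B k D m < flowers B k) :
    (P → fam B k (stepc B k D m P) = Sparsify.reduce (fam B k m ∪ Sparsify.petals (fam B k m)
      (firstFlower B k D m / B ^ k / (k + 1)) (cl B k (firstFlower B k D m % B ^ k)))) ∧
    (¬P → fam B k (stepc B k D m P) =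
      Sparsify.reduce (fam B k m ∪ {cl B k (firstFlower B k D m % B ^ k)})) := by
  classical
  rw [stepc, if_pos h]
  generalize firstFlower B k D m = t at *
  have hZ : 0 < B ^ k := Nat.pow_pos hB
  set N : Finset (Finset (ℕ × ℕ)) :=
    if P then Sparsify.petals (fam B k m) (t / B ^ k / (k + 1)) (cl B k (t % B ^ k))
    else {cl B k (t % B ^ k)} with hN
  have hcand : ∀ C < B ^ k, Cand B k m t P C ↔ cl B k C ∈ fam B k m ∪ N := by
    intro C hC
    rw [mem_union, cl_mem_fam hC, Cand]
    refine or_congr_right ?_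
    by_cases hP : P
    · simp only [hN, hP, not_true_eq_false, false_and, true_and, false_or, if_true,
        Sparsify.petals, mem_image, mem_filter, mem_fam]
      constructor
      · rintro ⟨C₀, h0, h1, h2, h3, h4⟩
        refine ⟨_, ⟨⟨C₀, h0, h1, rfl⟩, (card_cl C₀).trans h2, cl_subset_cl.2 h3⟩, ?_⟩
        ext ⟨i, d⟩
        simp only [Finset.mem_sdiff, mem_cl]
        constructor
        · rintro ⟨⟨h5, h6, h7⟩, h8⟩
          rcases h4 i h5 with h9 | h9
          · exact ⟨h5, h6, by omega⟩
          · refine absurd ⟨h5, h6, ?_⟩ h8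
            have := h3 i h5
            omega
        · rintro ⟨h5, h6, h7⟩
          rcases h4 i h5 with h9 | h9
          · exact ⟨⟨h5, h6, by omega⟩, fun h => by omega⟩
          · omega
      · rintro ⟨_, ⟨⟨C₀, h0, h1, rfl⟩, h2, h3⟩, h4⟩
        have h3' := cl_subset_cl.1 h3
        refine ⟨C₀, h0, h1, (card_cl C₀).symm.trans h2, h3', fun i hi => ?_⟩
        by_cases h5 : dg B (t % B ^ k) i = 0
        · refine .inl ⟨h5, ?_⟩
          have h6 : (i, dg B C₀ i) ∈ cl B k C ↔ dg B C₀ i ≠ 0 := by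
            rw [← h4]
            simp only [Finset.mem_sdiff, mem_cl, hi, h5]
            constructor
            · exact fun h => h.1.2.1
            · exact fun h => ⟨⟨trivial, h, trivial⟩, fun h' => h h'.2.2.symm⟩
          have h7 : (i, dg B C i) ∈ cl B k C₀ \ cl B k (t % B ^ k) ↔ dg B C i ≠ 0 := by
            rw [h4, mem_cl]
            simp [hi]
          simp only [Finset.mem_sdiff, mem_cl] at h6 h7
          by_cases h8 : dg B C i = 0
          · by_contra h9
            have := (h6.2 (fun h => h9 (h8.trans h.symm))).2.2
            exact h9 this
          · exact (h7.2 h8).1.2.2.symm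
        · refine .inr ⟨h5, ?_⟩
          by_contra h6
          have h7 : (i, dg B C i) ∈ cl B k C₀ \ cl B k (t % B ^ k) := by
            rw [h4, mem_cl]
            exact ⟨hi, h6, rfl⟩
          simp only [Finset.mem_sdiff, mem_cl] at h7
          refine h7.2 ⟨hi, h6, ?_⟩
          have := h3' i hi
          have := h7.1.2.2
          omega
    · simp only [hN, hP, not_false_eq_true, false_and, true_and, or_false, if_false, mem_singleton]
      exact (cl_inj hC (Nat.mod_lt _ hZ)).symm
  have hsubset : ∀ C ∈ fam B k m ∪ N, ∃ c < B ^ k, cl B k c = C := by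
    intro C hC
    rcases mem_union.1 hC with hC | hC
    · obtain ⟨c, hc, -, h⟩ := mem_fam.1 hC
      exact ⟨c, hc, h⟩
    · rw [hN] at hC
      split_ifs at hC
      · simp only [Sparsify.petals, mem_image, mem_filter, mem_fam] at hC
        obtain ⟨_, ⟨⟨c, -, -, rfl⟩, -⟩, rfl⟩ := hC
        exact exists_cl_eq hB sdiff_subset
      · exact ⟨_, Nat.mod_lt _ hZ, (mem_singleton.1 hC).symm⟩
  suffices H : fam B k (mask (B ^ k) fun C => Cand B k m t P C ∧
      ∀ C' < B ^ k, Cand B k m t P C' → subc B k C' C → C' = C) =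
      Sparsify.reduce (fam B k m ∪ N) by
    rw [H]
    exact ⟨fun hP => by rw [hN, if_pos hP], fun hP => by rw [hN, if_neg hP]⟩
  ext C
  rw [mem_fam_mask, Sparsify.reduce, mem_filter]
  constructor
  · rintro ⟨c, hc, ⟨h1, h2⟩, rfl⟩
    refine ⟨(hcand c hc).1 h1, fun C' hC' hsub => ?_⟩
    obtain ⟨c', hc', rfl⟩ := hsubset C' hC'
    rw [h2 c' hc' ((hcand c' hc').2 hC') (cl_subset_cl.1 hsub)]
  · rintro ⟨h1, h2⟩
    obtain ⟨c, hc, rfl⟩ := hsubset C h1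
    refine ⟨c, hc, ⟨(hcand c hc).2 h1, fun c' hc' h3 h4 => ?_⟩, rfl⟩
    exact (cl_inj hc' hc).1 (h2 _ ((hcand c' hc').1 h3) (cl_subset_cl.2 h4))

theorem fam_stepc {D m : ℕ} {P : Prop} (hB : 0 < B) (hD : 1 ≤ D)
    (h : firstFlower B k D m < flowers B k) :
    Sparsify.Step D P (fam B k m) (fam B k (stepc B k D m P)) :=
  ⟨_, _, firstFlower_spec hB hD h, fam_stepc_eq hB h⟩

end Codes
end RAM

namespace Sparsify
open Finset

theorem Step.good {U : Type} [DecidableEq U] {k D : ℕ} {V : Finset U} {P : Prop}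
    {F F' : Finset (Finset U)} (hD : 1 ≤ D) (h : Step D P F F') (hF : Good k V F) : Good k V F' := by
  obtain ⟨c, H, hE, h1, h2⟩ := h
  have hI : Inv k D V F ∅ := ⟨hF, empty_subset _, by simp [deg]⟩
  by_cases hP : P
  · obtain ⟨A, hA, -⟩ := hI.petals hD hE
    exact h1 hP ▸ hA.good
  · obtain ⟨A, hA, -⟩ := hI.heart hD hE
    exact h2 hP ▸ hA.good

end Sparsify

/-! ### Iterated sparsification and the vectors of half-assignments -/

namespace RAM
section Codes
open Finset

/-- The sparsification process; `P i` tells whether petals are added in step `i`. -/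
noncomputable def runc (B k D m₀ : ℕ) (P : ℕ → Prop) : ℕ → ℕ
  | 0 => m₀
  | i + 1 => stepc B k D (runc B k D m₀ P i) (P i)

/-- The process in which petals are added whenever `τ` falsifies the heart. -/
noncomputable def guided (B k D m₀ : ℕ) (τ : ℕ × ℕ → Prop) : ℕ → ℕ
  | 0 => m₀
  | i + 1 => stepc B k D (guided B k D m₀ τ i)
      (¬∃ u ∈ cl B k (firstFlower B k D (guided B k D m₀ τ i) % B ^ k), τ u)

variable {B k D m₀ : ℕ} {τ : ℕ × ℕ → Prop}

theorem stepc_of_not_lt {m : ℕ} {P : Prop} (h : ¬firstFlower B k D m < flowers B k) :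
    stepc B k D m P = m := if_neg h

/-- This is the soundness of all branches: `P` is arbitrary, so wrong advice never creates
satisfying assignments. -/
theorem sat_of_sat_runc (hB : 0 < B) (hD : 1 ≤ D) {P : ℕ → Prop} (n : ℕ)
    (h : ∀ C ∈ fam B k (runc B k D m₀ P n), ∃ u ∈ C, τ u) : ∀ C ∈ fam B k m₀, ∃ u ∈ C, τ u := by
  induction n with
  | zero => exact h
  | succ n ih =>
    refine ih ?_
    rw [runc] at h
    by_cases hf : firstFlower B k D (runc B k D m₀ P n) < flowers B k
    · exact (fam_stepc hB hD hf).sat h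
    · rwa [stepc_of_not_lt hf] at h

theorem good_runc (hB : 0 < B) (hD : 1 ≤ D) {V : Finset (ℕ × ℕ)}
    (h0 : Sparsify.Good k V (fam B k m₀)) (P : ℕ → Prop) (n : ℕ) :
    Sparsify.Good k V (fam B k (runc B k D m₀ P n)) := by
  induction n with
  | zero => exact h0
  | succ n ih =>
    rw [runc]
    by_cases hf : firstFlower B k D (runc B k D m₀ P n) < flowers B k
    · exact (fam_stepc hB hD hf).good hD ih
    · rwa [stepc_of_not_lt hf]

/-- Each step adds only sets that `τ` meets: the heart if it is met, and otherwise the petals. -/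
theorem sat_guided (hB : 0 < B) (h : ∀ C ∈ fam B k m₀, ∃ u ∈ C, τ u) (n : ℕ) :
    ∀ C ∈ fam B k (guided B k D m₀ τ n), ∃ u ∈ C, τ u := by
  induction n with
  | zero => exact h
  | succ n ih =>
    rw [guided]
    by_cases hf : firstFlower B k D (guided B k D m₀ τ n) < flowers B k
    · have hH : ∃ F N, (∀ C ∈ F, ∃ u ∈ C, τ u) ∧ (∀ C ∈ N, ∃ u ∈ C, τ u) ∧
          fam B k (stepc B k D (guided B k D m₀ τ n)
            (¬∃ u ∈ cl B k (firstFlower B k D (guided B k D m₀ τ n) % B ^ k), τ u)) =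
          Sparsify.reduce (F ∪ N) := by
        obtain ⟨h1, h2⟩ := fam_stepc_eq hB hf
          (P := ¬∃ u ∈ cl B k (firstFlower B k D (guided B k D m₀ τ n) % B ^ k), τ u)
        by_cases hs : ∃ u ∈ cl B k (firstFlower B k D (guided B k D m₀ τ n) % B ^ k), τ u
        · exact ⟨_, _, ih, by simpa using hs, h2 (not_not.2 hs)⟩
        · exact ⟨_, _, ih, Sparsify.sat_petals ih hs, h1 hs⟩
      obtain ⟨F, N, hF, hN, he⟩ := hH
      rw [he]
      exact Sparsify.sat_reduce_union hF hN
    · rwa [stepc_of_not_lt hf]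

/-- A satisfied formula stays satisfied for a suitable small set of petal steps, and becomes sparse
after boundedly many steps. -/
theorem exists_petal_steps (hB : 0 < B) (hD : 1 ≤ D) {V : Finset (ℕ × ℕ)}
    (h0 : Sparsify.Good k V (fam B k m₀)) (h : ∀ C ∈ fam B k m₀, ∃ u ∈ C, τ u) :
    ∃ S : Finset ℕ, (∀ i ∈ S, i < V.card * (5 * D) ^ k) ∧ S.card * D ≤ V.card * 5 ^ k ∧
      ∀ P : ℕ → Prop, (∀ i < V.card * (5 * D) ^ k, P i ↔ i ∈ S) →
        (∀ C ∈ fam B k (runc B k D m₀ P (V.card * (5 * D) ^ k)), ∃ u ∈ C, τ u) ∧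
        ¬firstFlower B k D (runc B k D m₀ P (V.card * (5 * D) ^ k)) < flowers B k := by
  classical
  set St := V.card * (5 * D) ^ k with hSt
  let g := guided B k D m₀ τ
  let fl : ℕ → Prop := fun i => firstFlower B k D (g i) < flowers B k
  let Q : ℕ → Prop := fun i => ¬∃ u ∈ cl B k (firstFlower B k D (g i) % B ^ k), τ u
  have hstep : ∀ n, (∀ i < n, fl i) →
      ∀ i < n, Sparsify.Step D (Q i) (fam B k (g i)) (fam B k (g (i + 1))) :=
    fun n hn i hi => fam_stepc hB hD (hn i hi)
  -- A run with flowers in all of the first `St + 1` rounds would contradict the bound on the number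
  -- of steps.
  have hex : ∃ i, ¬fl i := by
    by_contra! hno
    have := (Sparsify.steps_le hD (fun i => fam B k (g i)) Q h0 (St + 1)
      (hstep _ fun i _ => hno i)).1
    omega
  obtain ⟨n, hn, hmin⟩ : ∃ n, ¬fl n ∧ ∀ i < n, fl i :=
    ⟨Nat.find hex, Nat.find_spec hex, fun i hi => not_not.1 (Nat.find_min hex hi)⟩
  obtain ⟨h1, h2, -⟩ := Sparsify.steps_le hD (fun i => fam B k (g i)) Q h0 n (hstep n hmin)
  -- Once there is no flower, the process is stationary. It can therefore be run for a fixed number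
  -- of rounds, whatever the advice says about the later ones.
  have hconst : ∀ i, n ≤ i → g i = g n := by
    intro i hi
    induction i, hi using Nat.le_induction with
    | base => rfl
    | succ i hi ih =>
      change stepc B k D (g i) _ = g n
      rw [ih, stepc_of_not_lt hn]
  refine ⟨{i ∈ range n | Q i}, fun i hi => ?_, h2, fun P hP => ?_⟩
  · have := mem_range.1 (mem_filter.1 hi).1
    omega
  · have hrun : ∀ i ≤ St, runc B k D m₀ P i = g i := by
      intro i
      induction i with
      | zero => exact fun _ => rfl
      | succ i ih =>
        intro hi
        rw [runc, ih (by omega)]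
        change _ = stepc B k D (g i) (Q i)
        by_cases hin : i < n
        · rw [show P i = Q i from propext ((hP i (by omega)).trans (by simp [hin]))]
        · have : ¬firstFlower B k D (g i) < flowers B k := by
            rw [hconst i (by omega)]
            exact hn
          rw [stepc_of_not_lt this, stepc_of_not_lt this]
    rw [hrun St le_rfl]
    exact ⟨sat_guided hB h St, by rw [hconst St h1]; exact hn⟩

/-- Small sets of numbers are sets of digits. -/
theorem exists_digits {St r : ℕ} {S : Finset ℕ} (hS : ∀ i ∈ S, i < St) (hr : S.card ≤ r) :
    ∃ j < (St + 1) ^ r, ∀ i < St, (∃ u < r, dg (St + 1) j u = i) ↔ i ∈ S := by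
  -- The base is `St + 1` so that the digit `St`, which names no step, can pad the list when `S` has
  -- fewer than `r` elements.
  have hf : ∀ u < r, S.toList.getD u St < St + 1 := by
    intro u _
    by_cases h : u < S.toList.length
    · rw [List.getD_eq_getElem _ _ h]
      exact (hS _ (Finset.mem_toList.1 (List.getElem_mem h))).trans (by omega)
    · rw [List.getD_eq_default _ _ (by omega)]
      omega
  refine ⟨_, sum_digits_lt r hf, fun i hi => ⟨?_, fun h => ?_⟩⟩
  · rintro ⟨u, hu, rfl⟩
    rw [dg_sum_digits hf hu] at hi ⊢
    by_cases h : u < S.toList.length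
    · rw [List.getD_eq_getElem _ _ h]
      exact Finset.mem_toList.1 (List.getElem_mem h)
    · rw [List.getD_eq_default _ _ (by omega)] at hi
      omega
  · obtain ⟨u, hu, rfl⟩ := List.getElem_of_mem (Finset.mem_toList.2 h)
    have hur : u < r := by rw [Finset.length_toList] at hu; omega
    exact ⟨u, hur, by rw [dg_sum_digits hf hur, List.getD_eq_getElem _ _ hu]⟩

/-- The literal `d - 1 = 2 v + s` is true: the first `h` variables have the bits of `x` as values,
and the others the bits of `y`. -/
def trueLit (h x y d : ℕ) : Prop :=
  if (d - 1) / 2 < h then dg 2 x ((d - 1) / 2) = (d - 1) % 2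
  else dg 2 y ((d - 1) / 2 - h) = (d - 1) % 2

/-- No literal of the clause on the first `h` variables is true. -/
def afal (B k h x C : ℕ) : Prop := ∀ i < k, dg B C i = 0 ∨
  h ≤ (dg B C i - 1) / 2 ∨ dg 2 x ((dg B C i - 1) / 2) ≠ (dg B C i - 1) % 2

/-- No literal of the clause on the other variables is true. -/
def bfal (B k h y C : ℕ) : Prop := ∀ i < k, dg B C i = 0 ∨
  (dg B C i - 1) / 2 < h ∨ dg 2 y ((dg B C i - 1) / 2 - h) ≠ (dg B C i - 1) % 2

theorem afal_and_bfal {h x y C : ℕ} :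
    afal B k h x C ∧ bfal B k h y C ↔ ¬∃ u ∈ cl B k C, trueLit h x y u.2 := by
  constructor
  · rintro ⟨h1, h2⟩ ⟨⟨i, d⟩, hu, ht⟩
    obtain ⟨hi, h0, h3⟩ := mem_cl.1 hu
    dsimp only at hi h0 h3 ht
    have h1 := h1 i hi
    have h2 := h2 i hi
    rw [h3] at h1 h2
    rw [trueLit] at ht
    split_ifs at ht with hv
    · omega
    · omega
  · intro hno
    have key : ∀ i < k, dg B C i ≠ 0 → ¬trueLit h x y (dg B C i) := fun i hi h0 ht =>
      hno ⟨(i, dg B C i), mem_cl.2 ⟨hi, h0, rfl⟩, ht⟩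
    constructor <;> intro i hi <;> by_cases h0 : dg B C i = 0
    · exact .inl h0
    · have := key i hi h0
      rw [trueLit] at this
      split_ifs at this with hv
      · exact .inr (.inr this)
      · exact .inr (.inl (not_lt.1 hv))
    · exact .inl h0
    · have := key i hi h0
      rw [trueLit] at this
      split_ifs at this with hv
      · exact .inr (.inl hv)
      · exact .inr (.inr this)

/-- The `e`-th clause of the family `m` has the property `Q`. If the family is not sparse, then this
counts as true. -/
noncomputable def flag (B k D m e : ℕ) (Q : ℕ → Prop) : ℕ :=
  ind (firstFlower B k D m < flowers B k ∨ ∃ C < B ^ k, bt m C ∧ countP C (bt m) = e ∧ Q C)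

theorem countP_lt_countP {m C C' : ℕ} (h : C < C') (hC : bt m C) :
    countP C (bt m) < countP C' (bt m) := by
  have h1 : countP (C + 1) (bt m) ≤ countP C' (bt m) :=
    Finset.sum_le_sum_of_subset (range_subset_range.2 h)
  rw [countP, sum_range_succ, ind_true hC] at h1
  exact h1

/-- Coordinate `e` stands for the clause with `e` smaller codes in the family. Different clauses
have different ranks, so two flags at the same `e` speak of the same clause, and both being set
would mean that it is violated. -/
theorem sum_flag_eq_zero {m M h x y : ℕ} (hsp : ¬firstFlower B k D m < flowers B k)
    (hsat : ∀ C ∈ fam B k m, ∃ u ∈ C, trueLit h x y u.2) :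
    ∑ e ∈ range M, flag B k D m e (afal B k h x) * flag B k D m e (bfal B k h y) = 0 := by
  refine sum_eq_zero fun e _ => ?_
  by_contra hne
  obtain ⟨h1, h2⟩ := mul_ne_zero_iff.1 hne
  rw [flag, ne_eq, ind_eq_zero, not_not] at h1 h2
  obtain ⟨C, hC, hm, he, ha⟩ := h1.resolve_left hsp
  obtain ⟨C', hC', hm', he', hb⟩ := h2.resolve_left hsp
  obtain rfl : C = C' := by
    rcases lt_trichotomy C C' with hlt | heq | hlt
    · have := countP_lt_countP hlt hm
      omega
    · exact heq
    · have := countP_lt_countP hlt hm'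
      omega
  exact afal_and_bfal.1 ⟨ha, hb⟩ (hsat _ ((cl_mem_fam hC).2 hm))

/-- If the branch did not become sparse, all flags are `1` and the sum is positive, so such a branch
is rejected. Otherwise all ranks are below `M`, and a violated clause would contribute at its rank.
-/
theorem sat_of_sum_flag {m M h x y : ℕ} (hM : 0 < M)
    (hcard : ¬firstFlower B k D m < flowers B k → (fam B k m).card ≤ M)
    (h0 : ∑ e ∈ range M, flag B k D m e (afal B k h x) * flag B k D m e (bfal B k h y) = 0) :
    ∀ C ∈ fam B k m, ∃ u ∈ C, trueLit h x y u.2 := by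
  classical
  rw [sum_eq_zero_iff] at h0
  have hsp : ¬firstFlower B k D m < flowers B k := by
    intro hsp
    have := h0 0 (by simpa using hM)
    rw [flag, flag, ind_true (.inl hsp), ind_true (.inl hsp)] at this
    omega
  intro C hC
  obtain ⟨c, hc, hm, rfl⟩ := mem_fam.1 hC
  by_contra hno
  obtain ⟨ha, hb⟩ := afal_and_bfal.2 hno
  have he : countP c (bt m) < M := by
    refine lt_of_lt_of_le (countP_lt_countP hc hm) ?_
    refine le_trans (le_of_eq ?_) (hcard hsp)
    rw [countP_eq, fam, card_image_of_injOn]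
    exact cl_injOn.mono fun c hc => by simp at hc ⊢; exact hc.1
  have := h0 _ (mem_range.2 he)
  rw [flag, flag, ind_true (.inr ⟨c, hc, hm, rfl, ha⟩), ind_true (.inr ⟨c, hc, hm, rfl, hb⟩)] at this
  omega

/-- The petal steps are given by the digits of `j`. -/
def petalStep (St r j i : ℕ) : Prop := ∃ u < r, dg (St + 1) j u = i

end Codes
end RAM

namespace RAM

/-! ### The protocol -/

/-- Parameters: `q` is the field size, `g` and `T` are the dimensions of the grid of coordinates, `R`
is the number of repetitions, and there are `2 ^ h` vectors of either kind. -/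
structure Par where
  h : ℕ
  g : ℕ
  T : ℕ
  R : ℕ
  q : ℕ

namespace Par

/-- The number of messages. -/
def Q (P : Par) : ℕ := P.q ^ (P.R * P.T)

/-- Coordinate `i * P.T + w` sits in row `i` and column `w` of the grid, and each column is one
polynomial. Values are reduced modulo `q` only in `Accept`. -/
def apoly (P : Par) (al : ℕ → ℕ) (w t : ℕ) : ℕ := ∑ i ∈ Finset.range P.g, al (i * P.T + w) * t ^ i

/-- The exponents are reversed, so that equal rows of both vectors meet in degree `g - 1` of the
product. The value is reduced because it becomes a base-`q` digit of the message. -/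
def bpoly (P : Par) (be : ℕ → ℕ) (w t : ℕ) : ℕ :=
  (∑ i ∈ Finset.range P.g, be (i * P.T + w) * t ^ (P.g - 1 - i)) % P.q

/-- The coefficients of the claimed polynomial. -/
def coef (P : Par) (j i : ℕ) : ℕ := if i = P.g - 1 then 0 else dg P.q j i

def mpoly (P : Par) (j t : ℕ) : ℕ := ∑ i ∈ Finset.range (2 * P.g), P.coef j i * t ^ i

/-- The message for the random string `l`. -/
def msg (P : Par) (be : ℕ → ℕ) (l : ℕ) : ℕ :=
  ∑ u ∈ Finset.range (P.R * P.T), P.bpoly be (u % P.T) (dg P.q l (u / P.T)) * P.q ^ u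

def Accept (P : Par) (j : ℕ) (al : ℕ → ℕ) (l m : ℕ) : Prop :=
  ∀ r < P.R, P.mpoly j (dg P.q l r) % P.q =
    (∑ w ∈ Finset.range P.T, P.apoly al w (dg P.q l r) * dg P.q m (r * P.T + w)) % P.q

-- The symbol `2 * P.Q` is a blank that no entry of the second kind equals. The last `P.h` entries
-- spell out `x`; they match nothing and only make the vectors distinct. The index is clipped at
-- `P.h`, which keeps the exponent in `dg` polynomially bounded for arbitrary arguments.
open Classical in
noncomputable def aent (P : Par) (j : ℕ) (al : ℕ → ℕ) (x l κ : ℕ) : ℕ :=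
  if κ < 2 * P.Q then if P.Accept j al l (κ / 2) then κ else 2 * P.Q
  else 2 * P.Q + dg 2 x (P.h - (P.h - (κ - 2 * P.Q)))

/-- The lowest bit carries a bit of `y` to make the vectors distinct; the first player ignores it by
halving `κ`. -/
def bent (P : Par) (be : ℕ → ℕ) (y l : ℕ) : ℕ :=
  2 * P.msg be l + dg 2 y (P.h - (P.h - l))

variable {P : Par}

section Poly
open Polynomial

noncomputable def Ap (P : Par) (al : ℕ → ℕ) (w : ℕ) : (ZMod P.q)[X] :=
  ∑ i ∈ Finset.range P.g, C (al (i * P.T + w) : ZMod P.q) * X ^ i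

noncomputable def Bp (P : Par) (be : ℕ → ℕ) (w : ℕ) : (ZMod P.q)[X] :=
  ∑ i ∈ Finset.range P.g, C (be (i * P.T + w) : ZMod P.q) * X ^ (P.g - 1 - i)

noncomputable def Tp (P : Par) (al be : ℕ → ℕ) : (ZMod P.q)[X] :=
  ∑ w ∈ Finset.range P.T, P.Ap al w * P.Bp be w

noncomputable def Mp (P : Par) (j : ℕ) : (ZMod P.q)[X] :=
  ∑ i ∈ Finset.range (2 * P.g), C (P.coef j i : ZMod P.q) * X ^ i

theorem coeff_sum_C_mul_X_pow {A : Type} [Semiring A] (n : ℕ) (f : ℕ → A) (i : ℕ) :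
    (∑ m ∈ Finset.range n, C (f m) * X ^ m : A[X]).coeff i = if i < n then f i else 0 := by
  simp [coeff_C_mul, coeff_X_pow]

theorem coeff_Bp (be : ℕ → ℕ) (w i : ℕ) :
    (P.Bp be w).coeff i = if i < P.g then (be ((P.g - 1 - i) * P.T + w) : ZMod P.q) else 0 := by
  rw [Bp, ← Finset.sum_range_reflect, Finset.sum_congr rfl (g := fun i =>
    C (be ((P.g - 1 - i) * P.T + w) : ZMod P.q) * X ^ i), coeff_sum_C_mul_X_pow P.g
      fun i => (be ((P.g - 1 - i) * P.T + w) : ZMod P.q)]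
  intro i hi
  rw [Finset.mem_range] at hi
  rw [show P.g - 1 - (P.g - 1 - i) = i by omega]

theorem coeff_Tp_of_le (al be : ℕ → ℕ) {i : ℕ} (hi : 2 * P.g ≤ i) : (P.Tp al be).coeff i = 0 := by
  rw [Tp, finsetSum_coeff]
  refine Finset.sum_eq_zero fun w _ => ?_
  rw [coeff_mul]
  refine Finset.sum_eq_zero fun u hu => ?_
  rw [Finset.HasAntidiagonal.mem_antidiagonal] at hu
  rw [Ap, coeff_sum_C_mul_X_pow, coeff_Bp]
  by_cases h1 : u.1 < P.g
  · rw [if_neg (show ¬u.2 < P.g by omega), mul_zero]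
  · rw [if_neg h1, zero_mul]

/-- In degree `g - 1` the exponent `i` of the first factor meets `g - 1 - i` of the second, and both
belong to coordinate `i * P.T + w`. -/
theorem coeff_Tp (hg : 0 < P.g) (al be : ℕ → ℕ) : (P.Tp al be).coeff (P.g - 1) =
    ((∑ e ∈ Finset.range (P.g * P.T), al e * be e : ℕ) : ZMod P.q) := by
  have h1 : ∑ e ∈ Finset.range (P.g * P.T), al e * be e =
      ∑ w ∈ Finset.range P.T, ∑ i ∈ Finset.range P.g,
        al (i * P.T + w) * be (i * P.T + w) := by
    rw [Finset.sum_comm]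
    generalize P.g = g
    induction g with
    | zero => simp
    | succ g ih => rw [Nat.succ_mul, Finset.sum_range_add, ih, Finset.sum_range_succ]
  rw [h1, Tp, finsetSum_coeff]
  push_cast
  refine Finset.sum_congr rfl fun w _ => ?_
  rw [coeff_mul, Finset.Nat.sum_antidiagonal_eq_sum_range_succ_mk,
    show (P.g - 1).succ = P.g by omega]
  refine Finset.sum_congr rfl fun i hi => ?_
  rw [Finset.mem_range] at hi
  rw [Ap, coeff_sum_C_mul_X_pow, coeff_Bp, if_pos hi, if_pos (by omega),
    show P.g - 1 - (P.g - 1 - i) = i by omega]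

theorem eval_Tp (al be : ℕ → ℕ) (t : ℕ) : (P.Tp al be).eval (t : ZMod P.q) =
    ((∑ w ∈ Finset.range P.T, P.apoly al w t * P.bpoly be w t : ℕ) : ZMod P.q) := by
  simp only [Tp, Ap, Bp, apoly, bpoly, eval_finsetSum, eval_mul, eval_C, eval_pow, eval_X,
    Nat.cast_sum, Nat.cast_mul, Nat.cast_pow, ZMod.natCast_mod]

theorem eval_Mp (j t : ℕ) : (P.Mp j).eval (t : ZMod P.q) = (P.mpoly j t : ZMod P.q) := by
  simp only [Mp, mpoly, eval_finsetSum, eval_mul, eval_C, eval_pow, eval_X, Nat.cast_sum,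
    Nat.cast_mul, Nat.cast_pow]

theorem dg_msg (hq : 0 < P.q) (be : ℕ → ℕ) (l : ℕ) {r w : ℕ} (hr : r < P.R) (hw : w < P.T) :
    dg P.q (P.msg be l) (r * P.T + w) = P.bpoly be w (dg P.q l r) := by
  have h1 : r * P.T + w < P.R * P.T := by
    have := Nat.mul_le_mul_right P.T (Nat.succ_le_of_lt hr)
    rw [Nat.succ_mul] at this
    omega
  rw [msg, dg_sum_digits (f := fun u => P.bpoly be (u % P.T) (dg P.q l (u / P.T)))
    (fun u _ => Nat.mod_lt _ hq) h1, Nat.mul_add_mod_self_right,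
    Nat.mod_eq_of_lt hw, mul_comm, Nat.mul_add_div (by omega), Nat.div_eq_of_lt hw, add_zero]

theorem msg_lt (hq : 0 < P.q) (be : ℕ → ℕ) (l : ℕ) : P.msg be l < P.Q :=
  sum_digits_lt _ fun _ _ => Nat.mod_lt _ hq

theorem accept_msg (hq : 0 < P.q) {j : ℕ} {al be : ℕ → ℕ} {l : ℕ} :
    P.Accept j al l (P.msg be l) ↔ ∀ r < P.R, (P.Mp j).eval (dg P.q l r : ZMod P.q) =
      (P.Tp al be).eval (dg P.q l r : ZMod P.q) := by
  refine forall₂_congr fun r hr => ?_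
  rw [eval_Mp, eval_Tp, ZMod.natCast_eq_natCast_iff', Finset.sum_congr rfl fun w hw => by
    rw [dg_msg hq be l hr (Finset.mem_range.1 hw)]]

/-- The announcement consists of the true coefficients. Forcing coefficient `g - 1` to zero does no
harm, since it is the inner product, which vanishes. -/
theorem exists_Mp_eq (hg : 0 < P.g) (hq : 1 < P.q) {al be : ℕ → ℕ}
    (h : ∑ e ∈ Finset.range (P.g * P.T), al e * be e = 0) :
    ∃ j < P.q ^ (2 * P.g), P.Mp j = P.Tp al be := by
  have : NeZero P.q := ⟨by omega⟩
  have hf : ∀ i < 2 * P.g, ((P.Tp al be).coeff i).val < P.q := fun i _ => ZMod.val_lt _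
  refine ⟨_, sum_digits_lt _ hf, ?_⟩
  ext i
  rw [Mp, coeff_sum_C_mul_X_pow]
  split_ifs with hi
  · rw [coef, dg_sum_digits hf hi]
    split_ifs with h1
    · rw [h1, coeff_Tp hg, h]
    · exact ZMod.natCast_zmod_val _
  · exact (coeff_Tp_of_le al be (by omega)).symm

/-- The coefficient determines the inner product only modulo `q`; the bound `hlt` excludes nonzero
multiples of `q`. -/
theorem sum_eq_zero_of_Mp_eq (hg : 0 < P.g) {al be : ℕ → ℕ} {j : ℕ} (h : P.Mp j = P.Tp al be)
    (hlt : ∑ e ∈ Finset.range (P.g * P.T), al e * be e < P.q) :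
    ∑ e ∈ Finset.range (P.g * P.T), al e * be e = 0 := by
  have h1 := coeff_Tp hg al be
  rw [← h, Mp, coeff_sum_C_mul_X_pow, if_pos (by omega), coef, if_pos rfl, Nat.cast_zero,
    eq_comm, ZMod.natCast_eq_zero_iff] at h1
  exact Nat.eq_zero_of_dvd_of_lt h1 hlt

-- The difference of two distinct polynomials of degree at most `2 g` has at most `2 g` roots, and
-- an accepting random string has all its `R` digits among these roots.
open Classical in
theorem card_accept_le (hq : P.q.Prime) {al be : ℕ → ℕ} {j : ℕ}
    (h : P.Mp j ≠ P.Tp al be) :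
    ((Finset.range (P.q ^ P.R)).filter fun l => P.Accept j al l (P.msg be l)).card ≤
      (2 * P.g) ^ P.R := by
  have : Fact P.q.Prime := ⟨hq⟩
  set G : Finset ℕ := (Finset.range P.q).filter fun t =>
    (P.Mp j).eval (t : ZMod P.q) = (P.Tp al be).eval (t : ZMod P.q) with hG
  have hGcard : G.card ≤ 2 * P.g := by
    have hne : P.Mp j - P.Tp al be ≠ 0 := sub_ne_zero.2 h
    have hdeg : (P.Mp j - P.Tp al be).natDegree ≤ 2 * P.g := by
      refine natDegree_le_iff_coeff_eq_zero.2 fun i hi => ?_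
      rw [coeff_sub, Mp, coeff_sum_C_mul_X_pow, if_neg (by omega), coeff_Tp_of_le al be hi.le,
        sub_zero]
    refine le_trans ?_ ((card_roots' (P.Mp j - P.Tp al be)).trans hdeg)
    refine le_trans ?_ (Multiset.toFinset_card_le _)
    refine Finset.card_le_card_of_injOn (fun t : ℕ => (t : ZMod P.q)) ?_ ?_
    · intro t ht
      simp only [hG, Finset.coe_filter, Finset.mem_range, Set.mem_ofPred_eq] at ht
      simp [hne, ht.2]
    · intro t ht t' ht' he
      simp only [hG, Finset.coe_filter, Finset.mem_range, Set.mem_ofPred_eq] at ht ht'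
      have := (ZMod.natCast_eq_natCast_iff' t t' P.q).1 he
      rwa [Nat.mod_eq_of_lt ht.1, Nat.mod_eq_of_lt ht'.1] at this
  calc _ ≤ (Fintype.piFinset fun _ : Fin P.R => G).card := by
        refine Finset.card_le_card_of_injOn (fun l (r : Fin P.R) => dg P.q l r) ?_ ?_
        · intro l hl
          simp only [Finset.coe_filter, Finset.mem_range, Set.mem_ofPred_eq] at hl
          rw [accept_msg hq.pos] at hl
          simp only [Finset.mem_coe, Fintype.mem_piFinset, hG, Finset.mem_filter, Finset.mem_range]
          exact fun r => ⟨dg_lt hq.pos _ _, hl.2 r r.2⟩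
        · intro l hl l' hl' he
          simp only [Finset.coe_filter, Finset.mem_range, Set.mem_ofPred_eq] at hl hl'
          exact dg_ext hl.1 hl'.1 fun i hi => congrFun he ⟨i, hi⟩
    _ = G.card ^ P.R := by simp
    _ ≤ _ := Nat.pow_le_pow_left hGcard _

end Poly

/-! ### The instance -/

theorem dg_two_le (x i : ℕ) : dg 2 x i ≤ 1 := Nat.le_of_lt_succ (dg_lt (by omega) x i)

theorem aent_lt (j : ℕ) (al : ℕ → ℕ) (x l κ : ℕ) : P.aent j al x l κ < 2 * P.Q + 2 := by
  have := dg_two_le x (P.h - (P.h - (κ - 2 * P.Q)))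
  unfold aent
  split_ifs <;> omega

theorem bent_lt (hq : 0 < P.q) (be : ℕ → ℕ) (y l : ℕ) : P.bent be y l < 2 * P.Q := by
  have := msg_lt hq be l
  have := dg_two_le y (P.h - (P.h - l))
  unfold bent
  omega

noncomputable def avec (P : Par) (j : ℕ) (al : ℕ → ℕ → ℕ) (x : ℕ) :
    Fin (P.q ^ P.R) → Fin (2 * P.Q + P.h) → Fin (2 * P.Q + 2) :=
  fun l κ => ⟨P.aent j (al x) x l κ, aent_lt _ _ _ _ _⟩

def bvec (P : Par) (hq : 0 < P.q) (be : ℕ → ℕ → ℕ) (y : ℕ) :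
    Fin (P.q ^ P.R) → Fin (2 * P.Q + 2) :=
  fun l => ⟨P.bent (be y) y l, (bent_lt hq _ _ _).trans (by omega)⟩

theorem avec_injOn (hq : 0 < P.q) (j : ℕ) (al : ℕ → ℕ → ℕ) {x x' : ℕ} (hx : x < 2 ^ P.h)
    (hx' : x' < 2 ^ P.h) (he : P.avec j al x = P.avec j al x') : x = x' := by
  refine dg_ext hx hx' fun i hi => ?_
  have := congrArg Fin.val (congrFun (congrFun he ⟨0, Nat.pow_pos hq⟩) ⟨2 * P.Q + i, by omega⟩)
  simpa [avec, aent, Nat.sub_sub_self hi.le] using this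

theorem bvec_injOn (hq : 0 < P.q) (hh : P.h ≤ P.q ^ P.R) (be : ℕ → ℕ → ℕ) {y y' : ℕ}
    (hy : y < 2 ^ P.h) (hy' : y' < 2 ^ P.h) (he : P.bvec hq be y = P.bvec hq be y') : y = y' := by
  refine dg_ext hy hy' fun i hi => ?_
  have := congrArg Fin.val (congrFun he ⟨i, hi.trans_le hh⟩)
  simp only [bvec, bent, Nat.sub_sub_self hi.le] at this
  have h1 := dg_two_le y i
  have h2 := dg_two_le y' i
  omega

/-- The instance of PCP-Vectors. -/
noncomputable def inst (P : Par) (hq : 0 < P.q) (hh : P.h ≤ P.q ^ P.R) (j : ℕ)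
    (al be : ℕ → ℕ → ℕ) : PCPVectors where
  L := P.q ^ P.R
  K := 2 * P.Q + P.h
  S := 2 * P.Q + 2
  A := (List.range (2 ^ P.h)).map (P.avec j al)
  B := (List.range (2 ^ P.h)).map (P.bvec hq be)
  L_pos := Nat.pow_pos hq
  A_nodup := List.Nodup.map_on (fun x hx y hy h =>
    avec_injOn hq j al (List.mem_range.1 hx) (List.mem_range.1 hy) h) List.nodup_range
  B_nodup := List.Nodup.map_on (fun x hx y hy h =>
    bvec_injOn hq hh be (List.mem_range.1 hx) (List.mem_range.1 hy) h) List.nodup_range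
  A_ne_nil := by simp
  B_ne_nil := by simp

theorem N_inst (hq : 0 < P.q) (hh : P.h ≤ P.q ^ P.R) (j : ℕ) (al be : ℕ → ℕ → ℕ) :
    (P.inst hq hh j al be).N = 2 ^ (P.h + 1) := by
  simp [inst, PCPVectors.N, pow_succ]
  ring

/-- Blanks and identifying symbols of the first player are at least `2 * P.Q`, while the other side
stays below. A match can only occur at the position `κ` equal to the entry itself, which is kept
exactly if its message is accepted. -/
theorem exists_eq_iff (hq : 0 < P.q) (j : ℕ) (al be : ℕ → ℕ → ℕ) (x y : ℕ)
    (l : Fin (P.q ^ P.R)) : (∃ κ, P.avec j al x l κ = P.bvec hq be y l) ↔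
      P.Accept j (al x) l (P.msg (be y) l) := by
  have hb := bent_lt hq (be y) y l
  have hm : P.bent (be y) y l / 2 = P.msg (be y) l := by
    have := dg_two_le y (P.h - (P.h - l))
    unfold bent
    omega
  constructor
  · rintro ⟨κ, hκ⟩
    have h1 := congrArg Fin.val hκ
    simp only [avec, bvec, aent] at h1
    split_ifs at h1 with h2 h3
    · rwa [h1, hm] at h3
    · omega
    · omega
  · intro h
    refine ⟨⟨P.bent (be y) y l, by omega⟩, Fin.ext ?_⟩
    simp only [avec, bvec, aent]
    rw [if_pos hb, hm, if_pos h]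

open Classical in
theorem score_eq (hq : 0 < P.q) (j : ℕ) (al be : ℕ → ℕ → ℕ) (x y : ℕ) :
    PCPVectors.score (P.avec j al x) (P.bvec hq be y) =
      (((Finset.range (P.q ^ P.R)).filter fun l =>
        P.Accept j (al x) l (P.msg (be y) l)).card : ℝ) / (P.q : ℝ) ^ P.R := by
  rw [PCPVectors.score, Nat.cast_pow]
  congr 2
  refine Finset.card_bij (fun l _ => (l : ℕ)) ?_ (fun _ _ _ _ h => Fin.ext h) ?_
  · intro l hl
    simp only [Finset.mem_filter, Finset.mem_univ, true_and] at hl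
    simp only [Finset.mem_filter, Finset.mem_range, l.2, true_and]
    exact (exists_eq_iff hq j al be x y l).1 hl
  · intro l hl
    simp only [Finset.mem_filter, Finset.mem_range] at hl
    refine ⟨⟨l, hl.1⟩, ?_, rfl⟩
    simp only [Finset.mem_filter, Finset.mem_univ, true_and]
    exact (exists_eq_iff hq j al be x y ⟨l, hl.1⟩).2 hl.2

theorem score_eq_one (hq : 0 < P.q) {j : ℕ} {al be : ℕ → ℕ → ℕ} {x y : ℕ}
    (h : P.Mp j = P.Tp (al x) (be y)) :
    PCPVectors.score (P.avec j al x) (P.bvec hq be y) = 1 := by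
  classical
  rw [score_eq, Finset.filter_true_of_mem, Finset.card_range, Nat.cast_pow, div_self]
  · positivity
  · intro l _
    rw [accept_msg hq]
    exact fun r _ => by rw [h]

theorem score_le (hq : P.q.Prime) (hgq : 4 * P.g ≤ P.q) {j : ℕ}
    {al be : ℕ → ℕ → ℕ} {x y : ℕ} (h : P.Mp j ≠ P.Tp (al x) (be y)) :
    PCPVectors.score (P.avec j al x) (P.bvec hq.pos be y) ≤ 1 / 2 ^ P.R := by
  classical
  have hq0 : (0 : ℝ) < P.q := by exact_mod_cast hq.pos
  rw [score_eq, div_le_div_iff₀ (by positivity) (by positivity), one_mul, ← Nat.cast_pow]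
  have h1 := card_accept_le hq h
  calc _ ≤ (((2 * P.g) ^ P.R : ℕ) : ℝ) * 2 ^ P.R := by gcongr
    _ = ((4 * P.g : ℕ) : ℝ) ^ P.R := by push_cast; rw [← mul_pow]; ring
    _ ≤ _ := by
      rw [Nat.cast_pow]
      gcongr

theorem complete_of_sum_eq_zero (hg : 0 < P.g) (hq : 1 < P.q) (hh : P.h ≤ P.q ^ P.R)
    {al be : ℕ → ℕ → ℕ} {x y : ℕ} (hx : x < 2 ^ P.h) (hy : y < 2 ^ P.h)
    (h : ∑ e ∈ Finset.range (P.g * P.T), al x e * be y e = 0) :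
    ∃ j < P.q ^ (2 * P.g), (P.inst (by omega) hh j al be).Complete := by
  obtain ⟨j, hj, hM⟩ := exists_Mp_eq hg hq h
  exact ⟨j, hj, _, List.mem_map_of_mem (List.mem_range.2 hx), _,
    List.mem_map_of_mem (List.mem_range.2 hy), score_eq_one _ hM⟩

/-- Every instance is in one of the two cases, and in the first case there is an orthogonal pair. -/
theorem complete_or_sound (hg : 0 < P.g) (hq : P.q.Prime) (hgq : 4 * P.g ≤ P.q)
    (hh : P.h ≤ P.q ^ P.R) (j : ℕ) {al be : ℕ → ℕ → ℕ}
    (hlt : ∀ x y, ∑ e ∈ Finset.range (P.g * P.T), al x e * be y e < P.q) :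
    ((P.inst hq.pos hh j al be).Complete ∧ ∃ x < 2 ^ P.h, ∃ y < 2 ^ P.h,
      ∑ e ∈ Finset.range (P.g * P.T), al x e * be y e = 0) ∨
    (P.inst hq.pos hh j al be).Sound (1 / 2 ^ P.R) := by
  by_cases h : ∃ x < 2 ^ P.h, ∃ y < 2 ^ P.h, P.Mp j = P.Tp (al x) (be y)
  · obtain ⟨x, hx, y, hy, hM⟩ := h
    exact .inl ⟨⟨_, List.mem_map_of_mem (List.mem_range.2 hx), _,
      List.mem_map_of_mem (List.mem_range.2 hy), score_eq_one _ hM⟩, x, hx, y, hy,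
      sum_eq_zero_of_Mp_eq hg hM (hlt x y)⟩
  · refine .inr fun a ha b hb => ?_
    obtain ⟨x, hx, rfl⟩ := List.mem_map.1 ha
    obtain ⟨y, hy, rfl⟩ := List.mem_map.1 hb
    exact score_le hq hgq fun hM => h ⟨x, List.mem_range.1 hx, y, List.mem_range.1 hy, hM⟩

/-! ### The encoding -/

theorem ofFn_eq_map {A : Type} (n : ℕ) (f : ℕ → A) :
    (List.ofFn fun i : Fin n => f i) = (List.range n).map f :=
  List.ext_getElem (by simp) (by simp)

theorem getD_flatMap_range {m : ℕ} {f : ℕ → List ℕ} (hf : ∀ x, (f x).length = m) (n : ℕ) {i : ℕ}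
    (hi : i < n * m) : ((List.range n).flatMap f).getD i 0 = (f (i / m)).getD (i % m) 0 := by
  induction n with
  | zero => simp at hi
  | succ n ih =>
    have hlen : ((List.range n).flatMap f).length = n * m := by
      simp [List.length_flatMap, hf]
    rw [List.range_succ, List.flatMap_append]
    by_cases h : i < n * m
    · rw [List.getD_append _ _ _ _ (by rwa [hlen]), ih h]
    · rw [List.getD_append_right _ _ _ _ (by rw [hlen]; omega), hlen]
      rw [Nat.succ_mul] at hi
      obtain ⟨d, rfl⟩ := Nat.exists_eq_add_of_le (not_lt.1 h)
      have hd : d < m := by omega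
      rw [Nat.add_sub_cancel_left, mul_comm n m, Nat.mul_add_div (by omega), Nat.div_eq_of_lt hd,
        Nat.mul_add_mod, Nat.mod_eq_of_lt hd]
      simp

/-- The number of entries of the vectors of the first kind. -/
def asize (P : Par) : ℕ := 2 ^ P.h * (P.q ^ P.R * (2 * P.Q + P.h))

def size (P : Par) : ℕ := 5 + P.asize + 2 ^ P.h * P.q ^ P.R

/-- The entries of the encoded instance. -/
noncomputable def entry (P : Par) (j : ℕ) (al be : ℕ → ℕ → ℕ) (i : ℕ) : ℕ :=
  if i = 0 then P.q ^ P.R else if i = 1 then 2 * P.Q + P.h else if i = 2 then 2 * P.Q + 2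
  else if i < 5 then 2 ^ P.h
  else if i - 5 < P.asize then
    P.aent j (al ((i - 5) / (P.q ^ P.R * (2 * P.Q + P.h)))) ((i - 5) / (P.q ^ P.R * (2 * P.Q + P.h)))
      ((i - 5) % (P.q ^ P.R * (2 * P.Q + P.h)) / (2 * P.Q + P.h))
      ((i - 5) % (P.q ^ P.R * (2 * P.Q + P.h)) % (2 * P.Q + P.h))
  else P.bent (be ((i - 5 - P.asize) / P.q ^ P.R)) ((i - 5 - P.asize) / P.q ^ P.R)
    ((i - 5 - P.asize) % P.q ^ P.R)

theorem encode_inst (hq : 0 < P.q) (hh : P.h ≤ P.q ^ P.R) (j : ℕ) (al be : ℕ → ℕ → ℕ) :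
    (P.inst hq hh j al be).encode = P.q ^ P.R :: (2 * P.Q + P.h) :: (2 * P.Q + 2) :: 2 ^ P.h ::
      2 ^ P.h :: (((List.range (2 ^ P.h)).flatMap fun x => (List.range (P.q ^ P.R)).flatMap fun l =>
        (List.range (2 * P.Q + P.h)).map fun κ => P.aent j (al x) x l κ) ++
      (List.range (2 ^ P.h)).flatMap fun y => (List.range (P.q ^ P.R)).map fun l =>
        P.bent (be y) y l) := by
  simp only [PCPVectors.encode, inst, List.length_map, List.length_range, List.flatMap_map, avec,
    bvec]
  congr 7
  · funext x
    rw [List.flatMap_def, ← ofFn_eq_map]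
    congr 2
    funext l
    exact ofFn_eq_map _ fun κ => P.aent j (al x) x l κ
  · funext y
    exact ofFn_eq_map _ fun l => P.bent (be y) y l

theorem length_encode_inst (hq : 0 < P.q) (hh : P.h ≤ P.q ^ P.R) (j : ℕ) (al be : ℕ → ℕ → ℕ) :
    (P.inst hq hh j al be).encode.length = P.size := by
  rw [encode_inst]
  simp [List.length_flatMap, size, asize]
  ring

theorem getD_encode_inst (hq : 0 < P.q) (hh : P.h ≤ P.q ^ P.R) (j : ℕ) (al be : ℕ → ℕ → ℕ) {i : ℕ}
    (hi : i < P.size) : (P.inst hq hh j al be).encode.getD i 0 = P.entry j al be i := by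
  rw [encode_inst, entry]
  match i with
  | 0 => rfl
  | 1 => rfl
  | 2 => rfl
  | 3 => rfl
  | 4 => rfl
  | i + 5 =>
    have hL : 0 < P.q ^ P.R := Nat.pow_pos hq
    have hQ : 0 < P.Q := Nat.pow_pos hq
    rw [if_neg (by omega), if_neg (by omega), if_neg (by omega), if_neg (by omega)]
    simp only [List.getD_cons_succ, Nat.add_sub_cancel]
    have hlen : ((List.range (2 ^ P.h)).flatMap fun x => (List.range (P.q ^ P.R)).flatMap fun l =>
        (List.range (2 * P.Q + P.h)).map fun κ => P.aent j (al x) x l κ).length = P.asize := by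
      simp [List.length_flatMap, asize]
    split_ifs with h
    · rw [List.getD_append _ _ _ _ (by rwa [hlen]),
        getD_flatMap_range (m := P.q ^ P.R * (2 * P.Q + P.h)) (by simp [List.length_flatMap]) _ h]
      have hlt : i % (P.q ^ P.R * (2 * P.Q + P.h)) < P.q ^ P.R * (2 * P.Q + P.h) :=
        Nat.mod_lt _ (by positivity)
      rw [getD_flatMap_range (m := 2 * P.Q + P.h) (by simp) _ hlt, List.getD_eq_getElem _ _ (by
        simpa using Nat.mod_lt _ (by omega))]
      simp
    · rw [List.getD_append_right _ _ _ _ (by rw [hlen]; omega), hlen]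
      have hi' : i - P.asize < 2 ^ P.h * P.q ^ P.R := by rw [size] at hi; omega
      rw [getD_flatMap_range (m := P.q ^ P.R) (by simp) _ hi', List.getD_eq_getElem _ _ (by
        simpa using Nat.mod_lt _ hL)]
      simp

end Par
end RAM

namespace RAM

/-! ### Feasibility of the reduction -/

/-- Instances with context `Γ'` carry the data of instances with context `Γ`. -/
structure Ext {α β : Type} (Γ : Ctx α) (Γ' : Ctx β) (π : β → α) : Prop where
  size : ∀ x, Γ'.size x = Γ.size (π x)
  inp : ∀ x, Γ'.inp x = Γ.inp (π x)
  vars : ∀ v ∈ Γ.vars, (fun x => v (π x)) ∈ Γ'.vars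

namespace Ext
variable {α β γ : Type} {Γ : Ctx α} {Γ' : Ctx β} {Γ'' : Ctx γ} {π : β → α} {ψ : γ → β}

theorem refl (Γ : Ctx α) : Ext Γ Γ id := ⟨fun _ => rfl, fun _ => rfl, fun _ h => h⟩

theorem trans (h : Ext Γ Γ' π) (h' : Ext Γ' Γ'' ψ) : Ext Γ Γ'' fun x => π (ψ x) :=
  ⟨fun x => (h'.size x).trans (h.size _), fun x => (h'.inp x).trans (h.inp _),
    fun v hv => h'.vars _ (h.vars v hv)⟩

theorem ext {n : α → ℕ} {w : Set (Ctx.Ix n → ℕ)}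
    {hw : ∀ v ∈ w, PolyBd (fun x : Ctx.Ix n => Γ.size x.1) fun x => (v x).size} :
    Ext Γ (Γ.ext n w hw) fun x => x.1 :=
  ⟨fun _ => rfl, fun _ => rfl, fun v hv => Or.inr ⟨v, hv, rfl⟩⟩

theorem idx {n : α → ℕ} {hn : PolyBd Γ.size n} : Ext Γ (Γ.idx n hn) fun x => x.1 := ext

theorem feas {f : α → ℕ} (h : Ext Γ Γ' π) (hf : Feas Γ f) : Feas Γ' fun x => f (π x) :=
  hf.pull π h.size h.inp h.vars

theorem feasU {f : α → ℕ} (h : Ext Γ Γ' π) (hf : FeasU Γ f) : FeasU Γ' fun x => f (π x) := by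
  refine ⟨h.feas hf.1, ?_⟩
  rw [show Γ'.size = fun x => Γ.size (π x) from funext h.size]
  exact hf.2.comp π

end Ext

/-- Feasible sequences of numbers. -/
def FeasS {α : Type} (Γ : Ctx α) (f : α → ℕ → ℕ) : Prop :=
  ∀ (β : Type) (Γ' : Ctx β) (π : β → α) (e : β → ℕ), Ext Γ Γ' π → FeasU Γ' e →
    Feas Γ' fun x => f (π x) (e x)

variable {α : Type} {Γ : Ctx α}

theorem FeasS.ext {β : Type} {Γ' : Ctx β} {π : β → α} {f : α → ℕ → ℕ} (hf : FeasS Γ f)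
    (h : Ext Γ Γ' π) : FeasS Γ' fun x => f (π x) :=
  fun γ Γ'' ψ e h' he => hf γ Γ'' (fun x => π (ψ x)) e (h.trans h') he

theorem FeasS.idx {n : α → ℕ} {hn : PolyBd Γ.size n} {f : α → ℕ → ℕ} (hf : FeasS Γ f) :
    FeasS (Γ.idx n hn) fun x => f x.1 := hf.ext Ext.idx

theorem FeasS.feas {f : α → ℕ → ℕ} (hf : FeasS Γ f) {e : α → ℕ} (he : FeasU Γ e) :
    Feas Γ fun a => f a (e a) := hf α Γ id e (.refl Γ) he

section Codes
variable {k : ℕ} {B D m m₀ c c' C H t h x y j r St n e : α → ℕ} {P : α → Prop}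

theorem FeasP.bt (hm : Feas Γ m) (hc : FeasU Γ c) : FeasP Γ fun a => RAM.bt (m a) (c a) :=
  .eq (.dg (.const 2) hm hc) (.const 1)

theorem FeasP.subc (hB : FeasU Γ B) (hc' : Feas Γ c') (hc : Feas Γ c) :
    FeasP Γ fun a => RAM.subc (B a) k (c' a) (c a) :=
  .all (.const k) (P := fun a i => RAM.dg (B a) (c' a) i = 0 ∨
      RAM.dg (B a) (c' a) i = RAM.dg (B a) (c a) i)
    (.or (.eq (.dg hB.1.idx hc'.idx .var) (.const 0))
      (.eq (.dg hB.1.idx hc'.idx .var) (.dg hB.1.idx hc.idx .var)))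

theorem FeasU.csz (hB : FeasU Γ B) (hc : Feas Γ c) : FeasU Γ fun a => RAM.csz (B a) k (c a) :=
  .countP (.const k) (P := fun a i => RAM.dg (B a) (c a) i ≠ 0)
    (.not (.eq (.dg hB.1.idx hc.idx .var) (.const 0)))

theorem FeasU.cdeg (hB : FeasU Γ B) (hm : Feas Γ m) (hc : Feas Γ c) (hH : Feas Γ H) :
    FeasU Γ fun a => RAM.cdeg (B a) k (m a) (c a) (H a) :=
  .countP (hB.pow k) (P := fun a C => RAM.bt (m a) C ∧ RAM.csz (B a) k C = c a ∧
      RAM.subc (B a) k (H a) C)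
    (.and (.bt hm.idx .var) (.and (.eq (FeasU.csz hB.idx FeasU.var.1).1 hc.idx)
      (.subc hB.idx hH.idx FeasU.var.1)))

theorem FeasP.flower (hB : FeasU Γ B) (hD : FeasU Γ D) (hm : Feas Γ m) (ht : FeasU Γ t) :
    FeasP Γ fun a => Flower (B a) k (D a) (m a) (t a) := by
  have hZ := hB.pow k
  have hH := ht.mod hZ.1
  have hs := (ht.div hZ.1).mod (Feas.const (k + 1))
  have hc := (ht.div hZ.1).div (Feas.const (k + 1))
  have hcs := FeasU.csz (k := k) hB hH.1
  exact .and (.eq (hcs.1.add hs.1) (.const k)) (.and (.le (.const 1) hcs.1) (.and (.lt hcs.1 hc.1)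
    (.le (hD.1.pow (hc.sub hcs.1)) (FeasU.cdeg hB hm hc.1 hH.1).1)))

theorem FeasU.flowers (hB : FeasU Γ B) : FeasU Γ fun a => RAM.flowers (B a) k :=
  .mul (.const _) (hB.pow k)

theorem FeasU.firstFlower (hB : FeasU Γ B) (hD : FeasU Γ D) (hm : Feas Γ m) :
    FeasU Γ fun a => RAM.firstFlower (B a) k (D a) (m a) :=
  .least (.flowers hB) (P := fun a => Flower (B a) k (D a) (m a))
    (.flower hB.idx hD.idx hm.idx .var)

theorem FeasP.cand (hB : FeasU Γ B) (hm : Feas Γ m) (ht : FeasU Γ t) (hP : FeasP Γ P)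
    (hC : FeasU Γ C) : FeasP Γ fun a => Cand (B a) k (m a) (t a) (P a) (C a) := by
  have hZ := hB.pow k
  have hH := ht.mod hZ.1
  have hc := (ht.div hZ.1).div (Feas.const (k + 1))
  refine .or (.bt hm hC) (.or (.and hP.not (.eq hC.1 hH.1)) (.and hP (.ex hZ (P := fun a C₀ =>
    RAM.bt (m a) C₀ ∧ RAM.csz (B a) k C₀ = t a / B a ^ k / (k + 1) ∧
    RAM.subc (B a) k (t a % B a ^ k) C₀ ∧
    ∀ i < k, (RAM.dg (B a) (t a % B a ^ k) i = 0 ∧ RAM.dg (B a) (C a) i = RAM.dg (B a) C₀ i) ∨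
      (RAM.dg (B a) (t a % B a ^ k) i ≠ 0 ∧ RAM.dg (B a) (C a) i = 0)) ?_)))
  refine .and (.bt hm.idx .var) (.and (.eq (FeasU.csz hB.idx FeasU.var.1).1 hc.idx.1)
    (.and (.subc hB.idx hH.idx.1 FeasU.var.1) (.all (.const k) (P := fun (x : Ctx.Ix fun a => B a ^ k) i =>
      (RAM.dg (B x.1) (t x.1 % B x.1 ^ k) i = 0 ∧
        RAM.dg (B x.1) (C x.1) i = RAM.dg (B x.1) (x.2 : ℕ) i) ∨
      (RAM.dg (B x.1) (t x.1 % B x.1 ^ k) i ≠ 0 ∧ RAM.dg (B x.1) (C x.1) i = 0)) ?_)))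
  have h1 := Feas.dg hB.idx.idx.1 hH.idx.idx.1
    (FeasU.var (Γ := Γ.idx _ hZ.2) (n := fun _ => k) (hn := (FeasU.const k).2))
  have h2 := Feas.dg hB.idx.idx.1 hC.idx.idx.1
    (FeasU.var (Γ := Γ.idx _ hZ.2) (n := fun _ => k) (hn := (FeasU.const k).2))
  exact .or (.and (.eq h1 (.const 0)) (.eq h2 (.dg hB.idx.idx.1 (FeasU.var (Γ := Γ)).1.idx .var)))
    (.and (.not (.eq h1 (.const 0))) (.eq h2 (.const 0)))

theorem Feas.stepc (hB : FeasU Γ B) (hD : FeasU Γ D) (hm : Feas Γ m) (hP : FeasP Γ P) :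
    Feas Γ fun a => RAM.stepc (B a) k (D a) (m a) (P a) := by
  have hZ := hB.pow k
  have ht := FeasU.firstFlower (k := k) hB hD hm
  refine .ite (.lt ht.1 (FeasU.flowers hB).1) (.mask hZ (P := fun a C =>
    Cand (B a) k (m a) (RAM.firstFlower (B a) k (D a) (m a)) (P a) C ∧
    ∀ C' < B a ^ k, Cand (B a) k (m a) (RAM.firstFlower (B a) k (D a) (m a)) (P a) C' →
      RAM.subc (B a) k C' C → C' = C) ?_) hm
  refine .and (.cand hB.idx hm.idx ht.idx hP.idx .var) (.all hZ.idx (P := fun x C' =>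
    Cand (B x.1) k (m x.1) (RAM.firstFlower (B x.1) k (D x.1) (m x.1)) (P x.1) C' →
      RAM.subc (B x.1) k C' x.2 → C' = x.2) ?_)
  exact .imp (.cand hB.idx.idx hm.idx.idx ht.idx.idx hP.idx.idx .var)
    (.imp (.subc hB.idx.idx FeasU.var.1 (FeasU.var (Γ := Γ)).1.idx)
      (.eq FeasU.var.1 (FeasU.var (Γ := Γ)).1.idx))

theorem stepc_lt {B k D m : ℕ} {P : Prop} (hm : m < 2 ^ B ^ k) : RAM.stepc B k D m P < 2 ^ B ^ k := by
  unfold RAM.stepc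
  split_ifs
  · exact mask_lt _ _
  · exact hm

theorem runc_lt {B k D m₀ : ℕ} {P : ℕ → Prop} (hm : m₀ < 2 ^ B ^ k) (i : ℕ) :
    runc B k D m₀ P i < 2 ^ B ^ k := by
  induction i with
  | zero => exact hm
  | succ i ih => exact stepc_lt ih

/-- Families are masks with `B ^ k` bits at every round, so `Feas.fold` applies to the whole
process. -/
theorem Feas.runc (hB : FeasU Γ B) (hD : FeasU Γ D) (hm : Feas Γ m₀)
    (hlt : ∀ a, m₀ a < 2 ^ B a ^ k) (hn : FeasU Γ n) {P : α → ℕ → Prop}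
    (hP : FeasP (Γ.idx n hn.2) fun x => P x.1 x.2) :
    Feas Γ fun a => RAM.runc (B a) k (D a) (m₀ a) (P a) (n a) := by
  have hZ := hB.pow k
  have hsz : ∀ a i, (RAM.runc (B a) k (D a) (m₀ a) (P a) i).size ≤ B a ^ k := fun a i =>
    Nat.size_le.2 (runc_lt (hlt a) i)
  have hw : ∀ v ∈ ({fun x => RAM.runc (B x.1) k (D x.1) (m₀ x.1) (P x.1) x.2, fun x => (x.2 : ℕ)} :
      Set (Ctx.Ix n → ℕ)), PolyBd (fun x : Ctx.Ix n => Γ.size x.1) fun x => (v x).size := by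
    rintro v (rfl | rfl)
    · exact (hZ.2.comp fun x : Ctx.Ix n => x.1).mono fun x => hsz _ _
    · exact hn.2.fin
  refine Feas.fold hn.1 hn.2 (fun a i => RAM.runc (B a) k (D a) (m₀ a) (P a) i) hZ.2
    (fun a i _ => hsz a i) hm _ hw (fun _ h => h) ?_
  have h1 : Feas (Γ.ext n _ hw) fun x => RAM.runc (B x.1) k (D x.1) (m₀ x.1) (P x.1) x.2 :=
    .var (Or.inl (Or.inl rfl))
  have h2 : FeasP (Γ.ext n _ hw) fun x => P x.1 x.2 := Feas.mono hP rfl rfl (by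
    rintro v (rfl | hv)
    · exact Or.inl (Or.inr rfl)
    · exact Or.inr hv)
  exact Feas.stepc (Ext.ext.feasU hB) (Ext.ext.feasU hD) h1 h2

theorem FeasP.petalStep (hSt : FeasU Γ St) (hr : FeasU Γ r) (hj : Feas Γ j) (hn : Feas Γ n) :
    FeasP Γ fun a => RAM.petalStep (St a) (r a) (j a) (n a) :=
  .ex hr (P := fun a u => RAM.dg (St a + 1) (j a) u = n a)
    (.eq (.dg (hSt.1.add (.const 1)).idx hj.idx .var) hn.idx)

theorem FeasP.afal (hB : FeasU Γ B) (hh : FeasU Γ h) (hx : Feas Γ x) (hC : Feas Γ C)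
    (hpos : ∀ a, 0 < B a) : FeasP Γ fun a => RAM.afal (B a) k (h a) (x a) (C a) := by
  refine .all (.const k) (P := fun a i => RAM.dg (B a) (C a) i = 0 ∨
    h a ≤ (RAM.dg (B a) (C a) i - 1) / 2 ∨
    RAM.dg 2 (x a) ((RAM.dg (B a) (C a) i - 1) / 2) ≠ (RAM.dg (B a) (C a) i - 1) % 2) ?_
  have hd := FeasU.dg hB.idx hC.idx (FeasU.var (n := fun _ => k) (hn := (FeasU.const k).2))
    fun x => hpos x.1
  have hd' := hd.sub (.const 1)
  exact .or (.eq hd.1 (.const 0)) (.or (.le hh.1.idx (hd'.div (.const 2)).1)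
    (.not (.eq (.dg (.const 2) hx.idx (hd'.div (.const 2))) (hd'.mod (.const 2)).1)))

theorem FeasP.bfal (hB : FeasU Γ B) (hh : FeasU Γ h) (hy : Feas Γ y) (hC : Feas Γ C)
    (hpos : ∀ a, 0 < B a) : FeasP Γ fun a => RAM.bfal (B a) k (h a) (y a) (C a) := by
  refine .all (.const k) (P := fun a i => RAM.dg (B a) (C a) i = 0 ∨
    (RAM.dg (B a) (C a) i - 1) / 2 < h a ∨
    RAM.dg 2 (y a) ((RAM.dg (B a) (C a) i - 1) / 2 - h a) ≠ (RAM.dg (B a) (C a) i - 1) % 2) ?_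
  have hd := FeasU.dg hB.idx hC.idx (FeasU.var (n := fun _ => k) (hn := (FeasU.const k).2))
    fun x => hpos x.1
  have hd' := hd.sub (.const 1)
  exact .or (.eq hd.1 (.const 0)) (.or (.lt (hd'.div (.const 2)).1 hh.1.idx)
    (.not (.eq (.dg (.const 2) hy.idx ((hd'.div (.const 2)).sub hh.1.idx))
      (hd'.mod (.const 2)).1)))

theorem Feas.flag (hB : FeasU Γ B) (hD : FeasU Γ D) (hm : Feas Γ m) (he : Feas Γ e)
    {Q : α → ℕ → Prop} (hQ : FeasP (Γ.idx (fun a => B a ^ k) (hB.pow k).2) fun x => Q x.1 x.2) :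
    Feas Γ fun a => RAM.flag (B a) k (D a) (m a) (e a) (Q a) :=
  FeasP.or (.lt (FeasU.firstFlower hB hD hm).1 (FeasU.flowers hB).1)
    (.ex (hB.pow k) (P := fun a C => RAM.bt (m a) C ∧ RAM.countP C (RAM.bt (m a)) = e a ∧ Q a C)
      (.and (.bt hm.idx .var) (.and (.eq (FeasU.countP .var (P := fun x => RAM.bt (m x.1))
        (.bt hm.idx.idx .var)).1 he.idx) hQ)))

end Codes

/-- Families of parameters that can be computed. -/
structure FeasPar (Γ : Ctx α) (P : α → Par) : Prop where
  h : FeasU Γ fun a => (P a).h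
  g : FeasU Γ fun a => (P a).g
  T : FeasU Γ fun a => (P a).T
  R : FeasU Γ fun a => (P a).R
  q : FeasU Γ fun a => (P a).q

namespace FeasPar
variable {P : α → Par} {al be : α → ℕ → ℕ} {w t j l m x y i κ : α → ℕ}

theorem ext {β : Type} {Γ' : Ctx β} {π : β → α} (hP : FeasPar Γ P) (h : Ext Γ Γ' π) :
    FeasPar Γ' fun x => P (π x) :=
  ⟨h.feasU hP.h, h.feasU hP.g, h.feasU hP.T, h.feasU hP.R, h.feasU hP.q⟩

theorem idx {n : α → ℕ} {hn : PolyBd Γ.size n} (hP : FeasPar Γ P) :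
    FeasPar (Γ.idx n hn) fun x => P x.1 := hP.ext Ext.idx

theorem Q (hP : FeasPar Γ P) : Feas Γ fun a => (P a).Q := hP.q.1.pow (hP.R.mul hP.T)

theorem apoly (hP : FeasPar Γ P) (hal : FeasS Γ al) (hw : FeasU Γ w) (ht : Feas Γ t) :
    Feas Γ fun a => (P a).apoly (al a) (w a) (t a) :=
  .sum hP.g (f := fun a i => al a (i * (P a).T + w a) * t a ^ i)
    (.mul (hal.idx.feas (.add (.mul .var hP.T.idx) hw.idx)) (ht.idx.pow .var))

theorem bpoly (hP : FeasPar Γ P) (hbe : FeasS Γ be) (hw : FeasU Γ w) (ht : Feas Γ t) :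
    Feas Γ fun a => (P a).bpoly (be a) (w a) (t a) :=
  .mod (.sum hP.g (f := fun a i => be a (i * (P a).T + w a) * t a ^ ((P a).g - 1 - i))
    (.mul (hbe.idx.feas (.add (.mul .var hP.T.idx) hw.idx))
      (ht.idx.pow (.sub (hP.g.sub (.const 1)).idx FeasU.var.1)))) hP.q.1

theorem mpoly (hP : FeasPar Γ P) (hj : Feas Γ j) (ht : Feas Γ t) :
    Feas Γ fun a => (P a).mpoly (j a) (t a) :=
  .sum ((FeasU.const 2).mul hP.g) (f := fun a i => (P a).coef (j a) i * t a ^ i)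
    (.mul (.ite (.eq FeasU.var.1 (hP.g.sub (.const 1)).idx.1) (.const 0)
      (.dg hP.q.idx.1 hj.idx .var)) (ht.idx.pow .var))

theorem msg (hP : FeasPar Γ P) (hbe : FeasS Γ be) (hl : Feas Γ l) :
    Feas Γ fun a => (P a).msg (be a) (l a) :=
  .sum (hP.R.mul hP.T) (f := fun a u => (P a).bpoly (be a) (u % (P a).T)
      (RAM.dg (P a).q (l a) (u / (P a).T)) * (P a).q ^ u)
    (.mul (hP.idx.bpoly hbe.idx (.mod .var hP.T.idx.1)
      (.dg hP.q.idx.1 hl.idx (.div .var hP.T.idx.1))) (hP.q.idx.1.pow .var))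

theorem accept (hP : FeasPar Γ P) (hj : Feas Γ j) (hal : FeasS Γ al) (hl : Feas Γ l)
    (hm : Feas Γ m) : FeasP Γ fun a => (P a).Accept (j a) (al a) (l a) (m a) := by
  refine .all hP.R (P := fun a r => (P a).mpoly (j a) (RAM.dg (P a).q (l a) r) % (P a).q =
    (∑ w ∈ Finset.range (P a).T, (P a).apoly (al a) w (RAM.dg (P a).q (l a) r) *
      RAM.dg (P a).q (m a) (r * (P a).T + w)) % (P a).q) ?_
  have ht := Feas.dg hP.q.idx.1 hl.idx (FeasU.var (hn := hP.R.2))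
  refine .eq (.mod (hP.idx.mpoly hj.idx ht) hP.q.idx.1) (.mod (.sum hP.T.idx (f := fun x w =>
    (P x.1).apoly (al x.1) w (RAM.dg (P x.1).q (l x.1) x.2) *
      RAM.dg (P x.1).q (m x.1) (x.2 * (P x.1).T + w)) ?_) hP.q.idx.1)
  exact .mul (hP.idx.idx.apoly hal.idx.idx .var ht.idx) (.dg hP.q.idx.idx.1 hm.idx.idx
    (.add (.mul (FeasU.var (Γ := Γ)).idx hP.T.idx.idx) .var))

theorem aent (hP : FeasPar Γ P) (hj : Feas Γ j) (hal : FeasS Γ al) (hx : Feas Γ x) (hl : Feas Γ l)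
    (hκ : Feas Γ κ) : Feas Γ fun a => (P a).aent (j a) (al a) (x a) (l a) (κ a) := by
  classical
  have h2Q := (Feas.const 2).mul hP.Q
  exact .ite (.lt hκ h2Q) (.ite (hP.accept hj hal hl (hκ.div (.const 2))) hκ h2Q)
    (h2Q.add (.dg (.const 2) hx (hP.h.sub (hP.h.1.sub (hκ.sub h2Q)))))

theorem bent (hP : FeasPar Γ P) (hbe : FeasS Γ be) (hy : Feas Γ y) (hl : Feas Γ l) :
    Feas Γ fun a => (P a).bent (be a) (y a) (l a) :=
  ((Feas.const 2).mul (hP.msg hbe hl)).add (.dg (.const 2) hy (hP.h.sub (hP.h.1.sub hl)))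

theorem asize (hP : FeasPar Γ P) : Feas Γ fun a => (P a).asize :=
  ((Feas.const 2).pow hP.h).mul ((hP.q.1.pow hP.R).mul (((Feas.const 2).mul hP.Q).add hP.h.1))

theorem size (hP : FeasPar Γ P) : Feas Γ fun a => (P a).size :=
  ((Feas.const 5).add hP.asize).add (((Feas.const 2).pow hP.h).mul (hP.q.1.pow hP.R))

theorem entry {al be : α → ℕ → ℕ → ℕ} (hP : FeasPar Γ P) (hj : Feas Γ j) (hi : Feas Γ i)
    (hal : ∀ x, Feas Γ x → FeasS Γ fun a => al a (x a))
    (hbe : ∀ y, Feas Γ y → FeasS Γ fun a => be a (y a)) :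
    Feas Γ fun a => (P a).entry (j a) (al a) (be a) (i a) := by
  have hL := hP.q.1.pow hP.R
  have hK := ((Feas.const 2).mul hP.Q).add hP.h.1
  have hLK := hL.mul hK
  have hi' := hi.sub (.const 5)
  have hi'' := hi'.sub hP.asize
  have hx := hi'.div hLK
  have hy := hi''.div hL
  exact .ite (.eq hi (.const 0)) hL (.ite (.eq hi (.const 1)) hK (.ite (.eq hi (.const 2))
    (((Feas.const 2).mul hP.Q).add (.const 2)) (.ite (.lt hi (.const 5)) ((Feas.const 2).pow hP.h)
    (.ite (.lt hi' hP.asize) (hP.aent hj (hal _ hx) hx ((hi'.mod hLK).div hK) ((hi'.mod hLK).mod hK))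
      (hP.bent (hbe _ hy) hy (hi''.mod hL))))))

end FeasPar
end RAM

namespace RAM

/-! ### The reduction -/

section Params
variable (k h : ℕ)

/-- The threshold for flowers. -/
def dens : ℕ := h.size ^ 3

/-- The base for literals: there are `2 h` variables. -/
def base : ℕ := 4 * h + 1

def steps : ℕ := k * (4 * h) * (5 * dens h) ^ k

/-- The number of blocks, which is also the bound for petal steps. -/
def blocks : ℕ := h / h.size ^ 2 + 1

/-- It is polylogarithmic, which keeps messages short, yet large enough that `blocks * width`
exceeds the number of clauses of a sparse family. -/
def width : ℕ := h.size ^ (3 * k + 2)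

/-- A prime number above the number of coordinates. -/
noncomputable def field : ℕ := least (2 * (blocks h * width k h) + 1) fun t =>
  blocks h * width k h < t ∧ ∀ d < t, d < 2 ∨ t % d ≠ 0

/-- The number of repetitions is chosen such that `R * T * h.size ^ 3 ≤ h`: messages then have `O(h
/ h.size ^ 2)` bits, while `R` is still `h` divided by a polylogarithm. -/
noncomputable def par : Par where
  h := h
  g := blocks h
  T := width k h
  R := h / h.size ^ (3 * k + 5)
  q := field k h

/-- The number of claimed polynomials. -/
noncomputable def polys : ℕ := field k h ^ (2 * blocks h)

/-- The number of pieces of advice. -/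
noncomputable def advices : ℕ := (steps k h + 1) ^ blocks h * polys k h

/-- The bit mask of the clauses of the input. -/
noncomputable def start (inp : ℕ → ℕ) : ℕ := mask (base h ^ k) fun C =>
  ∃ c < inp 1, ∀ i < k, dg (base h) C i = inp (2 + c * k + i) + 1

/-- The sparsified formula for the advice `j`. -/
noncomputable def sparse (inp : ℕ → ℕ) (j : ℕ) : ℕ :=
  runc (base h) k (dens h) (start k h inp)
    (petalStep (steps k h) (blocks h) (j / polys k h)) (steps k h)

noncomputable def avals (inp : ℕ → ℕ) (j x e : ℕ) : ℕ :=
  flag (base h) k (dens h) (sparse k h inp j) e (afal (base h) k h x)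

noncomputable def bvals (inp : ℕ → ℕ) (j y e : ℕ) : ℕ :=
  flag (base h) k (dens h) (sparse k h inp j) e (bfal (base h) k h y)

/-- The entries of the instance for the advice `j`. -/
noncomputable def outp (inp : ℕ → ℕ) (j i : ℕ) : ℕ :=
  (par k h).entry (j % polys k h) (avals k h inp j) (bvals k h inp j) i

variable {k h}

theorem size_pos (hh : 0 < h) : 0 < h.size := Nat.size_pos.2 hh

theorem coords_pos (hh : 0 < h) : 0 < blocks h * width k h :=
  Nat.mul_pos (Nat.succ_pos _) (Nat.pow_pos (size_pos hh))

/-- By Bertrand's postulate the search range contains a prime. The condition that is searched for is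
trial division. -/
theorem field_spec (hh : 0 < h) : (field k h).Prime ∧ blocks h * width k h < field k h ∧
    field k h ≤ 2 * (blocks h * width k h) := by
  have hpos := coords_pos (k := k) hh
  obtain ⟨p, hp, h1, h2⟩ := Nat.exists_prime_lt_and_le_two_mul _ hpos.ne'
  obtain ⟨h3, ⟨h4, h5⟩, -⟩ := least_spec (n := 2 * (blocks h * width k h) + 1)
    (P := fun t => blocks h * width k h < t ∧ ∀ d < t, d < 2 ∨ t % d ≠ 0)
    ⟨p, by omega, h1, fun d hd => by
      by_contra! hno
      rcases (Nat.dvd_prime hp).1 (Nat.dvd_of_mod_eq_zero hno.2) with h | h <;> omega⟩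
  rw [← field] at h3 h4 h5
  refine ⟨Nat.prime_def_lt'.2 ⟨by omega, fun m hm hlt hdvd => ?_⟩, h4, by omega⟩
  rcases h5 m hlt with h | h
  · omega
  · exact h (Nat.mod_eq_zero_of_dvd hdvd)

end Params

/-! ### Feasibility of the parameters and of the entries -/

section Feasibility
variable {α : Type} {Γ : Ctx α} {h : α → ℕ} {k : ℕ}

theorem FeasU.dens (hh : FeasU Γ h) : FeasU Γ fun a => RAM.dens (h a) := hh.size.pow 3

theorem FeasU.base (hh : FeasU Γ h) : FeasU Γ fun a => RAM.base (h a) :=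
  ((FeasU.const 4).mul hh).add (.const 1)

theorem FeasU.steps (hh : FeasU Γ h) : FeasU Γ fun a => RAM.steps k (h a) :=
  ((FeasU.const k).mul ((FeasU.const 4).mul hh)).mul (((FeasU.const 5).mul hh.dens).pow k)

theorem FeasU.blocks (hh : FeasU Γ h) : FeasU Γ fun a => RAM.blocks (h a) :=
  (hh.div (hh.size.pow 2).1).add (.const 1)

theorem FeasU.width (hh : FeasU Γ h) : FeasU Γ fun a => RAM.width k (h a) := hh.size.pow _

theorem FeasU.field (hh : FeasU Γ h) : FeasU Γ fun a => RAM.field k (h a) := by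
  have hM := hh.blocks.mul (FeasU.width (k := k) hh)
  refine .least (((FeasU.const 2).mul hM).add (.const 1)) (P := fun a t =>
    RAM.blocks (h a) * RAM.width k (h a) < t ∧ ∀ d < t, d < 2 ∨ t % d ≠ 0) ?_
  exact .and (.lt hM.idx.1 FeasU.var.1) (.all .var (P := fun x d => d < 2 ∨ (x.2 : ℕ) % d ≠ 0)
    (.or (.lt FeasU.var.1 (.const 2))
      (.not (.eq ((FeasU.var (Γ := Γ)).idx.mod FeasU.var.1).1 (.const 0)))))

theorem FeasU.feasPar (hh : FeasU Γ h) : FeasPar Γ fun a => par k (h a) :=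
  ⟨hh, hh.blocks, hh.width, hh.div (hh.size.pow _).1, hh.field⟩

theorem FeasU.polys (hh : FeasU Γ h) : Feas Γ fun a => RAM.polys k (h a) :=
  hh.field.1.pow ((FeasU.const 2).mul hh.blocks)

theorem FeasU.advices (hh : FeasU Γ h) : Feas Γ fun a => RAM.advices k (h a) :=
  ((hh.steps.1.add (.const 1)).pow hh.blocks).mul hh.polys

theorem feasS_inp {c : ℕ} (hc : ∀ a i, Γ.inp a i ≤ (Γ.size a + 2) ^ c) : FeasS Γ Γ.inp := by
  intro β Γ' π e hE he
  refine (Feas.input he.1 ⟨c, fun x => ?_⟩).congr fun x => by rw [hE.inp]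
  dsimp only
  rw [hE.inp, hE.size]
  exact (size_le_self _).trans (hc _ _)

theorem FeasU.start (hin : FeasS Γ Γ.inp) (hin1 : PolyBd Γ.size fun a => Γ.inp a 1)
    (hh : FeasU Γ h) : Feas Γ fun a => RAM.start k (h a) (Γ.inp a) := by
  have h1 : FeasU Γ fun a => Γ.inp a 1 := ⟨hin.feas (.const 1), hin1⟩
  have hZ := hh.base.pow k
  refine .mask hZ (P := fun a C => ∃ c < Γ.inp a 1, ∀ i < k,
    RAM.dg (RAM.base (h a)) C i = Γ.inp a (2 + c * k + i) + 1) ?_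
  refine .ex h1.idx (P := fun x c => ∀ i < k,
    RAM.dg (RAM.base (h x.1)) x.2 i = Γ.inp x.1 (2 + c * k + i) + 1) ?_
  refine .all (.const k) (P := fun (x : Ctx.Ix fun y : Ctx.Ix fun a => RAM.base (h a) ^ k =>
    Γ.inp y.1 1) i =>
    RAM.dg (RAM.base (h x.1.1)) x.1.2 i = Γ.inp x.1.1 (2 + x.2 * k + i) + 1) ?_
  refine .eq (.dg hh.base.idx.idx.idx.1 (FeasU.var (Γ := Γ)).idx.idx.1 .var)
    (.add (hin.idx.idx.idx.feas ?_) (.const 1))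
  exact .add (.add (.const 2) (.mul (FeasU.var (Γ := Γ.idx _ _)).idx (.const k))) .var

theorem FeasU.sparse (hin : FeasS Γ Γ.inp) (hin1 : PolyBd Γ.size fun a => Γ.inp a 1)
    (hh : FeasU Γ h) {j : α → ℕ} (hj : Feas Γ j) :
    Feas Γ fun a => RAM.sparse k (h a) (Γ.inp a) (j a) :=
  .runc hh.base hh.dens (hh.start hin hin1) (fun _ => mask_lt _ _) hh.steps
    (P := fun a => RAM.petalStep (RAM.steps k (h a)) (RAM.blocks (h a)) (j a / RAM.polys k (h a)))
    (.petalStep hh.steps.idx hh.blocks.idx (hj.div hh.polys).idx FeasU.var.1)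

theorem FeasU.avals (hin : FeasS Γ Γ.inp) (hin1 : PolyBd Γ.size fun a => Γ.inp a 1)
    (hh : FeasU Γ h) {j x : α → ℕ} (hj : Feas Γ j) (hx : Feas Γ x) :
    FeasS Γ fun a => RAM.avals k (h a) (Γ.inp a) (j a) (x a) := fun _ _ π _ hE he =>
  .flag (hE.feasU hh.base) (hE.feasU hh.dens) (hE.feas (hh.sparse hin hin1 hj)) he.1
    (Q := fun a => RAM.afal (RAM.base (h (π a))) k (h (π a)) (x (π a)))
    (.afal (hE.feasU hh.base).idx (hE.feasU hh).idx (hE.feas hx).idx FeasU.var.1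
      fun _ => Nat.succ_pos _)

theorem FeasU.bvals (hin : FeasS Γ Γ.inp) (hin1 : PolyBd Γ.size fun a => Γ.inp a 1)
    (hh : FeasU Γ h) {j x : α → ℕ} (hj : Feas Γ j) (hx : Feas Γ x) :
    FeasS Γ fun a => RAM.bvals k (h a) (Γ.inp a) (j a) (x a) := fun _ _ π _ hE he =>
  .flag (hE.feasU hh.base) (hE.feasU hh.dens) (hE.feas (hh.sparse hin hin1 hj)) he.1
    (Q := fun a => RAM.bfal (RAM.base (h (π a))) k (h (π a)) (x (π a)))
    (.bfal (hE.feasU hh.base).idx (hE.feasU hh).idx (hE.feas hx).idx FeasU.var.1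
      fun _ => Nat.succ_pos _)

theorem FeasU.outp (hin : FeasS Γ Γ.inp) (hin1 : PolyBd Γ.size fun a => Γ.inp a 1)
    (hh : FeasU Γ h) {j i : α → ℕ} (hj : Feas Γ j) (hi : Feas Γ i) :
    Feas Γ fun a => RAM.outp k (h a) (Γ.inp a) (j a) (i a) :=
  hh.feasPar.entry (hj.mod hh.polys) hi (fun _ hx => hh.avals hin hin1 hj hx)
    fun _ hy => hh.bvals hin hin1 hj hy

end Feasibility
end RAM

namespace RAM

/-! ### Correctness of the reduction -/

theorem getD_flatMap {A : Type} {m : ℕ} {f : A → List ℕ} (hf : ∀ x, (f x).length = m) (l : List A)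
    {c i : ℕ} (hc : c < l.length) (hi : i < m) :
    (l.flatMap f).getD (c * m + i) 0 = (f l[c]).getD i 0 := by
  induction l generalizing c with
  | nil => simp at hc
  | cons a l ih =>
    rw [List.flatMap_cons]
    cases c with
    | zero =>
      rw [Nat.zero_mul, zero_add, List.getD_append _ _ _ _ (by rwa [hf])]
      rfl
    | succ c =>
      rw [List.getD_append_right _ _ _ _ (by rw [hf, Nat.succ_mul]; omega), hf,
        show (c + 1) * m + i - m = c * m + i by rw [Nat.succ_mul]; omega,
        ih (by simpa using hc)]
      rfl

section
variable {k n : ℕ} (φ : KCNF k n)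

/-- The input array. -/
def input : ℕ → ℕ := fun i => φ.encode.getD i 0

theorem input_lit {c i : ℕ} (hc : c < φ.clauses.length) (hi : i < k) :
    input φ (2 + c * k + i) =
      2 * ((φ.clauses[c] ⟨i, hi⟩).1 : ℕ) + (φ.clauses[c] ⟨i, hi⟩).2.toNat := by
  rw [input, KCNF.encode, show 2 + c * k + i = c * k + i + 1 + 1 by omega, List.getD_cons_succ,
    List.getD_cons_succ, getD_flatMap (m := k) (by simp) _ hc hi, List.getD_eq_getElem _ _
    (by simpa using hi)]
  simp

theorem length_clauses_le : φ.clauses.length ≤ (2 * n) ^ k := by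
  refine (φ.nodup.length_le_card).trans ?_
  simp [mul_comm]

theorem input_le (i : ℕ) : input φ i ≤ 2 * n + (2 * n) ^ k := by
  rw [input, KCNF.encode]
  match i with
  | 0 => simp; omega
  | 1 =>
    have := length_clauses_le φ
    simp
    omega
  | i + 2 =>
    rw [List.getD_cons_succ, List.getD_cons_succ]
    by_cases h : i < (φ.clauses.flatMap fun c =>
        List.ofFn fun i => 2 * ((c i).1 : ℕ) + (c i).2.toNat).length
    · rw [List.getD_eq_getElem _ _ h]
      have := List.getElem_mem h
      simp only [List.mem_flatMap, List.mem_ofFn] at this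
      obtain ⟨c, -, j, hj⟩ := this
      rw [← hj]
      have h1 := (c j).1.2
      have h2 := (c j).2.toNat_le
      omega
    · rw [List.getD_eq_default _ _ (by omega)]
      omega

variable {φ} {h : ℕ}

theorem lit_lt (hn : n ≤ 2 * h) {c i : ℕ} (hc : c < φ.clauses.length) (hi : i < k) :
    input φ (2 + c * k + i) + 1 < base h := by
  rw [input_lit φ hc hi, base]
  have h1 := (φ.clauses[c] ⟨i, hi⟩).1.2
  have h2 := (φ.clauses[c] ⟨i, hi⟩).2.toNat_le
  omega

theorem mem_fam_start {C : Finset (ℕ × ℕ)} : C ∈ fam (base h) k (start k h (input φ)) ↔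
    ∃ D < base h ^ k, (∃ c < φ.clauses.length, ∀ i < k,
      dg (base h) D i = input φ (2 + c * k + i) + 1) ∧ cl (base h) k D = C := mem_fam_mask

/-- The ground set of the clauses. -/
def ground (k h : ℕ) : Finset (ℕ × ℕ) := Finset.range k ×ˢ Finset.Ioo 0 (base h)

theorem card_ground : (ground k h).card = k * (4 * h) := by
  simp [ground, base]

/-- All input clauses occupy all `k` positions, and sets of equal size form an antichain. -/
theorem good_start (hk : 0 < k) :
    Sparsify.Good k (ground k h) (fam (base h) k (start k h (input φ))) := by
  have hcard : ∀ C ∈ fam (base h) k (start k h (input φ)), C.card = k := by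
    intro C hC
    obtain ⟨D, -, ⟨c, -, hcD⟩, rfl⟩ := mem_fam_start.1 hC
    rw [card_cl, csz, countP]
    rw [Finset.sum_congr rfl (g := fun _ => 1) fun i hi => ind_true (by
      rw [hcD i (Finset.mem_range.1 hi)]; omega)]
    simp
  refine ⟨fun C hC C' hC' hsub => ?_, fun C hC => by rw [hcard C hC]; exact hk,
    fun C hC => (hcard C hC).le, fun C hC => ?_⟩
  · exact Finset.eq_of_subset_of_card_le hsub (by rw [hcard C hC, hcard C' hC'])
  · obtain ⟨D, -, -, rfl⟩ := mem_fam_start.1 hC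
    intro u hu
    obtain ⟨h1, h2, h3⟩ := mem_cl.1 hu
    simp only [ground, Finset.mem_product, Finset.mem_range, Finset.mem_Ioo]
    exact ⟨h1, Nat.pos_of_ne_zero h2, h3 ▸ dg_lt (Nat.succ_pos _) _ _⟩

/-- The value of a variable. -/
def value (h x y v : ℕ) : ℕ := if v < h then dg 2 x v else dg 2 y (v - h)

theorem trueLit_iff {x y d : ℕ} : trueLit h x y d ↔ value h x y ((d - 1) / 2) = (d - 1) % 2 := by
  unfold trueLit value
  split_ifs <;> rfl

theorem value_le_one (x y v : ℕ) : value h x y v ≤ 1 := by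
  unfold value
  split_ifs <;> exact Par.dg_two_le _ _

theorem sat_start_iff (hn : n ≤ 2 * h) {x y : ℕ} :
    (∀ C ∈ fam (base h) k (start k h (input φ)), ∃ u ∈ C, trueLit h x y u.2) ↔
    ∀ c ∈ φ.clauses, ∃ i, decide (value h x y (c i).1 = 1) = (c i).2 := by
  have hlit : ∀ c (hc : c < φ.clauses.length) i (hi : i < k),
      trueLit h x y (input φ (2 + c * k + i) + 1) ↔
        decide (value h x y (φ.clauses[c] ⟨i, hi⟩).1 = 1) = (φ.clauses[c] ⟨i, hi⟩).2 := by
    intro c hc i hi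
    rw [trueLit_iff, input_lit φ hc hi]
    have h1 := value_le_one (h := h) x y (φ.clauses[c] ⟨i, hi⟩).1
    generalize (φ.clauses[c] ⟨i, hi⟩).2 = s
    generalize ((φ.clauses[c] ⟨i, hi⟩).1 : ℕ) = v at *
    have h2 := s.toNat_le
    rw [Nat.add_sub_cancel, show (2 * v + s.toNat) / 2 = v by omega,
      show (2 * v + s.toNat) % 2 = s.toNat by omega]
    cases s
    · simp
      omega
    · simp
  constructor
  · intro H c hc
    obtain ⟨m, hm, rfl⟩ := List.getElem_of_mem hc
    have hf : ∀ i < k, input φ (2 + m * k + i) + 1 < base h := fun i hi => lit_lt hn hm hi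
    obtain ⟨⟨i, d⟩, hu, ht⟩ := H _ (mem_fam_start.2 ⟨_, sum_digits_lt k hf,
      ⟨m, hm, fun i hi => dg_sum_digits hf hi⟩, rfl⟩)
    obtain ⟨hi, -, hd⟩ := mem_cl.1 hu
    dsimp only at hi hd ht
    rw [dg_sum_digits hf hi] at hd
    exact ⟨⟨i, hi⟩, (hlit m hm i hi).1 (hd ▸ ht)⟩
  · intro H C hC
    obtain ⟨D, -, ⟨c, hc, hcD⟩, rfl⟩ := mem_fam_start.1 hC
    obtain ⟨⟨i, hi⟩, ht⟩ := H _ (List.getElem_mem hc)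
    exact ⟨(i, dg (base h) D i), mem_cl.2 ⟨hi, by rw [hcD i hi]; omega, rfl⟩, by
      rw [hcD i hi]; exact (hlit c hc i hi).2 ht⟩

theorem satisfiable_iff (hn : n ≤ 2 * h) : φ.Satisfiable ↔ ∃ x < 2 ^ h, ∃ y < 2 ^ h,
    ∀ C ∈ fam (base h) k (start k h (input φ)), ∃ u ∈ C, trueLit h x y u.2 := by
  constructor
  · rintro ⟨X, hX⟩
    -- There may be more than `n` variables in the two halves; the surplus ones occur in no clause
    -- and get the value zero.
    let b : ℕ → ℕ := fun v => if hv : v < n then (X ⟨v, hv⟩).toNat else 0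
    have hb : ∀ v, b v < 2 := fun v => by
      simp only [b]
      split_ifs
      · exact Bool.toNat_lt _
      · omega
    refine ⟨_, sum_digits_lt h (f := b) fun i _ => hb i, _,
      sum_digits_lt h (f := fun i => b (h + i)) fun i _ => hb _, (sat_start_iff hn).2 ?_⟩
    intro c hc
    obtain ⟨i, hi⟩ := hX c hc
    refine ⟨i, ?_⟩
    have hv : value h (∑ i ∈ Finset.range h, b i * 2 ^ i)
        (∑ i ∈ Finset.range h, b (h + i) * 2 ^ i) (c i).1 = b (c i).1 := by
      have hlt := (c i).1.2
      unfold value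
      split_ifs with hvh
      · rw [dg_sum_digits (fun i _ => hb i) hvh]
      · rw [dg_sum_digits (f := fun i => b (h + i)) (fun i _ => hb _) (by omega),
          Nat.add_sub_cancel' (by omega)]
    rw [hv, ← hi]
    simp only [b, (c i).1.2, dif_pos, Fin.eta]
    cases X (c i).1 <;> simp
  · rintro ⟨x, -, y, -, H⟩
    exact ⟨fun v => decide (value h x y v = 1), (sat_start_iff hn).1 H⟩

/-- The conditions on the parameters. -/
structure Large (k h : ℕ) : Prop where
  hh : 0 < h
  petals : k * (4 * h) * 5 ^ k ≤ blocks h * dens h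
  coords : k * (4 * h) * (k * dens h ^ (k - 1)) ≤ blocks h * width k h
  width : 4 ≤ width k h
  len : h ≤ (par k h).q ^ (par k h).R

namespace Large

theorem prime (hL : Large k h) : (par k h).q.Prime := (field_spec hL.hh).1

theorem four_mul_le (hL : Large k h) : 4 * (par k h).g ≤ (par k h).q := by
  have := (field_spec (k := k) hL.hh).2.1
  have h2 := Nat.mul_le_mul_left (blocks h) hL.width
  change 4 * blocks h ≤ field k h
  omega

theorem g_pos : 0 < (par k h).g := Nat.succ_pos _

variable (φ) in
/-- The instance for the advice `j`. -/
noncomputable def instance_ (hL : Large k h) (j : ℕ) : PCPVectors :=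
  (par k h).inst hL.prime.pos hL.len (j % polys k h) (avals k h (input φ) j)
    (bvals k h (input φ) j)

theorem exists_complete (hL : Large k h) (hk : 0 < k) (hn : n ≤ 2 * h) (hφ : φ.Satisfiable) :
    ∃ j < advices k h, (hL.instance_ φ j).Complete := by
  obtain ⟨x, hx, y, hy, H⟩ := (satisfiable_iff hn).1 hφ
  have hD : 1 ≤ dens h := Nat.pow_pos (size_pos hL.hh)
  have hsteps : (ground k h).card * (5 * dens h) ^ k = steps k h := by rw [card_ground, steps]
  obtain ⟨S, h1, h2, h3⟩ := exists_petal_steps (B := base h) (τ := fun u => trueLit h x y u.2)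
    (Nat.succ_pos _) hD (good_start (φ := φ) (h := h) hk) H
  rw [hsteps] at h1 h3
  obtain ⟨j₁, hj₁, hS⟩ := exists_digits (r := blocks h) h1 (by
    refine Nat.le_of_mul_le_mul_right (h2.trans ?_) hD
    rw [card_ground]
    exact hL.petals)
  obtain ⟨h4, h5⟩ := h3 (petalStep (steps k h) (blocks h) j₁) hS
  have hpos : 0 < polys k h := Nat.pow_pos hL.prime.pos
  have hdiv : ∀ j₂ < polys k h, (j₁ * polys k h + j₂) / polys k h = j₁ := fun j₂ hj₂ => by
    rw [add_comm, Nat.add_mul_div_right _ _ hpos, Nat.div_eq_of_lt hj₂, zero_add]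
  have hmod : ∀ j₂ < polys k h, (j₁ * polys k h + j₂) % polys k h = j₂ := fun j₂ hj₂ => by
    rw [Nat.mul_add_mod_self_right, Nat.mod_eq_of_lt hj₂]
  -- The vectors depend only on the quotient `j₁`, so the announcement `j₂` can be chosen after
  -- them.
  have ha : ∀ j₂ < polys k h, avals k h (input φ) (j₁ * polys k h + j₂) =
      avals k h (input φ) (j₁ * polys k h + 0) := fun j₂ hj₂ => by
    funext x e
    rw [avals, avals, sparse, sparse, hdiv _ hj₂, hdiv _ hpos]
  have hb : ∀ j₂ < polys k h, bvals k h (input φ) (j₁ * polys k h + j₂) =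
      bvals k h (input φ) (j₁ * polys k h + 0) := fun j₂ hj₂ => by
    funext x e
    rw [bvals, bvals, sparse, sparse, hdiv _ hj₂, hdiv _ hpos]
  obtain ⟨j₂, hj₂, hC⟩ := Par.complete_of_sum_eq_zero (P := par k h) g_pos hL.prime.one_lt hL.len hx
    hy (al := avals k h (input φ) (j₁ * polys k h + 0))
    (be := bvals k h (input φ) (j₁ * polys k h + 0)) (by
      simp only [avals, bvals, sparse, hdiv _ hpos]
      exact sum_flag_eq_zero h5 h4)
  refine ⟨j₁ * polys k h + j₂, ?_, ?_⟩
  · have := Nat.mul_le_mul_right (polys k h) (Nat.succ_le_of_lt hj₁)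
    rw [Nat.succ_mul] at this
    change j₂ < polys k h at hj₂
    rw [advices]
    omega
  · unfold instance_
    rw [hmod _ hj₂, ha _ hj₂, hb _ hj₂]
    exact hC

theorem complete_or_sound (hL : Large k h) (hk : 0 < k) (hn : n ≤ 2 * h) (j : ℕ) :
    ((hL.instance_ φ j).Complete ∧ φ.Satisfiable) ∨
      (hL.instance_ φ j).Sound (1 / 2 ^ (par k h).R) := by
  have hD : 1 ≤ dens h := Nat.pow_pos (size_pos hL.hh)
  rcases Par.complete_or_sound (P := par k h) g_pos hL.prime hL.four_mul_le hL.len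
    (j % polys k h) (al := avals k h (input φ) j) (be := bvals k h (input φ) j) (by
      intro x y
      refine lt_of_le_of_lt ?_ (field_spec (k := k) hL.hh).2.1
      refine (Finset.sum_le_card_nsmul _ _ 1 fun e _ => ?_).trans (by simp [par])
      exact Nat.mul_le_mul (ind_le_one _) (ind_le_one _)) with ⟨h1, x, hx, y, hy, h0⟩ | h1
  · refine .inl ⟨h1, (satisfiable_iff hn).2 ⟨x, hx, y, hy, ?_⟩⟩
    refine sat_of_sat_runc (Nat.succ_pos _) hD (steps k h)
      (P := petalStep (steps k h) (blocks h) (j / polys k h)) ?_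
    refine sat_of_sum_flag (coords_pos (k := k) hL.hh) (fun hsp => ?_) h0
    refine ((good_runc (Nat.succ_pos _) hD (good_start hk) _ _).card_le hD
      (not_heavy_of_flowers_le (Nat.succ_pos _) hD hsp)).trans ?_
    rw [card_ground]
    exact hL.coords
  · exact .inr h1

end Large
end
end RAM

namespace RAM

/-! ### Searching for an accepting run -/

/-- The program that writes zero to the `n` registers from `B` on. -/
def clear (B : ℕ) : ℕ → Prog
  | 0 => .skip
  | n + 1 => .seq (clear B n) (.assign (B + n) (.lit 0))

theorem exec_clear (B n : ℕ) (s : State) :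
    ∃ s', Exec (clear B n) s (1 + 2 * n) s' ∧ (∀ x < n, s'.reg (x + B) = 0) ∧
      (∀ r < B, s'.reg r = s.reg r) ∧ s'.arr = s.arr := by
  induction n with
  | zero => exact ⟨s, .skip s, by simp, fun _ _ => rfl, rfl⟩
  | succ n ih =>
    obtain ⟨s₁, h1, h2, h3, h4⟩ := ih
    refine ⟨_, (h1.seq (.assign s₁ _ _)).cast ?_, fun x hx => ?_, fun r hr => ?_, h4⟩
    · simp only [Expr.cost, Nat.size_zero]
      ring
    · rcases Nat.lt_succ_iff_lt_or_eq.1 hx with hx | rfl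
      · simp only
        rw [Function.update_of_ne (by omega), h2 x hx]
      · simp [add_comm, Expr.eval]
    · simp only
      rw [Function.update_of_ne (by omega), h3 r hr]

variable {α : Type} {Γ : Ctx α} {J len : α → ℕ}

/-- Instances together with a number below `J` and a number below `len`, both of which are
available in registers. -/
def Ctx.entries (Γ : Ctx α) (J len : α → ℕ) (hJ : PolyBd Γ.size fun a => (J a).size)
    (hlen : PolyBd Γ.size fun a => (len a).size) : Ctx (Σ a : α, Fin (J a) × Fin (len a)) where
  size x := Γ.size x.1
  inp x := Γ.inp x.1
  vars := {fun x => x.2.1, fun x => x.2.2}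
  vars_bd := by
    rintro v (rfl | rfl)
    · exact (hJ.comp fun x : Σ a : α, Fin (J a) × Fin (len a) => x.1).mono fun x =>
        Nat.size_le_size x.2.1.2.le
    · exact (hlen.comp fun x : Σ a : α, Fin (J a) × Fin (len a) => x.1).mono fun x =>
        Nat.size_le_size x.2.2.2.le

/-- Writes the word with number `j` to the first array of the memory with number `j`, where `w`
computes a single entry. -/
def writeWord (w : Prog) : Prog :=
  .loop (.op .sub (.reg 3) (.reg 4))
    (.seq (.seq w (.store 1 (.op .add (.op .mul (.reg 4) (.reg 1)) (.reg 2)) (.reg 5)))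
      (.assign 4 (.op .add (.reg 4) (.lit 1))))

/-- Residues above `j` are still zero when word `j` is written, and remain so afterwards. Array `1`
plays the role of the input array of the relocated program. -/
theorem exec_writeWord {w : Prog} {J len j S : ℕ} {inp out : ℕ → ℕ} (hj : j < J)
    (hJS : J.size ≤ S) (hlS : len.size ≤ S)
    (hw : ∀ i < len, ∀ s : State, s.reg 2 = j → s.reg 4 = i → s.arr 0 = inp →
      ∃ t s', Exec w s t s' ∧ t ≤ S ∧ s'.reg 5 = out i ∧ (out i).size ≤ S ∧
        (∀ r < 5, s'.reg r = s.reg r) ∧ s'.arr = s.arr)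
    (s : State) (h1 : s.reg 1 = J) (h2 : s.reg 2 = j) (h3 : s.reg 3 = len) (h4 : s.reg 4 = 0)
    (hinp : s.arr 0 = inp) (h0 : ∀ a m, j ≤ m % J → s.arr (a + 1) m = 0) :
    ∃ t s', Exec (writeWord w) s t s' ∧ t ≤ (len + 1) * (20 * S + 20) ∧
      s'.reg 0 = s.reg 0 ∧ s'.reg 1 = J ∧ s'.reg 2 = j ∧ s'.reg 3 = len ∧ s'.arr 0 = inp ∧
      (∀ i, s'.arr 1 (i * J + j) = if i < len then out i else 0) ∧
      (∀ a i, s'.arr (a + 2) (i * J + j) = 0) ∧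
      ∀ a m, j < m % J → s'.arr (a + 1) m = 0 := by
  have hmod : ∀ i, (i * J + j) % J = j := fun i => by
    rw [Nat.mul_add_mod', Nat.mod_eq_of_lt hj]
  let Inv : ℕ → State → Prop := fun n s' => s'.reg 0 = s.reg 0 ∧ s'.reg 1 = J ∧ s'.reg 2 = j ∧
    s'.reg 3 = len ∧ s'.reg 4 = n ∧ s'.arr 0 = inp ∧
    (∀ i, s'.arr 1 (i * J + j) = if i < n then out i else 0) ∧
    (∀ a i, s'.arr (a + 2) (i * J + j) = 0) ∧ ∀ a m, j < m % J → s'.arr (a + 1) m = 0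
  have hcost : ∀ n s', n ≤ len → Inv n s' →
      Expr.cost s' (.op .sub (.reg 3) (.reg 4)) ≤ 3 * S + 3 := by
    rintro n s' hn ⟨-, -, -, h3, h4, -⟩
    have e1 := Nat.size_le_size hn
    have e2 := Nat.size_le_size (Nat.sub_le len n)
    simp only [Expr.cost, Expr.eval, h3, h4, Op.eval]
    omega
  obtain ⟨t, s', e, ht, g0, g1, g2, g3, g4, g5⟩ := Exec.loop_of_invariant
    (e := .op .sub (.reg 3) (.reg 4))
    (p := .seq (.seq w (.store 1 (.op .add (.op .mul (.reg 4) (.reg 1)) (.reg 2)) (.reg 5)))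
      (.assign 4 (.op .add (.reg 4) (.lit 1)))) (c := 3 * S + 3) (τ := 16 * S + 16) len Inv
    (by
      rintro n s' hn hI
      refine ⟨?_, hcost n s' hn.le hI, ?_⟩
      · obtain ⟨-, -, -, h3, h4, -⟩ := hI
        simp only [Expr.eval, Op.eval, h3, h4]
        omega
      obtain ⟨g0, g1, g2, g3, g4, g5, g6, g7, g8⟩ := hI
      obtain ⟨t, s₁, e₁, ht, k5, k6, kr, ka⟩ := hw n hn s' g2 g4 g5
      have k0 := kr 0 (by omega)
      have k1 := (kr 1 (by omega)).trans g1
      have k2 := (kr 2 (by omega)).trans g2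
      have k3 := (kr 3 (by omega)).trans g3
      have k4 := (kr 4 (by omega)).trans g4
      refine ⟨_, _, .seq (.seq e₁ (.store s₁ _ _ _)) (.assign _ _ _), ?_, ?_⟩
      · have f1 := Nat.size_le_size hn.le
        have f2 := Nat.size_le_size hj.le
        have f3 := size_mul_le n J
        have f4 := size_mul_add_le hj n
        have f5 := Nat.size_le_size hn.nat_succ_le
        simp only [Expr.cost, Expr.eval, Op.eval, k1, k2, k4, k5, Nat.size_one]
        simp only [Nat.succ_eq_add_one] at f5
        omega
      · simp only [Inv, Expr.eval, Op.eval, k1, k2, k4, k5, ka]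
        refine ⟨?_, ?_, ?_, ?_, ?_, ?_, fun i => ?_, fun a i => ?_, fun a m hm => ?_⟩
        · simpa using k0.trans g0
        · simpa using k1
        · simpa using k2
        · simpa using k3
        · simp
        · simpa using g5
        · rw [Function.update_self]
          by_cases hi : i = n
          · simp [hi]
          · rw [Function.update_of_ne, g6]
            · have : i < n + 1 ↔ i < n := by omega
              simp only [this]
            · intro h
              exact hi (Nat.eq_of_mul_eq_mul_right (by omega) (Nat.add_right_cancel h))
        · rw [Function.update_of_ne (by omega), g7]
        · by_cases ha : a = 0
          · subst ha
            rw [zero_add, Function.update_self, Function.update_of_ne, g8 0 m hm]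
            rintro rfl
            rw [hmod] at hm
            omega
          · rw [Function.update_of_ne (by omega), g8 a m hm])
    (by
      intro s' hI
      refine ⟨?_, hcost _ s' le_rfl hI⟩
      obtain ⟨-, -, -, h3, h4, -⟩ := hI
      simp [Expr.eval, Op.eval, h3, h4])
    s ⟨rfl, h1, h2, h3, h4, hinp, fun i => by
      simpa using h0 0 _ (hmod i).ge, fun a i => h0 (a + 1) _ (hmod i).ge,
      fun a m hm => h0 a m hm.le⟩
  exact ⟨t, s', e, ht.trans (Nat.mul_le_mul_left _ (by omega)), g0, g1, g2, g3, g5⟩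

/-- Runs `p` on the words written by `w`, each time in fresh memory, and records in register `0`
whether some run accepts. -/
def searchLoop (w p : Prog) : Prog :=
  .loop (.op .sub (.reg 1) (.reg 2))
    (.seq (.seq (.seq (.seq (.seq (.assign 4 (.lit 0)) (writeWord w)) (clear 6 (p.regs + 1)))
      (p.reloc 6 1 2)) (.cond (.reg 6) (.assign 0 (.lit 1)) .skip))
      (.assign 2 (.op .add (.reg 2) (.lit 1))))

theorem exec_searchLoop {w p : Prog} {J len S τ : ℕ} {inp v : ℕ → ℕ} {l : ℕ → List ℕ}
    (hJS : J.size ≤ S) (hlS : len.size ≤ S)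
    (hw : ∀ j < J, ∀ i < len, ∀ s : State, s.reg 2 = j → s.reg 4 = i → s.arr 0 = inp →
      ∃ t s', Exec w s t s' ∧ t ≤ S ∧ s'.reg 5 = (l j).getD i 0 ∧ ((l j).getD i 0).size ≤ S ∧
        (∀ r < 5, s'.reg r = s.reg r) ∧ s'.arr = s.arr)
    (hl : ∀ j < J, (l j).length = len)
    (hp : ∀ j < J, ∃ t s, Exec p (init (l j)) t s ∧ t ≤ τ ∧ s.reg 0 = v j) (hv : ∀ j, v j ≤ 1)
    (s : State) (h0 : s.reg 0 = 0) (h1 : s.reg 1 = J) (h2 : s.reg 2 = 0) (h3 : s.reg 3 = len)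
    (hinp : s.arr 0 = inp) (harr : ∀ a m, s.arr (a + 1) m = 0) :
    ∃ t s', Exec (searchLoop w p) s t s' ∧
      t ≤ (J + 1) * ((len + 1 + τ) * (40 * S + 2 * p.regs + 60)) ∧
      s'.reg 0 = if ∃ j < J, v j = 1 then 1 else 0 := by
  let Inv : ℕ → State → Prop := fun n s' => (s'.reg 0 = if ∃ j < n, v j = 1 then 1 else 0) ∧
    s'.reg 1 = J ∧ s'.reg 2 = n ∧ s'.reg 3 = len ∧ s'.arr 0 = inp ∧
    ∀ a m, n ≤ m % J → s'.arr (a + 1) m = 0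
  have hcost : ∀ n s', n ≤ J → Inv n s' →
      Expr.cost s' (.op .sub (.reg 1) (.reg 2)) ≤ 3 * S + 3 := by
    rintro n s' hn ⟨-, g1, g2, -⟩
    have e1 := Nat.size_le_size hn
    have e2 := Nat.size_le_size (Nat.sub_le J n)
    simp only [Expr.cost, Expr.eval, g1, g2, Op.eval]
    omega
  obtain ⟨t, s', e, ht, g0, -⟩ := Exec.loop_of_invariant
    (e := .op .sub (.reg 1) (.reg 2))
    (p := .seq (.seq (.seq (.seq (.seq (.assign 4 (.lit 0)) (writeWord w)) (clear 6 (p.regs + 1)))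
      (p.reloc 6 1 2)) (.cond (.reg 6) (.assign 0 (.lit 1)) .skip))
      (.assign 2 (.op .add (.reg 2) (.lit 1)))) (c := 3 * S + 3)
    (τ := (len + 1) * (20 * S + 20) + (5 + 4 * S) * τ + 2 * p.regs + 2 * S + 20) J Inv
    (by
      rintro n s' hn hI
      refine ⟨?_, hcost n s' hn.le hI, ?_⟩
      · obtain ⟨-, g1, g2, -⟩ := hI
        simp only [Expr.eval, Op.eval, g1, g2]
        omega
      obtain ⟨g0, g1, g2, g3, g4, g5⟩ := hI
      have hmod : ∀ i, (i * J + n) % J = n := fun i => by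
        rw [Nat.mul_add_mod', Nat.mod_eq_of_lt hn]
      obtain ⟨t₁, s₁, e₁, ht₁, a0, a1, a2, a3, a4, a5, a6, a7⟩ := exec_writeWord
        (out := fun i => (l n).getD i 0) hn hJS hlS (hw n hn)
        { s' with reg := Function.update s'.reg 4 ((Expr.lit 0).eval s') }
        (by simpa using g1) (by simpa using g2) (by simpa using g3) (by simp [Expr.eval]) g4 g5
      obtain ⟨s₂, e₂, b0, b1, b2⟩ := exec_clear 6 (p.regs + 1) s₁
      obtain ⟨t, s₃, e₃, ht, hr⟩ := hp n hn
      obtain ⟨t₄, s₄, e₄, ht₄, hS, hF⟩ := e₃.reloc (B := 6) (rJ := 1) (rj := 2) (X := p.regs + 1)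
        (by omega) (by omega) hn (Nat.le_succ _) s₂
        ⟨fun x hx => b0 x hx, fun a i => by
          rw [b2]
          cases a with
          | zero =>
            simp only [init, a5, if_true]
            split_ifs with hi
            · rfl
            · rw [List.getD_eq_default _ _ (by rw [hl n hn]; omega)]
          | succ a => simp [init, a6], by rw [b1 1 (by omega), a1], by rw [b1 2 (by omega), a2]⟩
      have h6 : s₄.reg 6 = v n := (hS.reg 0 (by omega)).trans hr
      have h0 : s₄.reg 0 = s'.reg 0 := by
        rw [hF.reg 0 (by omega), b1 0 (by omega), a0]
        simp
      have h1 : s₄.reg 1 = J := hS.hJ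
      have h2 : s₄.reg 2 = n := hS.hj
      have h3 : s₄.reg 3 = len := by rw [hF.reg 3 (by omega), b1 3 (by omega), a3]
      have h4 : s₄.arr 0 = inp := by rw [hF.inp, b2, a4]
      have h5 : ∀ a m, n + 1 ≤ m % J → s₄.arr (a + 1) m = 0 := fun a m hm => by
        rw [hF.arr _ _ (by omega), b2, a7 a m hm]
      have hvn := hv n
      obtain ⟨t₅, s₅, e₅, ht₅, c0, cr, ca⟩ : ∃ t s, Exec (.cond (.reg 6) (.assign 0 (.lit 1)) .skip)
          s₄ t s ∧ t ≤ 6 ∧ s.reg 0 = (if ∃ j < n + 1, v j = 1 then 1 else 0) ∧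
          (∀ r, r ≠ 0 → s.reg r = s₄.reg r) ∧ s.arr = s₄.arr := by
        have hvs := size_le_self (v n)
        by_cases hz : v n = 0
        · refine ⟨_, s₄, .cond_false (h6.trans hz) (.skip s₄), ?_, ?_, fun _ _ => rfl, rfl⟩
          · simp only [Expr.cost, h6]
            omega
          · rw [h0, g0]
            congr 1
            refine propext ⟨fun ⟨j, hj, h⟩ => ⟨j, by omega, h⟩, fun ⟨j, hj, h⟩ => ⟨j, ?_, h⟩⟩
            rcases Nat.lt_succ_iff_lt_or_eq.1 hj with hj | rfl
            · exact hj
            · omega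
        · refine ⟨_, _, .cond_true (by rwa [Expr.eval, h6]) (.assign s₄ _ _), ?_, ?_,
            fun r hr => by simp [hr], rfl⟩
          · simp only [Expr.cost, h6, Nat.size_one]
            omega
          · rw [if_pos ⟨n, by omega, by omega⟩]
            simp [Expr.eval]
      refine ⟨_, _, .seq (.seq (.seq (.seq (.seq (.assign s' _ _) e₁) e₂) e₄) e₅)
        (.assign s₅ _ _), ?_, ?_⟩
      · have f1 := Nat.size_le_size hn.le
        have f2 := Nat.size_le_size hn.nat_succ_le
        have f3 : (5 + 4 * J.size) * t ≤ (5 + 4 * S) * τ := Nat.mul_le_mul (by omega) ht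
        simp only [Nat.succ_eq_add_one] at f2
        simp only [Expr.cost, Expr.eval, Op.eval, cr 2 (by omega), h2, Nat.size_one, Nat.size_zero]
        omega
      · simp only [Inv, Expr.eval, Op.eval, cr 2 (by omega), h2, ca]
        refine ⟨?_, ?_, ?_, ?_, h4, h5⟩
        · simpa using c0
        · simpa [cr 1] using h1
        · simp
        · simpa [cr 3] using h3)
    (by
      intro s' hI
      refine ⟨?_, hcost _ s' le_rfl hI⟩
      obtain ⟨-, g1, g2, -⟩ := hI
      simp [Expr.eval, Op.eval, g1, g2])
    s ⟨by simpa using h0, h1, h2, h3, hinp, fun a m _ => harr a m⟩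
  refine ⟨t, s', e, ht.trans (Nat.mul_le_mul_left _ ?_), g0⟩
  nlinarith [Nat.zero_le (len * S), Nat.zero_le (τ * S), Nat.zero_le (len * p.regs),
    Nat.zero_le (τ * p.regs)]

/-- If the words `l a j` have feasible lengths and entries, then it takes little more time to search
for a word that is accepted by `p` than to run `p` on all of them. -/
theorem exists_search (hΓ : Γ.vars = ∅) (hJ : Feas Γ J) (hlen : Feas Γ len)
    {l : α → ℕ → List ℕ} (hl : ∀ a, ∀ j < J a, (l a j).length = len a)
    (hentry : Feas (Γ.entries J len hJ.size_bd hlen.size_bd) fun x => (l x.1 x.2.1).getD x.2.2 0)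
    (p : Prog) :
    ∃ P U, PolyBd Γ.size U ∧ ∀ (a : α) (inp : List ℕ) (τ : ℕ) (v : ℕ → ℕ),
      (init inp).arr 0 = Γ.inp a →
      (∀ j < J a, ∃ t s, Exec p (init (l a j)) t s ∧ t ≤ τ ∧ s.reg 0 = v j) → (∀ j, v j ≤ 1) →
      ∃ t s, Exec P (init inp) t s ∧ t ≤ (J a + 1) * (len a + 1 + τ) * U a ∧
        s.reg 0 = if ∃ j < J a, v j = 1 then 1 else 0 := by
  obtain ⟨T₁, hT₁, hs₁, H₁⟩ := id hJ
  obtain ⟨T₂, hT₂, hs₂, H₂⟩ := id hlen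
  obtain ⟨T₃, ⟨c, hT₃⟩, hs₃, H₃⟩ := hentry
  obtain ⟨p₁, hp₁⟩ := H₁ 5 (fun _ => 0) (by simp)
  obtain ⟨p₂, hp₂⟩ := H₂ 5 (fun _ => 0) (by simp)
  let vj : (Σ a : α, Fin (J a) × Fin (len a)) → ℕ := fun x => x.2.1
  classical
  -- The layout is the one of `searchLoop`: the number of the word is in register `2` and the
  -- position in register `4`.
  obtain ⟨w, hw⟩ := H₃ 5 (fun v => if v = vj then 2 else 4) fun v _ => by
    split_ifs <;> omega
  let S : α → ℕ := fun a => T₁ a + T₂ a + (Γ.size a + 2) ^ c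
  have hS : PolyBd Γ.size S := (hT₁.add hT₂).add ⟨c, fun _ => le_rfl⟩
  refine ⟨.seq (.seq (.seq (.seq p₁ (.assign 1 (.reg 5))) p₂) (.assign 3 (.reg 5)))
    (searchLoop w p), fun a => 44 * S a + (2 * p.regs + 64),
    ((PolyBd.const _ 44).mul hS).add (.const _ _), fun a inp τ v hi hp hv => ?_⟩
  obtain ⟨t₁, s₁, e₁, le₁, r₁, l₁, a₁⟩ := hp₁ a (init inp) (by simp [hΓ]) hi
  obtain ⟨t₂, s₂, e₂, le₂, r₂, l₂, a₂⟩ := hp₂ a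
    { s₁ with reg := Function.update s₁.reg 1 ((Expr.reg 5).eval s₁) } (by simp [hΓ])
    (by simp only [a₁, hi])
  obtain ⟨t₃, s₃, e₃, le₃, h₃⟩ := exec_searchLoop (J := J a) (len := len a) (S := S a) (τ := τ)
    (inp := Γ.inp a) (v := v) (l := l a) (w := w) (p := p) ((hs₁ a).trans (by simp only [S]; omega))
    ((hs₂ a).trans (by simp only [S]; omega))
    (by
      intro j hj i hi s h2 h4 h0
      obtain ⟨t, s', e, le, r, l, ar⟩ := hw ⟨a, ⟨j, hj⟩, ⟨i, hi⟩⟩ s (by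
        intro v hv
        dsimp only
        split_ifs with h
        · rw [h2, h]
        · rcases hv with rfl | rfl
          · exact absurd rfl h
          · exact h4) h0
      have h5 := hT₃ ⟨a, ⟨j, hj⟩, ⟨i, hi⟩⟩
      change T₃ _ ≤ (Γ.size a + 2) ^ c at h5
      exact ⟨t, s', e, le.trans (h5.trans (by simp only [S]; omega)), r,
        (hs₃ ⟨a, ⟨j, hj⟩, ⟨i, hi⟩⟩).trans (h5.trans (by simp only [S]; omega)), l, ar⟩)
    (hl a) hp hv { s₂ with reg := Function.update s₂.reg 3 ((Expr.reg 5).eval s₂) }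
    (by simp [l₂, l₁, init]) (by simp [l₂, r₁, Expr.eval])
    (by simp [l₂, l₁, init]) (by simp [Expr.eval, r₂]) (by simp only [a₂, a₁, hi])
    (by simp [a₂, a₁, init])
  refine ⟨_, _, .seq (.seq (.seq (.seq e₁ (.assign s₁ _ _)) e₂) (.assign s₂ _ _)) e₃, ?_, h₃⟩
  have f1 := hs₁ a
  have f2 := hs₂ a
  have f3 : 1 * (4 * S a + 4) ≤ (J a + 1) * (len a + 1 + τ) * (4 * S a + 4) :=
    Nat.mul_le_mul_right _ (Nat.mul_pos (by omega) (by omega))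
  simp only [Expr.cost, r₁, r₂]
  rw [← mul_assoc] at le₃
  have f4 : (J a + 1) * (len a + 1 + τ) * (44 * S a + (2 * p.regs + 64)) =
    (J a + 1) * (len a + 1 + τ) * (40 * S a + 2 * p.regs + 60) +
    (J a + 1) * (len a + 1 + τ) * (4 * S a + 4) := by ring
  rw [f4]
  have f5 : T₁ a + T₂ a ≤ S a := Nat.le_add_right _ _
  omega

end RAM

namespace RAM

/-! ### Deciding satisfiability through instances of PCP-Vectors -/

/-- The parameter for formulas on `n` variables. -/
def half (n₀ n : ℕ) : ℕ := (n + 1) / 2 + n₀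

theorem le_two_mul_half (n₀ n : ℕ) : n ≤ 2 * half n₀ n := by
  rw [half]
  omega

theorem polyBd_input (n₀ k : ℕ) : PolyBd (fun a : Σ n, KCNF k n => half n₀ a.1)
    fun a => 2 * a.1 + (2 * a.1) ^ k := by
  have h : PolyBd (fun a : Σ n, KCNF k n => half n₀ a.1) fun a => 2 * a.1 :=
    ((PolyBd.const _ 4).mul (.size _)).mono fun a => by
      have := le_two_mul_half n₀ a.1
      omega
  exact h.add (h.pow k)

/-- The context of a computation on formulas. -/
noncomputable def formulas (n₀ k : ℕ) : Ctx (Σ n, KCNF k n) where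
  size a := half n₀ a.1
  inp a := input a.2
  vars := ∅
  vars_bd := by simp

variable {n₀ k : ℕ}

theorem polyBd_formulas : ∃ c, ∀ a i,
    (formulas n₀ k).inp a i ≤ ((formulas n₀ k).size a + 2) ^ c :=
  (polyBd_input n₀ k).imp fun _ hc a i => (input_le _ i).trans (hc a)

theorem feasU_half : FeasU (formulas n₀ k) fun a => half n₀ a.1 := by
  obtain ⟨c, hc⟩ := polyBd_formulas (n₀ := n₀) (k := k)
  have h : FeasU (formulas n₀ k) fun a => (formulas n₀ k).inp a 0 :=
    ⟨Feas.input (.const 0) ⟨c, fun a => (size_le_self _).trans (hc a 0)⟩, c, fun a => hc a 0⟩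
  exact ((h.add (.const 1)).div (.const 2)).add (.const n₀)

/-- A machine for PCP-Vectors yields a machine for satisfiability. -/
theorem exists_sat (hk : 0 < k) (hL : ∀ n, Large k (half n₀ n)) (p : Prog) :
    ∃ P c, ∀ (n : ℕ) (φ : KCNF k n) (τ : ℝ),
      (∀ j < advices k (half n₀ n),
        ((((hL n).instance_ φ j).Complete → AcceptsWithin p ((hL n).instance_ φ j).encode τ)) ∧
        (((hL n).instance_ φ j).Sound (1 / 2 ^ (par k (half n₀ n)).R) →
          RejectsWithin p ((hL n).instance_ φ j).encode τ)) →
      ∃ t s, Exec P (init φ.encode) t s ∧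
        t ≤ (advices k (half n₀ n) + 1) * ((par k (half n₀ n)).size + 1 + ⌊τ⌋₊) *
          (half n₀ n + 2) ^ c ∧ (φ.Satisfiable → s.reg 0 = 1) ∧ (¬ φ.Satisfiable → s.reg 0 = 0) := by
  classical
  obtain ⟨c, hc⟩ := polyBd_formulas (n₀ := n₀) (k := k)
  have hh := feasU_half (n₀ := n₀) (k := k)
  obtain ⟨P, U, ⟨d, hU⟩, H⟩ := exists_search (Γ := formulas n₀ k) rfl (FeasU.advices (k := k) hh)
    (hh.feasPar (k := k)).size (l := fun a j => ((hL a.1).instance_ a.2 j).encode)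
    (fun a j _ => Par.length_encode_inst ..) (by
      have hE : Ext (formulas n₀ k) ((formulas n₀ k).entries _ _
          (FeasU.advices (k := k) hh).size_bd (hh.feasPar (k := k)).size.size_bd) fun x => x.1 :=
        ⟨fun _ => rfl, fun _ => rfl, fun v hv => hv.elim⟩
      refine (FeasU.outp (k := k) (Γ := (formulas n₀ k).entries _ _
        (FeasU.advices (k := k) hh).size_bd (hh.feasPar (k := k)).size.size_bd)
        (feasS_inp (c := c) fun x i => hc x.1 i) ⟨c, fun x => hc x.1 1⟩ (hE.feasU hh)
        (.var (.inl rfl)) (.var (.inr rfl))).congr fun x => ?_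
      exact (Par.getD_encode_inst _ _ _ _ _ x.2.2.2).symm) p
  refine ⟨P, d, fun n φ τ hp => ?_⟩
  obtain ⟨t, s, e, ht, hs⟩ := H ⟨n, φ⟩ φ.encode ⌊τ⌋₊
    -- Every answer is forced: if this conjunction fails, then `complete_or_sound` puts the instance
    -- in the sound case.
    (fun j => if ((hL n).instance_ φ j).Complete ∧ φ.Satisfiable then 1 else 0)
    (by rfl) (by
      intro j hj
      split_ifs with h
      · obtain ⟨t, s, e, ht, hs⟩ := (hp j hj).1 h.1
        exact ⟨t, s, e, Nat.le_floor ht, hs⟩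
      · obtain ⟨t, s, e, ht, hs⟩ := (hp j hj).2
          (((hL n).complete_or_sound hk (le_two_mul_half n₀ n) j).resolve_left h)
        exact ⟨t, s, e, Nat.le_floor ht, hs⟩)
    (fun j => by split_ifs <;> omega)
  refine ⟨t, s, e, ht.trans (Nat.mul_le_mul_left _ (hU ⟨n, φ⟩)), fun hφ => ?_, fun hφ => ?_⟩
  · obtain ⟨j, hj, hC⟩ := (hL n).exists_complete hk (le_two_mul_half n₀ n) hφ
    rw [hs, if_pos ⟨j, hj, if_pos ⟨hC, hφ⟩⟩]
  · rw [hs, if_neg]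
    rintro ⟨j, -, h⟩
    rw [if_neg fun h => hφ h.2] at h
    omega

end RAM

namespace RAM

/-! ### Asymptotics of the parameters -/

/-- `h` is large in terms of `m`. -/
structure Big (m h : ℕ) : Prop where
  size : m ≤ h.size.size
  pow : h.size ^ m ≤ h

theorem tendsto_size : Tendsto Nat.size atTop atTop :=
  tendsto_atTop_atTop.2 fun m => ⟨2 ^ m, fun _ h => (Nat.lt_size.2 h).le⟩

theorem two_pow_size_le {h : ℕ} (hh : 0 < h) : 2 ^ h.size ≤ 2 * h := by
  obtain ⟨b, hb⟩ := Nat.exists_eq_succ_of_ne_zero (Nat.size_pos.2 hh).ne'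
  have : 2 ^ b ≤ h := Nat.lt_size.1 (by omega)
  rw [hb, pow_succ]
  omega

theorem eventually_pow_le (m : ℕ) : ∀ᶠ b : ℕ in atTop, 2 * b ^ m ≤ 2 ^ b := by
  have h := tendsto_pow_const_div_const_pow_of_one_lt m (one_lt_two : (1 : ℝ) < 2)
  filter_upwards [h.eventually_le_const (show (0 : ℝ) < 1 / 2 by norm_num)] with b hb
  rw [div_le_iff₀ (by positivity)] at hb
  have : (2 : ℝ) * (b : ℝ) ^ m ≤ 2 ^ b := by linarith
  exact_mod_cast this

theorem eventually_big (m : ℕ) : ∀ᶠ h in atTop, Big m h := by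
  filter_upwards [(tendsto_size.comp tendsto_size).eventually_ge_atTop m,
    tendsto_size.eventually (eventually_pow_le m), eventually_gt_atTop 0] with h h1 h2 h3
  exact ⟨h1, by have := two_pow_size_le h3; omega⟩

namespace Big
variable {m k h : ℕ}

theorem le_size (hB : Big m h) : m ≤ h.size := hB.size.trans (size_le_self _)

theorem mul_pow_le (hB : Big m h) {c i : ℕ} (hc : c ≤ m) (hi : i < m) : c * h.size ^ i ≤ h := by
  refine le_trans ?_ hB.pow
  have h0 : 0 < h.size := by have := hB.le_size; omega
  calc c * h.size ^ i ≤ h.size * h.size ^ i := Nat.mul_le_mul_right _ (hc.trans hB.le_size)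
    _ = h.size ^ (i + 1) := (pow_succ' _ _).symm
    _ ≤ _ := Nat.pow_le_pow_right h0 hi

theorem pos (hB : Big m h) (hm : 0 < m) : 0 < h := by
  by_contra! h0
  obtain rfl : h = 0 := by omega
  have := hB.le_size
  simp at this
  omega

theorem le_blocks_mul (h : ℕ) : h ≤ blocks h * h.size ^ 2 := by
  rcases Nat.eq_zero_or_pos h with rfl | hh
  · simp
  · have := Nat.lt_mul_div_succ h (Nat.pow_pos (n := 2) (size_pos hh))
    rw [blocks, mul_comm]
    exact this.le

theorem blocks_mul_le (hB : Big m h) (hm : 2 < m) : blocks h * h.size ^ 2 ≤ 2 * h := by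
  have h1 := hB.mul_pow_le (c := 1) (i := 2) (by omega) hm
  have h2 := Nat.div_mul_le_self h (h.size ^ 2)
  rw [blocks, add_mul]
  omega

theorem le_two_pow (hB : Big m h) (hm : 3 * k + 7 ≤ m) : (par k h).R * h.size ^ (3 * k + 5) ≤ h ∧
    h + 1 ≤ ((par k h).R + 1) * h.size ^ (3 * k + 5) ∧ h.size ≤ (par k h).R := by
  have h0 : 0 < h.size ^ (3 * k + 5) := Nat.pow_pos (size_pos (hB.pos (by omega)))
  refine ⟨Nat.div_mul_le_self _ _, ?_, ?_⟩
  · rw [mul_comm]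
    exact Nat.lt_mul_div_succ h h0
  · refine (Nat.le_div_iff_mul_le h0).2 ?_
    have := hB.mul_pow_le (c := 1) (i := 3 * k + 6) (by omega) (by omega)
    rw [← pow_succ']
    exact (one_mul (h.size ^ (3 * k + 6))).symm.trans_le this

/-- The constants that depend on `k` are absorbed by one factor `h.size`, because `blocks h * h.size
^ 2` is at least `h` and `dens h` is `h.size ^ 3`. -/
theorem large (hB : Big m h) (hk : 0 < k) (h1 : 4 * k * 5 ^ k ≤ m) (h2 : 4 * k ^ 2 ≤ m)
    (h3 : 3 * k + 7 ≤ m) : Large k h where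
  hh := hB.pos (by omega)
  petals := by
    have hb := le_blocks_mul h
    have hm := hB.le_size
    calc k * (4 * h) * 5 ^ k = 4 * k * 5 ^ k * h := by ring
      _ ≤ h.size * (blocks h * h.size ^ 2) := Nat.mul_le_mul (h1.trans hm) hb
      _ = blocks h * dens h := by rw [dens]; ring
  coords := by
    have hb := le_blocks_mul h
    have hm := hB.le_size
    have h0 : 0 < h.size := by omega
    calc k * (4 * h) * (k * dens h ^ (k - 1)) = 4 * k ^ 2 * h * h.size ^ (3 * (k - 1)) := by
          rw [dens, ← pow_mul]; ring
      _ ≤ h.size ^ 1 * (blocks h * h.size ^ 2) * h.size ^ (3 * (k - 1)) := by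
          refine Nat.mul_le_mul_right _ (Nat.mul_le_mul ?_ hb)
          simpa using h2.trans hm
      _ = blocks h * h.size ^ (3 * (k - 1) + 3) := by ring
      _ ≤ blocks h * RAM.width k h :=
          Nat.mul_le_mul_left _ (Nat.pow_le_pow_right h0 (by omega))
  width := by
    have hm := hB.le_size
    rw [RAM.width]
    calc 4 ≤ 4 ^ (3 * k + 2) := Nat.le_self_pow (by omega) 4
      _ ≤ _ := Nat.pow_le_pow_left (by omega) _
  len := by
    have hq : 2 ≤ (par k h).q := (field_spec (hB.pos (by omega))).1.two_le
    calc h ≤ 2 ^ h.size := (Nat.lt_size_self h).le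
      _ ≤ 2 ^ (par k h).R := Nat.pow_le_pow_right (by omega) (hB.le_two_pow h3).2.2
      _ ≤ _ := Nat.pow_le_pow_left hq _

theorem field_le (hB : Big m h) (h3 : 3 * k + 7 ≤ m) : field k h ≤ 2 ^ (3 * h.size) := by
  have hh := hB.pos (by omega)
  refine (field_spec (k := k) hh).2.2.trans ?_
  have h1 : blocks h ≤ 2 ^ h.size := by
    have := Nat.div_le_self h (h.size ^ 2)
    have := Nat.lt_size_self h
    rw [blocks]
    omega
  have h2 : RAM.width k h ≤ 2 ^ h.size := by
    have := hB.mul_pow_le (c := 1) (i := 3 * k + 2) (by omega) (by omega)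
    have := Nat.lt_size_self h
    rw [RAM.width]
    omega
  have h4 : 2 ≤ 2 ^ h.size := Nat.le_self_pow (size_pos hh).ne' 2
  calc 2 * (blocks h * RAM.width k h) ≤ 2 ^ h.size * (2 ^ h.size * 2 ^ h.size) :=
        Nat.mul_le_mul h4 (Nat.mul_le_mul h1 h2)
    _ = _ := by rw [← pow_add, ← pow_add]; congr 1; ring

/-- The binary logarithm of a bound for the dimensions of the instances. -/
noncomputable def dim (k h : ℕ) : ℕ := 3 * h.size * ((par k h).R * (par k h).T) + h.size + 2

/-- Dividing by `h.size` gives an exponent of at most `(h + 1) / h.size`, which is `eta N * log N`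
for `N = 2 ^ (h + 1)`. -/
theorem dim_mul_le (hB : Big m h) (h3 : 3 * k + 7 ≤ m) : dim k h * h.size ≤ h + 1 := by
  have h1 := (hB.le_two_pow h3).1
  have hm := hB.le_size
  have e : (par k h).R * (par k h).T * h.size ^ 3 = (par k h).R * h.size ^ (3 * k + 5) := by
    change _ * h.size ^ (3 * k + 2) * _ = _
    ring
  have h4 : 7 * ((par k h).R * (par k h).T * h.size ^ 2) ≤ h := by
    calc _ ≤ h.size * ((par k h).R * (par k h).T * h.size ^ 2) :=
          Nat.mul_le_mul_right _ (by omega)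
      _ = (par k h).R * (par k h).T * h.size ^ 3 := by ring
      _ ≤ h := e ▸ h1
  have h5 := hB.mul_pow_le (c := 6) (i := 2) (by omega) (by omega)
  have h6 : h.size ≤ h.size ^ 2 := Nat.le_self_pow (by omega) _
  have e2 : dim k h * h.size = 3 * ((par k h).R * (par k h).T * h.size ^ 2) + h.size ^ 2 +
      2 * h.size := by rw [dim]; ring
  omega

theorem Q_le (hB : Big m h) (h3 : 3 * k + 7 ≤ m) :
    (par k h).Q ≤ 2 ^ (3 * h.size * ((par k h).R * (par k h).T)) := by
  rw [Par.Q, pow_mul (2 : ℕ)]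
  exact Nat.pow_le_pow_left (hB.field_le h3) _

theorem two_Q_add_le (hB : Big m h) (h3 : 3 * k + 7 ≤ m) {x : ℕ} (hx : x ≤ 2 ^ h.size) :
    2 * (par k h).Q + x ≤ 2 ^ dim k h := by
  have h1 := hB.Q_le h3
  rw [dim, pow_add, pow_add]
  generalize 2 ^ (3 * h.size * ((par k h).R * (par k h).T)) = A at *
  generalize hD : 2 ^ h.size = D at *
  have hD0 : 0 < D := hD ▸ Nat.two_pow_pos _
  have hA : 0 < A := (Nat.pow_pos (field_spec (hB.pos (by omega))).1.pos).trans_le h1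
  nlinarith [Nat.mul_le_mul hA hD0, Nat.mul_le_mul_left A hD0, Nat.mul_le_mul_right D hA]

theorem L_le (hB : Big m h) (h3 : 3 * k + 7 ≤ m) : (par k h).q ^ (par k h).R ≤ 2 ^ dim k h := by
  have hq : 0 < (par k h).q := (field_spec (hB.pos (by omega))).1.pos
  have hT : 0 < (par k h).T := Nat.pow_pos (size_pos (hB.pos (by omega)))
  have h1 := hB.two_Q_add_le h3 (x := 0) (Nat.zero_le _)
  have h2 : (par k h).q ^ (par k h).R ≤ (par k h).Q :=
    Nat.pow_le_pow_right hq (Nat.le_mul_of_pos_right _ hT)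
  omega

theorem size_le (hB : Big m h) (h3 : 3 * k + 7 ≤ m) :
    (par k h).size ≤ 2 ^ (h + 2 * dim k h + 3) := by
  have h1 := hB.L_le h3
  have h2 := hB.two_Q_add_le h3 (Nat.lt_size_self h).le
  have h4 := Nat.mul_le_mul_left (2 ^ h) (Nat.mul_le_mul h1 h2)
  have h5 := Nat.mul_le_mul_left (2 ^ h) h1
  have h6 : 2 ^ h * 2 ^ dim k h ≤ 2 ^ h * (2 ^ dim k h * 2 ^ dim k h) :=
    Nat.mul_le_mul_left _ (Nat.le_mul_of_pos_left _ (Nat.two_pow_pos _))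
  have h7 : 1 ≤ 2 ^ h * (2 ^ dim k h * 2 ^ dim k h) := Nat.succ_le_of_lt (by positivity)
  have e : 2 ^ (h + 2 * dim k h + 3) = 8 * (2 ^ h * (2 ^ dim k h * 2 ^ dim k h)) := by ring
  have e2 : (par k h).size = 5 + 2 ^ h * ((par k h).q ^ (par k h).R * (2 * (par k h).Q + h)) +
    2 ^ h * (par k h).q ^ (par k h).R := rfl
  rw [e, e2]
  omega

/-- The exponent is about `8 * h / h.size`, hence `o(h)`: branches contribute `2 * h.size` bits per
block, announcements `6 * h.size`. -/
theorem advices_le (hB : Big m h) (h1 : 4 * k * 5 ^ k ≤ m) (h3 : 3 * k + 7 ≤ m) :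
    advices k h ≤ 2 ^ (8 * h.size * blocks h) := by
  have hs : steps k h + 1 ≤ 2 ^ (2 * h.size) := by
    have h4 := hB.mul_pow_le (c := 4 * k * 5 ^ k) (i := 3 * k) h1 (by omega)
    have h5 := Nat.lt_size_self h
    have e : steps k h = 4 * k * 5 ^ k * h.size ^ (3 * k) * h := by
      rw [steps, dens, mul_pow, ← pow_mul]
      ring
    have h6 := Nat.mul_le_mul_right h h4
    rw [e, two_mul, pow_add]
    nlinarith
  calc advices k h ≤ (2 ^ (2 * h.size)) ^ blocks h * (2 ^ (3 * h.size)) ^ (2 * blocks h) :=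
        Nat.mul_le_mul (Nat.pow_le_pow_left hs _) (Nat.pow_le_pow_left (hB.field_le h3) _)
    _ = _ := by rw [← pow_mul, ← pow_mul, ← pow_add]; congr 1; ring

end Big
end RAM

namespace RAM

/-! ### The bounds of the theorem -/

/-- A parameter that tends to infinity slowly with the number `N` of vectors. -/
def slow (N : ℕ) : ℕ := (Nat.log 2 N - 1).size

noncomputable def eta (N : ℕ) : ℝ := 1 / (slow N : ℝ)

noncomputable def delta (N : ℕ) : ℝ := ((slow N).size : ℝ) ^ 2 / (slow N : ℝ)

theorem tendsto_slow : Tendsto slow atTop atTop := by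
  refine tendsto_size.comp ((tendsto_sub_atTop_nat 1).comp ?_)
  exact tendsto_atTop_atTop.2 fun m => ⟨2 ^ m, fun a h => by
    simpa using Nat.log_mono_right (b := 2) h⟩

theorem tendsto_eta : Tendsto eta atTop (𝓝 0) :=
  tendsto_one_div_atTop_nhds_zero_nat.comp tendsto_slow

/-- With `s` the bit length of `slow N`, the value is at most `2 * s ^ 2 / 2 ^ s`. -/
theorem tendsto_delta : Tendsto delta atTop (𝓝 0) := by
  have h : Tendsto (fun s : ℕ => 2 * ((s : ℝ) ^ 2 / 2 ^ s)) atTop (𝓝 0) := by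
    simpa using (tendsto_pow_const_div_const_pow_of_one_lt 2 (one_lt_two : (1 : ℝ) < 2)).const_mul 2
  refine tendsto_of_tendsto_of_tendsto_of_le_of_le' tendsto_const_nhds
    (h.comp (tendsto_size.comp tendsto_slow)) (.of_forall fun N => by unfold delta; positivity) ?_
  filter_upwards [tendsto_slow.eventually_gt_atTop 0] with N hN
  have h1 : (2 : ℝ) ^ (slow N).size ≤ 2 * (slow N : ℝ) := by exact_mod_cast two_pow_size_le hN
  have h2 : (0 : ℝ) < slow N := by exact_mod_cast hN
  simp only [Function.comp, delta]
  rw [mul_div_assoc', div_le_div_iff₀ h2 (by positivity)]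
  nlinarith [mul_le_mul_of_nonneg_left h1 (sq_nonneg ((slow N).size : ℝ))]

@[simp] theorem slow_two_pow (h : ℕ) : slow (2 ^ (h + 1)) = h.size := by
  simp [slow, Nat.log_pow]

namespace Big
variable {m k h : ℕ}

theorem le_rpow_eta (hB : Big m h) (h3 : 3 * k + 7 ≤ m) {x : ℕ} (hx : x ≤ 2 ^ dim k h) :
    (x : ℝ) ≤ ((2 ^ (h + 1) : ℕ) : ℝ) ^ eta (2 ^ (h + 1)) := by
  have h0 : (0 : ℝ) < h.size := by exact_mod_cast size_pos (hB.pos (by omega))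
  have h1 : (dim k h : ℝ) * h.size ≤ h + 1 := by exact_mod_cast hB.dim_mul_le h3
  have h2 : (x : ℝ) ≤ (2 : ℝ) ^ (dim k h : ℝ) := by
    rw [Real.rpow_natCast]
    exact_mod_cast hx
  refine h2.trans ?_
  rw [Nat.cast_pow, Nat.cast_ofNat, ← Real.rpow_natCast, ← Real.rpow_mul (by norm_num), eta,
    slow_two_pow]
  refine Real.rpow_le_rpow_of_exponent_le (by norm_num) ?_
  rw [mul_one_div, le_div_iff₀ h0]
  exact_mod_cast h1

/-- Up to a factor two, `R` is `(h + 1) / h.size ^ (3 * k + 5)`, so `(h + 1) ^ delta` has to beat a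
power of `h.size` whose exponent depends on `k`. The square in `delta` does this for every `k` once
`h.size.size` is large. -/
theorem rpow_delta_le (hB : Big m h) (h3 : 6 * k + 12 ≤ m) :
    Real.logb 2 ((2 ^ (h + 1) : ℕ) : ℝ) ^ (1 - delta (2 ^ (h + 1))) ≤ (par k h).R := by
  obtain ⟨-, h1, h2⟩ := hB.le_two_pow (k := k) (by omega)
  have hh := hB.pos (by omega)
  have hm := hB.le_size
  have hb : (2 : ℝ) ≤ h.size := by exact_mod_cast (show 2 ≤ h.size by omega)
  have hs : (6 * k + 12 : ℝ) ≤ h.size.size := by exact_mod_cast h3.trans hB.size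
  have e : Real.logb 2 ((2 ^ (h + 1) : ℕ) : ℝ) = h + 1 := by
    rw [Nat.cast_pow, Nat.cast_ofNat, ← Real.rpow_natCast, Real.logb_rpow (by norm_num)
      (by norm_num)]
    push_cast
    rfl
  have h4 : (2 : ℝ) ^ ((h.size : ℝ) - 1) ≤ h + 1 := by
    have : (2 : ℝ) ^ h.size ≤ 2 * h := by exact_mod_cast two_pow_size_le hh
    rw [Real.rpow_sub_one (by norm_num), Real.rpow_natCast]
    linarith
  have h5 : (2 : ℝ) * (h.size : ℝ) ^ (3 * k + 5) ≤ ((h : ℝ) + 1) ^ delta (2 ^ (h + 1)) := by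
    have h6 : (h.size : ℝ) ≤ 2 ^ h.size.size := by exact_mod_cast (Nat.lt_size_self _).le
    calc (2 : ℝ) * (h.size : ℝ) ^ (3 * k + 5) ≤ 2 * (2 ^ h.size.size) ^ (3 * k + 5) := by gcongr
      _ = (2 : ℝ) ^ ((1 + h.size.size * (3 * k + 5) : ℕ) : ℝ) := by
        rw [Real.rpow_natCast]
        ring
      _ ≤ (2 : ℝ) ^ (((h.size : ℝ) - 1) * delta (2 ^ (h + 1))) := by
        refine Real.rpow_le_rpow_of_exponent_le (by norm_num) ?_
        rw [delta, slow_two_pow, mul_div_assoc', le_div_iff₀ (by linarith)]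
        push_cast
        -- The factor two compensates for `h.size - 1` being only at least half of `h.size`.
        have h7 : (1 + (h.size.size : ℝ) * (3 * k + 5)) * 2 ≤ (h.size.size : ℝ) ^ 2 := by
          have : (0 : ℝ) ≤ k := by positivity
          nlinarith
        nlinarith [mul_le_mul_of_nonneg_right h7 (show (0 : ℝ) ≤ h.size by linarith),
          mul_nonneg (sq_nonneg (h.size.size : ℝ)) (sub_nonneg.2 hb)]
      _ = ((2 : ℝ) ^ ((h.size : ℝ) - 1)) ^ delta (2 ^ (h + 1)) := Real.rpow_mul (by norm_num) _ _
      _ ≤ _ := Real.rpow_le_rpow (by positivity) h4 (by unfold delta; positivity)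
  have h6 : (h + 1 : ℝ) ≤ (par k h).R * (2 * (h.size : ℝ) ^ (3 * k + 5)) := by
    have : h + 1 ≤ (par k h).R * (2 * h.size ^ (3 * k + 5)) := by
      refine h1.trans ?_
      rw [← mul_assoc]
      exact Nat.mul_le_mul_right _ (by omega)
    exact_mod_cast this
  rw [e, Real.rpow_sub (by positivity), Real.rpow_one, div_le_iff₀ (by positivity)]
  exact h6.trans (by gcongr)

/-- In units of `ε * h / 128`, the advice costs at most 16, the polynomial overhead 1, and the
additive constants 1; together this is well below the available `ε * h / 2`. -/
theorem exponent_le (hB : Big m h) {c : ℕ} {ε : ℝ} (hm : 3 ≤ m) (hc : 2 * c ≤ m) (h0 : 0 < ε)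
    (hε : 128 ≤ ε * m) :
    ((8 * h.size * blocks h + 1 : ℕ) : ℝ) + ((h.size + 1) * c : ℕ) + (h + 1) * (2 - ε) ≤
      (2 - ε / 2) * h := by
  have hs := hB.le_size
  have hb : (128 : ℝ) ≤ ε * h.size := hε.trans (by gcongr)
  have hb0 : (0 : ℝ) < h.size := by exact_mod_cast (show 0 < h.size by omega)
  have hhr : (0 : ℝ) ≤ h := by positivity
  have key : ∀ x y : ℝ, 0 ≤ y → x * h.size ≤ y * h → x ≤ y * (ε * h / 128) := fun x y hy hx => by
    have h1 : y * h ≤ y * (ε * h / 128) * h.size := by nlinarith [mul_nonneg hy hhr]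
    exact le_of_mul_le_mul_right (hx.trans h1) hb0
  have h1 := key (8 * h.size * blocks h : ℕ) 16 (by norm_num) (by
    have := hB.blocks_mul_le (by omega)
    have h2 : 8 * h.size * blocks h * h.size ≤ 16 * h := by
      calc 8 * h.size * blocks h * h.size = 8 * (blocks h * h.size ^ 2) := by ring
        _ ≤ _ := by omega
    exact_mod_cast h2)
  have h2 := key ((h.size + 1) * c : ℕ) 1 (by norm_num) (by
    have := hB.mul_pow_le hc (i := 2) (by omega)
    have h2 : (h.size + 1) * c * h.size ≤ 1 * h := by
      calc (h.size + 1) * c * h.size ≤ (h.size + h.size) * c * h.size :=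
            Nat.mul_le_mul_right _ (Nat.mul_le_mul_right _ (by omega))
        _ = 2 * c * h.size ^ 2 := by ring
        _ ≤ _ := by omega
    exact_mod_cast h2)
  have h3 := key 3 1 (by norm_num) (by
    have := hB.mul_pow_le (c := 3) (i := 1) hm (by omega)
    have h2 : 3 * h.size ≤ 1 * h := by simpa using this
    exact_mod_cast h2)
  push_cast at h1 h2 ⊢
  nlinarith

theorem time_le (hB : Big m h) {c : ℕ} {ε C : ℝ} (h1 : 4 * k * 5 ^ k ≤ m) (h3 : 3 * k + 7 ≤ m)
    (hc : 2 * c ≤ m) (h8 : 16 ≤ m) (h0 : 0 < ε) (h0' : ε ≤ 1 / 2) (hε : 128 ≤ ε * m) (hC : 0 ≤ C)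
    {t : ℕ} (ht : t ≤ (advices k h + 1) *
      ((par k h).size + 1 + ⌊C * ((2 ^ (h + 1) : ℕ) : ℝ) ^ (2 - ε)⌋₊) * (h + 2) ^ c) :
    (t : ℝ) ≤ (2 + C) * 2 ^ ((2 - ε / 2) * h) := by
  have hs := hB.le_size
  have hN : ((2 ^ (h + 1) : ℕ) : ℝ) ^ (2 - ε) = 2 ^ ((h + 1) * (2 - ε)) := by
    rw [Nat.cast_pow, Nat.cast_ofNat, ← Real.rpow_natCast, ← Real.rpow_mul (by norm_num)]
    push_cast
    rfl
  rw [hN] at ht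
  have ha : ((advices k h + 1 : ℕ) : ℝ) ≤ 2 ^ ((8 * h.size * blocks h + 1 : ℕ) : ℝ) := by
    rw [Real.rpow_natCast]
    have := hB.advices_le h1 h3
    have h4 := Nat.two_pow_pos (8 * h.size * blocks h)
    exact_mod_cast (show _ ≤ 2 ^ _ by rw [pow_succ]; omega)
  -- Writing down an instance costs about `2 ^ (h + 2 * dim k h)`, which is less than the running
  -- time allowed to the distinguisher because `ε ≤ 1 / 2`.
  have hl : (((par k h).size + 1 : ℕ) : ℝ) ≤ 2 * 2 ^ ((h + 1) * (2 - ε)) := by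
    have h5 := hB.size_le h3
    have h6 := Nat.two_pow_pos (h + 2 * dim k h + 3)
    have h7 : (((par k h).size + 1 : ℕ) : ℝ) ≤ 2 * 2 ^ ((h + 2 * dim k h + 3 : ℕ) : ℝ) := by
      rw [Real.rpow_natCast]
      exact_mod_cast (show _ ≤ 2 * 2 ^ _ by omega)
    refine h7.trans (mul_le_mul_of_nonneg_left
      (Real.rpow_le_rpow_of_exponent_le (by norm_num) ?_) (by norm_num))
    have h9 : dim k h * 16 ≤ h + 1 :=
      (Nat.mul_le_mul_left _ (h8.trans hs)).trans (hB.dim_mul_le h3)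
    have h10 : (dim k h : ℝ) * 16 ≤ h + 1 := by exact_mod_cast h9
    have h11 : (16 : ℝ) ≤ h := by
      have h12 : 16 ≤ h := by simpa using hB.mul_pow_le (c := 16) (i := 0) h8 (by omega)
      exact_mod_cast h12
    have h12 : ((h + 2 * dim k h + 3 : ℕ) : ℝ) = h + 2 * dim k h + 3 := by push_cast; rfl
    rw [h12]
    have h13 : ((h : ℝ) + 1) * (3 / 2) ≤ (h + 1) * (2 - ε) :=
      mul_le_mul_of_nonneg_left (by linarith) (by linarith)
    linarith
  have hp : (((h + 2) ^ c : ℕ) : ℝ) ≤ 2 ^ (((h.size + 1) * c : ℕ) : ℝ) := by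
    have h5 := Nat.lt_size_self h
    have h6 : 2 ≤ 2 ^ h.size := Nat.le_self_pow (by omega) 2
    have h7 : (h + 2) ^ c ≤ 2 ^ ((h.size + 1) * c) := by
      rw [pow_mul]
      exact Nat.pow_le_pow_left (by rw [pow_succ]; omega) c
    rw [Real.rpow_natCast]
    calc _ ≤ ((2 ^ ((h.size + 1) * c) : ℕ) : ℝ) := Nat.cast_le.2 h7
      _ = _ := by rw [Nat.cast_pow, Nat.cast_ofNat]
  have hf : ((⌊C * 2 ^ (((h : ℝ) + 1) * (2 - ε))⌋₊ : ℕ) : ℝ) ≤ C * 2 ^ (((h : ℝ) + 1) * (2 - ε)) :=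
    Nat.floor_le (by positivity)
  calc (t : ℝ) ≤ ((advices k h + 1 : ℕ) : ℝ) * ((((par k h).size + 1 : ℕ) : ℝ) +
        (⌊C * 2 ^ (((h : ℝ) + 1) * (2 - ε))⌋₊ : ℕ)) * (((h + 2) ^ c : ℕ) : ℝ) := by
        exact_mod_cast ht
    _ ≤ 2 ^ ((8 * h.size * blocks h + 1 : ℕ) : ℝ) * (2 * 2 ^ (((h : ℝ) + 1) * (2 - ε)) +
        C * 2 ^ (((h : ℝ) + 1) * (2 - ε))) * 2 ^ (((h.size + 1) * c : ℕ) : ℝ) := by gcongr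
    _ = (2 + C) * 2 ^ (((8 * h.size * blocks h + 1 : ℕ) : ℝ) + ((h.size + 1) * c : ℕ) +
        (h + 1) * (2 - ε)) := by
        rw [Real.rpow_add (by norm_num), Real.rpow_add (by norm_num)]
        ring
    _ ≤ _ := by
        gcongr
        · norm_num
        · exact hB.exponent_le (by omega) hc h0 hε

end Big

theorem AcceptsWithin.mono {p : Prog} {l : List ℕ} {T T' : ℝ} (h : AcceptsWithin p l T)
    (hT : T ≤ T') : AcceptsWithin p l T' := by
  obtain ⟨t, s, h1, h2, h3⟩ := h
  exact ⟨t, s, h1, h2.trans hT, h3⟩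

theorem RejectsWithin.mono {p : Prog} {l : List ℕ} {T T' : ℝ} (h : RejectsWithin p l T)
    (hT : T ≤ T') : RejectsWithin p l T' := by
  obtain ⟨t, s, h1, h2, h3⟩ := h
  exact ⟨t, s, h1, h2.trans hT, h3⟩

end RAM

/-! ### From a distinguisher to a satisfiability algorithm -/

theorem PCPVectors.Sound.mono {I : PCPVectors} {τ τ' : ℝ} (h : I.Sound τ) (hτ : τ ≤ τ') :
    I.Sound τ' := fun a ha b hb => (h a ha b hb).trans hτ

theorem PCPVectors.one_le_N (I : PCPVectors) : 1 ≤ I.N :=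
  (List.length_pos_of_ne_nil I.A_ne_nil).trans_le (Nat.le_add_right _ _)

-- With `h` about `n / 2`, the time `2 ^ ((2 - ε / 2) * h)` becomes `2 ^ ((1 - ε / 4) * n)` up to a
-- constant factor. The offset `n₀` in `half` makes the parameters valid for every `n`.
open RAM in
theorem solvesKSAT_of_distinguishes {p : Prog} {ε C : ℝ} (h0 : 0 < ε) (h0' : ε ≤ 1 / 2)
    (hC : 0 ≤ C) {k : ℕ} (hk : 0 < k)
    (hp : ∀ I : PCPVectors,
      (I.L : ℝ) ≤ (I.N : ℝ) ^ eta I.N → (I.K : ℝ) ≤ (I.N : ℝ) ^ eta I.N →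
      (I.S : ℝ) ≤ (I.N : ℝ) ^ eta I.N →
      (I.Complete → AcceptsWithin p I.encode (C * (I.N : ℝ) ^ (2 - ε))) ∧
      (I.Sound (1 / (2 : ℝ) ^ (Real.logb 2 (I.N : ℝ) ^ (1 - delta I.N))) →
        RejectsWithin p I.encode (C * (I.N : ℝ) ^ (2 - ε)))) :
    ∃ P : Prog, SolvesKSAT k (ε / 4) P := by
  obtain ⟨n₀, hn₀⟩ := eventually_atTop.1
    (eventually_big (4 * k * 5 ^ k + 4 * k ^ 2 + (6 * k + 12)))
  have hB : ∀ n, Big (4 * k * 5 ^ k + 4 * k ^ 2 + (6 * k + 12)) (half n₀ n) := fun n =>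
    hn₀ _ (Nat.le_add_left _ _)
  have hL : ∀ n, Large k (half n₀ n) := fun n => (hB n).large hk (by omega) (by omega) (by omega)
  obtain ⟨P, c, hP⟩ := exists_sat hk hL p
  -- The exponent `c` is known only after `n₀` has fixed the program, so the time estimate needs a
  -- second threshold. The finitely many `n` below `2 * n₁` are covered by adding their time bounds
  -- to the constant.
  obtain ⟨n₁, hn₁⟩ := eventually_atTop.1
    (eventually_big (4 * k * 5 ^ k + (6 * k + 16) + 2 * c + ⌈128 / ε⌉₊))
  let B : ℕ → ℕ := fun n => (advices k (half n₀ n) + 1) * ((par k (half n₀ n)).size + 1 +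
    ⌊C * ((2 ^ (half n₀ n + 1) : ℕ) : ℝ) ^ (2 - ε)⌋₊) * (half n₀ n + 2) ^ c
  refine ⟨P, (2 + C) * 2 ^ (2 * (n₀ + 1) : ℝ) + (∑ n ∈ Finset.range (2 * n₁), B n : ℕ),
    fun n φ => ?_⟩
  have hI : ∀ j, ((hL n).instance_ φ j).N = 2 ^ (half n₀ n + 1) := fun j => Par.N_inst ..
  obtain ⟨t, s, e, ht, hs⟩ := hP n φ (C * ((2 ^ (half n₀ n + 1) : ℕ) : ℝ) ^ (2 - ε)) (by
    intro j _
    have h := hp ((hL n).instance_ φ j)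
    rw [hI] at h
    obtain ⟨h1, h2⟩ := h ((hB n).le_rpow_eta (k := k) (by omega) ((hB n).L_le (by omega)))
      ((hB n).le_rpow_eta (k := k) (by omega)
        ((hB n).two_Q_add_le (by omega) (Nat.lt_size_self _).le))
      ((hB n).le_rpow_eta (k := k) (by omega) ((hB n).two_Q_add_le (by omega)
        (Nat.le_self_pow (size_pos (hL n).hh).ne' 2)))
    refine ⟨h1, fun hS => h2 (hS.mono ?_)⟩
    have h3 := (hB n).rpow_delta_le (k := k) (by omega)
    rw [← Real.rpow_natCast]
    exact one_div_le_one_div_of_le (by positivity)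
      (Real.rpow_le_rpow_of_exponent_le (by norm_num) h3))
  have hT : (t : ℝ) ≤ ((2 + C) * 2 ^ (2 * (n₀ + 1) : ℝ) +
      (∑ n ∈ Finset.range (2 * n₁), B n : ℕ)) * 2 ^ ((1 - ε / 4) * (n : ℝ)) := by
    rw [add_mul]
    by_cases hn : n < 2 * n₁
    · have h1 : t ≤ ∑ n ∈ Finset.range (2 * n₁), B n :=
        ht.trans (Finset.single_le_sum (f := B) (fun _ _ => Nat.zero_le _) (Finset.mem_range.2 hn))
      have h2 : (1 : ℝ) ≤ 2 ^ ((1 - ε / 4) * (n : ℝ)) :=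
        Real.one_le_rpow (by norm_num) (mul_nonneg (by linarith) (Nat.cast_nonneg n))
      have h3 : (t : ℝ) ≤ (∑ n ∈ Finset.range (2 * n₁), B n : ℕ) := by exact_mod_cast h1
      have h4 : 0 ≤ (2 + C) * 2 ^ (2 * (n₀ + 1) : ℝ) * (2 : ℝ) ^ ((1 - ε / 4) * (n : ℝ)) := by
        positivity
      have h5 := mul_le_mul_of_nonneg_left h2 (Nat.cast_nonneg (α := ℝ)
        (∑ n ∈ Finset.range (2 * n₁), B n))
      linarith
    · have hB' := hn₁ (half n₀ n) (by rw [half]; omega)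
      have hε : 128 ≤ ε * (4 * k * 5 ^ k + (6 * k + 16) + 2 * c + ⌈128 / ε⌉₊ : ℕ) := by
        have h1 := Nat.le_ceil (128 / ε)
        rw [div_le_iff₀ h0] at h1
        have h2 : (⌈128 / ε⌉₊ : ℝ) ≤ (4 * k * 5 ^ k + (6 * k + 16) + 2 * c + ⌈128 / ε⌉₊ : ℕ) :=
          Nat.cast_le.2 (Nat.le_add_left _ _)
        nlinarith
      have h1 := hB'.time_le (k := k) (c := c) (by omega) (by omega) (by omega) (by omega) h0 h0' hε
        hC ht
      have h2 : (half n₀ n : ℝ) ≤ n / 2 + (n₀ + 1) := by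
        have : 2 * half n₀ n ≤ n + 2 * n₀ + 1 := by rw [half]; omega
        have : (2 * half n₀ n : ℝ) ≤ n + 2 * n₀ + 1 := by exact_mod_cast this
        linarith
      have h3 : (2 : ℝ) ^ ((2 - ε / 2) * (half n₀ n : ℝ)) ≤
          2 ^ (2 * (n₀ + 1) : ℝ) * 2 ^ ((1 - ε / 4) * (n : ℝ)) := by
        rw [← Real.rpow_add (by norm_num)]
        refine Real.rpow_le_rpow_of_exponent_le (by norm_num) ?_
        have : (0 : ℝ) ≤ n₀ := Nat.cast_nonneg _
        nlinarith
      have h4 := mul_le_mul_of_nonneg_left h3 (show 0 ≤ 2 + C by linarith)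
      have h5 : (0 : ℝ) ≤ (∑ n ∈ Finset.range (2 * n₁), B n : ℕ) *
        2 ^ ((1 - ε / 4) * (n : ℝ)) := by positivity
      linarith
  exact ⟨fun hφ => ⟨t, s, e, hT, hs.1 hφ⟩, fun hφ => ⟨t, s, e, hT, hs.2 hφ⟩⟩

theorem mainTheorem1 (hSETH : SETH) :
    ∃ η δ : ℕ → ℝ, Tendsto η atTop (𝓝 0) ∧ Tendsto δ atTop (𝓝 0) ∧
      ∀ ε : ℝ, 0 < ε → ¬ ∃ p : RAM.Prog, PCPVectors.Distinguishes p η δ (2 - ε) := by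
  refine ⟨RAM.eta, RAM.delta, RAM.tendsto_eta, RAM.tendsto_delta, fun ε hε => ?_⟩
  rintro ⟨p, C, hp⟩
  -- Lowering `ε` to at most `1 / 2` and making `C` nonnegative only relax the time bound, since `N
  -- ≥ 1`.
  have hε' : 0 < min ε (1 / 2) := lt_min hε (by norm_num)
  obtain ⟨k, hk, hno⟩ := hSETH (min ε (1 / 2) / 4) (by positivity)
  refine hno (solvesKSAT_of_distinguishes (p := p) (C := max C 0) hε' (min_le_right _ _)
    (le_max_right _ _) (by omega) fun I h1 h2 h3 => ?_)
  have hT : C * (I.N : ℝ) ^ (2 - ε) ≤ max C 0 * (I.N : ℝ) ^ (2 - min ε (1 / 2)) := by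
    have hN : (1 : ℝ) ≤ I.N := by exact_mod_cast I.one_le_N
    exact mul_le_mul (le_max_left _ _)
      (Real.rpow_le_rpow_of_exponent_le hN (by linarith [min_le_left ε (1 / 2)]))
      (by positivity) (le_max_right _ _)
  obtain ⟨h4, h5⟩ := hp I h1 h2 h3
  exact ⟨fun h => (h4 h).mono hT, fun h => (h5 h).mono hT⟩
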